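/- For a slice regular function $f$ on a ball $B(0;R)=\{q\in\mathbb H: |q|<R\}$ that is not identically zero, list its zeros so that every point is repeated according to its isolated multiplicity, and every sphere $[\beta]$ of spherical multiplicity $m$ contributes $m$ pairs $\beta,\bar\beta$. Let $n_f(t)$ and $\bar n_f(t)$ be the number of elements of this list in $\{|q|<t\}$ and in $\{|q|\le t\}$, respectively ($t<R$), and let $M_g(R)=\max_{|q|=R}|g(q)|$ for $g$ continuous on $\{|q|\le R\}$. (Jensen inequality.) Let $r>0$, and let $f$ be slice regular on $B(0;er)$. Let $f=gh$ on $B(0;er)$, where $g$ and $h$ are slice regular on $B(0;er)$ and continuous on its closure, $g$ has at most spherical zeros (a real zero being regarded as a degenerate sphere), $h$ has at most isolated zeros, and $|g(0)|=|h(0)|=1$. Then $\bar n_f(r)$ is finite and $$n_f(r)\le \bar n_f(r)\le \log\bigl(M_g(er)\,M_h(er)\bigr).$$ The bound on $\bar n_f(r)$ is attained. Put $R=er$. For every $n\ge 0$, all $a_1,\dots,a_n\in\mathbb H$ with $|a_k|=r$ and every $u\in\mathbb H$ with $|u|=1$, the function $$\varphi = (e^{n}u)\star B_{a_1}\star\cdots\star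 B_{a_n},\qquad B_a(q)=(R^2-q\bar a)^{-\star}\star(q-a)R,$$ has a factorization $\varphi=gh$ as above, with $\bar n_\varphi(r)=n=\log\bigl(M_g(er)\,M_h(er)\bigr)$. -/

import Mathlib

open scoped Quaternion

noncomputable section

namespace SliceRegular

/-- The sphere `𝕊` of purely imaginary unit quaternions. -/
def imagUnits : Set ℍ := {I | I.re = 0 ∧ ‖I‖ = 1}

/-- `f` is (left) slice regular on `U` (used for open `U`): `f` is real differentiable on `U` and,
for every imaginary unit `I`, `(∂/∂x + I ∂/∂y) f(x + I y) = 0` on `U ∩ ℂ_I`. Since `f` is real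
differentiable, the two partial derivatives are its derivatives in the directions `1` and `I`. -/
structure SliceRegularOn (f : ℍ → ℍ) (U : Set ℍ) : Prop where
  differentiableAt : ∀ q ∈ U, DifferentiableAt ℝ f q
  dbar : ∀ I ∈ imagUnits, ∀ x y : ℝ, (x : ℍ) + y • I ∈ U →
    fderiv ℝ f ((x : ℍ) + y • I) 1 + I * fderiv ℝ f ((x : ℍ) + y • I) I = 0

/-- The imaginary unit `I_q = Im q / |Im q|` of a nonreal quaternion (and `0` for a real one), so
that `q = x + I_q y` with `x = Re q` and `y = |Im q|`. -/
def imagUnit (q : ℍ) : ℍ := ‖q.im‖⁻¹ • q.im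

/-- The component `α` in `f(x + I y) = α(x, y) + I β(x, y)`, at `x = Re q`, `y = |Im q|`:
`α = (f(x + I y) + f(x - I y)) / 2`. -/
def alpha (f : ℍ → ℍ) (q : ℍ) : ℍ := (2⁻¹ : ℝ) • (f q + f (star q))

/-- The component `β` in `f(x + I y) = α(x, y) + I β(x, y)`, at `x = Re q`, `y = |Im q|`:
`β = I (f(x - I y) - f(x + I y)) / 2` (it vanishes on the real axis). -/
def beta (f : ℍ → ℍ) (q : ℍ) : ℍ := (2⁻¹ : ℝ) • (imagUnit q * (f (star q) - f q))

/-- The slice regular product: for `f = α + I β` and `g = γ + I δ`, one has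
`f ⋆ g = (α γ - β δ) + I (α δ + β γ)`. -/
def starMul (f g : ℍ → ℍ) (q : ℍ) : ℍ :=
  (alpha f q * alpha g q - beta f q * beta g q) +
    imagUnit q * (alpha f q * beta g q + beta f q * alpha g q)

/-- The conjugate function `f^c = conj α + I conj β`. -/
def starConj (f : ℍ → ℍ) (q : ℍ) : ℍ := star (alpha f q) + imagUnit q * star (beta f q)

/-- The symmetrization `f^s = f ⋆ f^c`. -/
def symmetrization (f : ℍ → ℍ) : ℍ → ℍ := starMul f (starConj f)

/-- The inverse `f^{-⋆} = (f^s)⁻¹ f^c` with respect to the slice regular product. -/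
def starInv (f : ℍ → ℍ) (q : ℍ) : ℍ := (symmetrization f q)⁻¹ * starConj f q

/-- The sphere `[q] = {x + J y : J ∈ 𝕊}` of `q = x + I y`; it is `{q}` when `q` is real. -/
def sphereOf (q : ℍ) : Set ℍ := {p | p.re = q.re ∧ ‖p.im‖ = ‖q.im‖}

/-- The quadratic polynomial `(q - x₀)² + y₀²` whose zero set is the sphere of `q₀ = x₀ + I y₀`. -/
def spherePoly (q₀ q : ℍ) : ℍ := (q - (q₀.re : ℍ)) ^ 2 + ((‖q₀.im‖ ^ 2 : ℝ) : ℍ)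

/-- The spherical multiplicity of `f` at the sphere of the nonreal point `q₀`: the largest `m` with
`f(q) = [(q - x₀)² + y₀²]^m g(q)` for a slice regular `g` not vanishing identically on `[q₀]`. -/
def sphericalMult (f : ℍ → ℍ) (U : Set ℍ) (q₀ : ℍ) : ℕ :=
  sSup {m : ℕ | ∃ g : ℍ → ℍ, SliceRegularOn g U ∧ (∃ p ∈ sphereOf q₀, g p ≠ 0) ∧
    ∀ q ∈ U, f q = spherePoly q₀ q ^ m * g q}

/-- The isolated multiplicity of `f` at a real point `q₁`: the largest `k` with
`f(q) = (q - q₁)^k g(q)` for a slice regular `g` with `g(q₁) ≠ 0`. -/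
def realMult (f : ℍ → ℍ) (U : Set ℍ) (q₁ : ℍ) : ℕ :=
  sSup {k : ℕ | ∃ g : ℍ → ℍ, SliceRegularOn g U ∧ g q₁ ≠ 0 ∧
    ∀ q ∈ U, f q = (q - q₁) ^ k * g q}

/-- The isolated multiplicity of `f` at a nonreal point `q₁`: the largest length `k` of a list
`p₁, …, p_k` in the sphere `[q₁]`, starting with `p₁ = q₁` if nonempty and with no two consecutive
entries conjugate to each other, such that, for some `m` and some slice regular `g` without zeros
in `[q₁]`, `f = (q - p₁) ⋆ ⋯ ⋆ (q - p_k) ⋆ ([(q - x₁)² + y₁²]^m g)`. -/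
def nonrealMult (f : ℍ → ℍ) (U : Set ℍ) (q₁ : ℍ) : ℕ :=
  sSup {k : ℕ | ∃ (l : List ℍ) (m : ℕ) (g : ℍ → ℍ), l.length = k ∧ (∀ p ∈ l, p ∈ sphereOf q₁) ∧
    (∀ p ∈ l.head?, p = q₁) ∧ l.IsChain (fun p p' => star p' ≠ p) ∧
    SliceRegularOn g U ∧ (∀ p ∈ sphereOf q₁, g p ≠ 0) ∧
    ∀ q ∈ U, f q = (l.map (fun p z => z - p)).foldr starMul
      (fun z => spherePoly q₁ z ^ m * g z) q}

open Classical in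
/-- The isolated multiplicity of `f` at a point. -/
def isolatedMult (f : ℍ → ℍ) (U : Set ℍ) (q₁ : ℍ) : ℕ :=
  if q₁.im = 0 then realMult f U q₁ else nonrealMult f U q₁

/-- The number of terms lying in the axially symmetric set `s` of the list of zeros of the function
`f` (slice regular on `U`), in which each point is repeated according to its isolated multiplicity
and each sphere of spherical multiplicity `m` contributes `m` pairs of conjugate points. -/
def zeroCount (f : ℍ → ℍ) (U s : Set ℍ) : ℕ∞ :=
  {a : ℍ × ℕ | a.1 ∈ s ∧ a.2 < isolatedMult f U a.1}.encard +
    2 * {a : Set ℍ × ℕ | ∃ q ∈ s, q.im ≠ 0 ∧ a.1 = sphereOf q ∧ a.2 < sphericalMult f U q}.encard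

/-- `M_f(R) = max_{|q| = R} |f(q)|`. -/
def maxModulus (f : ℍ → ℍ) (R : ℝ) : ℝ := sSup ((fun q => ‖f q‖) '' Metric.sphere (0 : ℍ) R)

/-- The setting of the Jensen inequality on the ball of radius `R`: a slice regular `f` is written
as `f = g h`, where `g` has at most spherical zeros (a real point being a degenerate sphere), `h`
has at most isolated zeros, both are continuous up to the boundary, and `|g(0)| = |h(0)| = 1`. -/
structure IsJensenFactorization (R : ℝ) (f g h : ℍ → ℍ) : Prop where
  regular_f : SliceRegularOn f (Metric.ball 0 R)
  regular_g : SliceRegularOn g (Metric.ball 0 R)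
  regular_h : SliceRegularOn h (Metric.ball 0 R)
  continuousOn_g : ContinuousOn g (Metric.closedBall 0 R)
  continuousOn_h : ContinuousOn h (Metric.closedBall 0 R)
  eq_mul : ∀ q ∈ Metric.ball (0 : ℍ) R, f q = g q * h q
  spherical_g : ∀ q ∈ Metric.ball (0 : ℍ) R, g q = 0 → ∀ p ∈ sphereOf q, g p = 0
  isolated_h : ∀ q ∈ Metric.ball (0 : ℍ) R, h q = 0 → ∀ᶠ p in nhdsWithin q {q}ᶜ, h p ≠ 0
  norm_g_zero : ‖g 0‖ = 1
  norm_h_zero : ‖h 0‖ = 1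

/-- The Blaschke-type factor `(R² - q ā)^{-⋆} ⋆ (q - a) R` of the ball of radius `R`. -/
def blaschkeFactor (R : ℝ) (a : ℍ) : ℍ → ℍ :=
  starMul (starInv (fun q => ((R ^ 2 : ℝ) : ℍ) - q * star a)) (fun q => (q - a) * (R : ℍ))

/-- The function `e^n u ⋆ B_{a₁} ⋆ ⋯ ⋆ B_{a_n}`, where `u` is a constant and the `B_{a_k}` are the
Blaschke-type factors of the ball of radius `R`. -/
def blaschkeProduct (R : ℝ) {n : ℕ} (u : ℍ) (a : Fin n → ℍ) : ℍ → ℍ :=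
  starMul (fun _ => Real.exp n • u)
    ((List.ofFn fun k => blaschkeFactor R (a k)).foldr starMul (fun _ => 1))

end SliceRegular

end

/-! The proof moves everything to holomorphic functions of one complex variable. Every slice regular
`f` on a ball centred at `0` comes from a holomorphic stem `F` with values in the complexified
quaternions: `f(x + I y) = a + I b` whenever `F(x + ι y) = a + ι b`, with `F` symmetric under
conjugation (`SliceRegularOn.exists_isStem`; the converse is `sliceRegularOn_of_isStem`). The
⋆-product becomes the pointwise product of stems, and the symmetrization becomes the scalar
holomorphic function `D = normSq F`.

The zeros of `D` record those of `f` with multiplicity. At a nonreal `z₀` in the upper half plane,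
`F` factors into linear factors on the sphere of `z₀`, no two consecutive ones conjugate, a power of
the quadratic polynomial of the sphere, and a unit at `z₀`. Uniqueness of the length, the head and
the exponent identifies the multiplicities, and the order of `D` at `z₀` is the isolated
multiplicity plus twice the spherical one (`multiplicities_of_nonreal`). At a real point the order
is twice the multiplicity (`multiplicity_of_real`). Hence the zeros of `D` in `|z| ≤ r`, counted in
both half planes, number exactly twice those of `f`.

If `|f| ≤ M` then `|D| ≤ M²` by the parallelogram law, and `|D(0)| = |f(0)|² = 1`. The classical
Jensen bound `pow_le_of_zeros` with `R = er` gives `e^(2n) ≤ M²`, that is `n ≤ log M`. The maximum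
principle applied to `g` and `h` separately allows `M = M_g M_h`.

For sharpness, each quaternionic Blaschke factor has modulus one on `|q| = R`, and so does a
⋆-product of them, because `(f ⋆ g)(q) = f(q) g(f(q)⁻¹ q f(q))` where `f(q) ≠ 0` (`norm_ev_mul`). So
`|φ| = e^n` on the boundary. Splitting off a longest possible product of scalar Blaschke factors,
each vanishing on a whole sphere, leaves a factor with only isolated zeros
(`exists_spherical_factorization`). Both factors, suitably normalized, have constant modulus on the
boundary, with product `e^n`. The order of `D` shows that `φ` has at least `n` zeros, and the Jensen
bound itself shows that it has at most `n`. -/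

noncomputable section

namespace SliceRegular

open scoped ComplexConjugate

/-! ### The complexified quaternions -/

/-- The inclusion of the quaternions in the complexified quaternions. -/
def ofH (w : ℍ) : ℍ[ℂ] := ⟨w.re, w.imI, w.imJ, w.imK⟩

/-- The complexified quaternion with the given components. -/
def mkC (a b c d : ℂ) : ℍ[ℂ] := ⟨a, b, c, d⟩

/-- The component `a` of `a + ι b`, with `a`, `b` quaternions and `ι` the imaginary unit of `ℂ`. -/
def reH (X : ℍ[ℂ]) : ℍ := ⟨X.re.re, X.imI.re, X.imJ.re, X.imK.re⟩

/-- The component `b` of `a + ι b`, with `a`, `b` quaternions and `ι` the imaginary unit of `ℂ`. -/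
def imH (X : ℍ[ℂ]) : ℍ := ⟨X.re.im, X.imI.im, X.imJ.im, X.imK.im⟩

/-- Complex conjugation `a + ι b ↦ a - ι b` of the complexified quaternions. -/
def conjC (X : ℍ[ℂ]) : ℍ[ℂ] := ⟨conj X.re, conj X.imI, conj X.imJ, conj X.imK⟩

/-- The point `x + y I` for `z = x + ι y`. -/
def slice (I : ℍ) (z : ℂ) : ℍ := (z.re : ℍ) + z.im • I

/-- The evaluation `a + ι b ↦ a + I b`. -/
def ev (I : ℍ) (X : ℍ[ℂ]) : ℍ := reH X + I * imH X

section simps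
@[simp] lemma mkC_re (a b c d : ℂ) : (mkC a b c d).re = a := rfl
@[simp] lemma mkC_imI (a b c d : ℂ) : (mkC a b c d).imI = b := rfl
@[simp] lemma mkC_imJ (a b c d : ℂ) : (mkC a b c d).imJ = c := rfl
@[simp] lemma mkC_imK (a b c d : ℂ) : (mkC a b c d).imK = d := rfl
variable (w : ℍ) (X : ℍ[ℂ])
@[simp] lemma ofH_re : (ofH w).re = w.re := rfl
@[simp] lemma ofH_imI : (ofH w).imI = w.imI := rfl
@[simp] lemma ofH_imJ : (ofH w).imJ = w.imJ := rfl
@[simp] lemma ofH_imK : (ofH w).imK = w.imK := rfl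
@[simp] lemma reH_re : (reH X).re = X.re.re := rfl
@[simp] lemma reH_imI : (reH X).imI = X.imI.re := rfl
@[simp] lemma reH_imJ : (reH X).imJ = X.imJ.re := rfl
@[simp] lemma reH_imK : (reH X).imK = X.imK.re := rfl
@[simp] lemma imH_re : (imH X).re = X.re.im := rfl
@[simp] lemma imH_imI : (imH X).imI = X.imI.im := rfl
@[simp] lemma imH_imJ : (imH X).imJ = X.imJ.im := rfl
@[simp] lemma imH_imK : (imH X).imK = X.imK.im := rfl
@[simp] lemma conjC_re : (conjC X).re = conj X.re := rfl
@[simp] lemma conjC_imI : (conjC X).imI = conj X.imI := rfl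
@[simp] lemma conjC_imJ : (conjC X).imJ = conj X.imJ := rfl
@[simp] lemma conjC_imK : (conjC X).imK = conj X.imK := rfl
end simps

lemma ext_reH_imH {X Y : ℍ[ℂ]} (h1 : reH X = reH Y) (h2 : imH X = imH Y) : X = Y := by
  have a1 := congrArg (·.re) h1
  have a2 := congrArg (·.imI) h1
  have a3 := congrArg (·.imJ) h1
  have a4 := congrArg (·.imK) h1
  have b1 := congrArg (·.re) h2
  have b2 := congrArg (·.imI) h2
  have b3 := congrArg (·.imJ) h2
  have b4 := congrArg (·.imK) h2
  simp only [reH_re, reH_imI, reH_imJ, reH_imK, imH_re, imH_imI, imH_imJ, imH_imK] at a1 a2 a3 a4 b1 b2 b3 b4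
  ext <;> apply Complex.ext <;> assumption

lemma reH_add (X Y : ℍ[ℂ]) : reH (X + Y) = reH X + reH Y := by ext <;> simp
lemma imH_add (X Y : ℍ[ℂ]) : imH (X + Y) = imH X + imH Y := by ext <;> simp
lemma reH_sub (X Y : ℍ[ℂ]) : reH (X - Y) = reH X - reH Y := by ext <;> simp
lemma imH_sub (X Y : ℍ[ℂ]) : imH (X - Y) = imH X - imH Y := by ext <;> simp

lemma reH_mul (X Y : ℍ[ℂ]) : reH (X * Y) = reH X * reH Y - imH X * imH Y := by
  ext <;> simp <;> ring

lemma imH_mul (X Y : ℍ[ℂ]) : imH (X * Y) = reH X * imH Y + imH X * reH Y := by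
  ext <;> simp <;> ring

@[simp] lemma reH_ofH (w : ℍ) : reH (ofH w) = w := by ext <;> simp
@[simp] lemma imH_ofH (w : ℍ) : imH (ofH w) = 0 := by ext <;> simp
@[simp] lemma reH_coe (c : ℂ) : reH (c : ℍ[ℂ]) = (c.re : ℍ) := by ext <;> simp
@[simp] lemma imH_coe (c : ℂ) : imH (c : ℍ[ℂ]) = (c.im : ℍ) := by ext <;> simp
@[simp] lemma reH_conjC (X : ℍ[ℂ]) : reH (conjC X) = reH X := by ext <;> simp
@[simp] lemma imH_conjC (X : ℍ[ℂ]) : imH (conjC X) = - imH X := by ext <;> simp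
@[simp] lemma reH_star (X : ℍ[ℂ]) : reH (star X) = star (reH X) := by ext <;> simp
@[simp] lemma imH_star (X : ℍ[ℂ]) : imH (star X) = star (imH X) := by ext <;> simp
@[simp] lemma reH_zero : reH 0 = 0 := by ext <;> simp
@[simp] lemma imH_zero : imH 0 = 0 := by ext <;> simp

lemma conjC_mul (X Y : ℍ[ℂ]) : conjC (X * Y) = conjC X * conjC Y := by
  ext1 <;> simp
lemma conjC_sub (X Y : ℍ[ℂ]) : conjC (X - Y) = conjC X - conjC Y := by ext1 <;> simp
lemma conjC_smul (c : ℂ) (X : ℍ[ℂ]) : conjC (c • X) = conj c • conjC X := by ext1 <;> simp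
lemma conjC_star (X : ℍ[ℂ]) : conjC (star X) = star (conjC X) := by ext1 <;> simp
@[simp] lemma conjC_ofH (w : ℍ) : conjC (ofH w) = ofH w := by ext1 <;> simp
@[simp] lemma conjC_coe (c : ℂ) : conjC (c : ℍ[ℂ]) = (conj c : ℂ) := by ext1 <;> simp
@[simp] lemma conjC_conjC (X : ℍ[ℂ]) : conjC (conjC X) = X := by ext1 <;> simp
@[simp] lemma conjC_zero : conjC 0 = 0 := by ext1 <;> simp
lemma normSq_conjC (X : ℍ[ℂ]) :
    Quaternion.normSq (conjC X) = conj (Quaternion.normSq X) := by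
  simp [Quaternion.normSq_def']

@[simp] lemma ofH_one : ofH 1 = 1 := by ext1 <;> simp
@[simp] lemma ofH_zero : ofH 0 = 0 := by ext1 <;> simp
lemma ofH_coe (x : ℝ) : ofH (x : ℍ) = ((x : ℂ) : ℍ[ℂ]) := by ext1 <;> simp

lemma normSq_ofH (w : ℍ) : Quaternion.normSq (ofH w) = ((‖w‖ ^ 2 : ℝ) : ℂ) := by
  rw [sq, ← Quaternion.normSq_eq_norm_mul_self, Quaternion.normSq_def', Quaternion.normSq_def']
  simp

lemma eq_ofH_of_imH_eq_zero {X : ℍ[ℂ]} (h : imH X = 0) : X = ofH (reH X) :=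
  ext_reH_imH (by simp) (by simp [h])

/-! ### Imaginary units and slices -/

lemma imagUnits_mul_self {I : ℍ} (hI : I ∈ imagUnits) : I * I = -1 := by
  obtain ⟨h0, h1⟩ := hI
  have h : I * star I = 1 := by
    rw [Quaternion.self_mul_star, Quaternion.normSq_eq_norm_mul_self, h1]; simp
  have hs : star I = -I := Quaternion.star_eq_neg.2 h0
  rw [hs, mul_neg] at h
  rw [← h, neg_neg]

lemma imagUnits_star_eq {I : ℍ} (hI : I ∈ imagUnits) : star I = -I :=
  Quaternion.star_eq_neg.2 hI.1

lemma imagUnits_neg {I : ℍ} (hI : I ∈ imagUnits) : -I ∈ imagUnits := by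
  refine ⟨by simp [hI.1], by simp [hI.2]⟩

lemma imagUnits_im_eq {I : ℍ} (hI : I ∈ imagUnits) : I.im = I := by
  ext <;> simp [hI.1]

/-- The standard imaginary unit. -/
def unitI : ℍ := ⟨0, 1, 0, 0⟩

@[simp] lemma unitI_re : unitI.re = 0 := rfl
@[simp] lemma unitI_imI : unitI.imI = 1 := rfl
@[simp] lemma unitI_imJ : unitI.imJ = 0 := rfl
@[simp] lemma unitI_imK : unitI.imK = 0 := rfl

/-- The second standard imaginary unit. -/
def unitJ : ℍ := ⟨0, 0, 1, 0⟩

@[simp] lemma unitJ_re : unitJ.re = 0 := rfl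
@[simp] lemma unitJ_imI : unitJ.imI = 0 := rfl
@[simp] lemma unitJ_imJ : unitJ.imJ = 1 := rfl
@[simp] lemma unitJ_imK : unitJ.imK = 0 := rfl

/-- The third standard imaginary unit. -/
def unitK : ℍ := ⟨0, 0, 0, 1⟩

@[simp] lemma unitK_re : unitK.re = 0 := rfl
@[simp] lemma unitK_imI : unitK.imI = 0 := rfl
@[simp] lemma unitK_imJ : unitK.imJ = 0 := rfl
@[simp] lemma unitK_imK : unitK.imK = 1 := rfl

lemma mem_imagUnits_of_sq {I : ℍ} (h0 : I.re = 0)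
    (h1 : I.imI ^ 2 + I.imJ ^ 2 + I.imK ^ 2 = 1) : I ∈ imagUnits := by
  refine ⟨h0, ?_⟩
  have h := Quaternion.normSq_eq_norm_mul_self I
  rw [Quaternion.normSq_def', h0] at h
  have : ‖I‖ ^ 2 = 1 := by rw [sq, ← h]; linarith
  exact (pow_eq_one_iff_of_nonneg (norm_nonneg _) two_ne_zero).1 this

lemma unitI_mem : unitI ∈ imagUnits := mem_imagUnits_of_sq rfl (by simp)

@[simp] lemma slice_re_of_mem {I : ℍ} (hI : I ∈ imagUnits) (z : ℂ) : (slice I z).re = z.re := by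
  simp [slice, hI.1]

@[simp] lemma slice_im_of_mem {I : ℍ} (hI : I ∈ imagUnits) (z : ℂ) :
    (slice I z).im = z.im • I := by
  simp [slice, (imagUnits_im_eq hI)]

lemma slice_neg (I : ℍ) (z : ℂ) : slice (-I) z = slice I (conj z) := by simp [slice]

lemma star_slice {I : ℍ} (hI : I ∈ imagUnits) (z : ℂ) : star (slice I z) = slice (-I) z := by
  simp [slice, (imagUnits_star_eq hI)]

lemma slice_eq_ev (I : ℍ) (z : ℂ) : slice I z = ev I (z : ℍ[ℂ]) := by
  simp [slice, ev, Quaternion.mul_coe_eq_smul]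

@[simp] lemma slice_ofReal (I : ℍ) (x : ℝ) : slice I x = (x : ℍ) := by simp [slice]
@[simp] lemma slice_zero (I : ℍ) : slice I 0 = 0 := by simp [slice]
@[simp] lemma slice_one (I : ℍ) : slice I 1 = 1 := by simp [slice]
lemma slice_I (I : ℍ) : slice I Complex.I = I := by simp [slice]

lemma norm_sq_slice {I : ℍ} (hI : I ∈ imagUnits) (z : ℂ) : ‖slice I z‖ ^ 2 = ‖z‖ ^ 2 := by
  have h := Quaternion.self_mul_star (slice I z)
  rw [star_slice hI] at h
  have h2 : slice I z * slice (-I) z = ((‖z‖ ^ 2 : ℝ) : ℍ) := by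
    have : ‖z‖ ^ 2 = z.re * z.re + z.im * z.im := by
      rw [← Complex.normSq_eq_norm_sq, Complex.normSq_apply]
    rw [this]
    simp only [slice, ← Quaternion.coe_mul_eq_smul]
    have hc : I * (z.im : ℍ) = (z.im : ℍ) * I := (Quaternion.coe_commutes _ _).symm
    have hc2 : I * (z.re : ℍ) = (z.re : ℍ) * I := (Quaternion.coe_commutes _ _).symm
    have hc3 : (z.re : ℍ) * (z.im : ℍ) = (z.im : ℍ) * z.re := Quaternion.coe_commutes _ _
    calc ((z.re : ℍ) + z.im * I) * (z.re + z.im * -I)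
        = z.re * z.re - (z.re * z.im) * I + z.im * (I * z.re) - z.im * (I * z.im) * I := by
          noncomm_ring
      _ = z.re * z.re - z.im * z.im * (I * I) := by rw [hc, hc2, hc3]; noncomm_ring
      _ = _ := by rw [(imagUnits_mul_self hI)]; simp
  rw [h2, Quaternion.coe_inj, Quaternion.normSq_eq_norm_mul_self] at h
  rw [sq, ← h]

@[simp] lemma norm_slice {I : ℍ} (hI : I ∈ imagUnits) (z : ℂ) : ‖slice I z‖ = ‖z‖ := by
  have := norm_sq_slice hI z
  exact (sq_eq_sq₀ (norm_nonneg _) (norm_nonneg _)).1 this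

/-- The point of the closed upper half plane which corresponds to the quaternion `q`. -/
def toC (q : ℍ) : ℂ := ⟨q.re, ‖q.im‖⟩

@[simp] lemma toC_re (q : ℍ) : (toC q).re = q.re := rfl
@[simp] lemma toC_im (q : ℍ) : (toC q).im = ‖q.im‖ := rfl

lemma slice_imagUnit (q : ℍ) : slice (imagUnit q) (toC q) = q := by
  rw [slice, imagUnit, toC_re, toC_im]
  by_cases h : q.im = 0
  · rw [h]; simpa [h] using Quaternion.re_add_im q
  · rw [smul_smul, mul_inv_cancel₀ (by simpa using h), one_smul, Quaternion.re_add_im]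

lemma imagUnit_mem {q : ℍ} (h : q.im ≠ 0) : imagUnit q ∈ imagUnits := by
  refine ⟨by simp [imagUnit], ?_⟩
  rw [imagUnit, norm_smul, norm_inv, norm_norm, inv_mul_cancel₀ (by simpa using h)]

lemma imagUnit_slice_pos {I : ℍ} (hI : I ∈ imagUnits) {z : ℂ} (h : 0 < z.im) :
    imagUnit (slice I z) = I := by
  rw [imagUnit, slice_im_of_mem hI, norm_smul, hI.2, mul_one, smul_smul, Real.norm_eq_abs,
    abs_of_pos h, inv_mul_cancel₀ h.ne', one_smul]

lemma imagUnit_slice_zero {I : ℍ} (hI : I ∈ imagUnits) {z : ℂ} (h : z.im = 0) :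
    imagUnit (slice I z) = 0 := by
  rw [imagUnit, slice_im_of_mem hI, h]; simp

lemma toC_slice {I : ℍ} (hI : I ∈ imagUnits) {z : ℂ} (h : 0 ≤ z.im) : toC (slice I z) = z := by
  apply Complex.ext
  · simp [hI]
  · simp [hI, norm_smul, hI.2, abs_of_nonneg h]

/-- Every quaternion lies on a slice, with its coordinate in the closed upper half plane. -/
lemma exists_slice_eq (q : ℍ) : ∃ I ∈ imagUnits, slice I (toC q) = q := by
  by_cases h : q.im = 0
  · refine ⟨unitI, unitI_mem, ?_⟩
    rw [slice, toC_im, h]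
    simpa [h] using Quaternion.re_add_im q
  · exact ⟨imagUnit q, imagUnit_mem h, slice_imagUnit q⟩

@[simp] lemma norm_toC (q : ℍ) : ‖toC q‖ = ‖q‖ := by
  obtain ⟨I, hI, h⟩ := exists_slice_eq q
  rw [← norm_slice hI, h]

lemma toC_im_nonneg (q : ℍ) : 0 ≤ (toC q).im := norm_nonneg _

lemma toC_im_eq_zero {q : ℍ} : (toC q).im = 0 ↔ q.im = 0 := by simp

lemma mem_sphereOf {p q : ℍ} : p ∈ sphereOf q ↔ toC p = toC q := by
  simp [sphereOf, Complex.ext_iff]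

/-! ### The evaluation map -/

@[simp] lemma ev_ofH (I w : ℍ) : ev I (ofH w) = w := by simp [ev]
@[simp] lemma ev_zero (I : ℍ) : ev I 0 = 0 := by simp [ev]
lemma ev_add (I : ℍ) (X Y : ℍ[ℂ]) : ev I (X + Y) = ev I X + ev I Y := by
  simp only [ev, reH_add, imH_add]; noncomm_ring
lemma ev_sub (I : ℍ) (X Y : ℍ[ℂ]) : ev I (X - Y) = ev I X - ev I Y := by
  simp only [ev, reH_sub, imH_sub]; noncomm_ring

/-- `ev I` is not a ring homomorphism, since `I` need not commute with the quaternionic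
coefficients. It is multiplicative when the left factor is a complex scalar (`ev_coe_mul`) or the
right factor is a quaternionic constant (`ev_mul_ofH`). -/
lemma ev_mul {I : ℍ} (hI : I ∈ imagUnits) (X Y : ℍ[ℂ]) :
    ev I (X * Y) = ev I X * reH Y + I * ev I X * imH Y := by
  simp only [ev, reH_mul, imH_mul]
  have : I * (reH X + I * imH X) = I * reH X - imH X := by
    rw [mul_add, ← mul_assoc, (imagUnits_mul_self hI)]; noncomm_ring
  rw [this]; noncomm_ring

lemma ev_mul_ofH (I : ℍ) (X : ℍ[ℂ]) (w : ℍ) :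
    ev I (X * ofH w) = ev I X * w := by
  simp only [ev, reH_mul, imH_mul, reH_ofH, imH_ofH]; noncomm_ring

lemma ev_coe_mul {I : ℍ} (hI : I ∈ imagUnits) (c : ℂ) (X : ℍ[ℂ]) :
    ev I ((c : ℍ[ℂ]) * X) = slice I c * ev I X := by
  rw [ev_mul hI, ← slice_eq_ev]
  have : I * slice I c = slice I c * I := by
    simp only [slice, mul_add, add_mul, mul_smul_comm, smul_mul_assoc]
    rw [Quaternion.coe_commutes]
  rw [this, ev]; noncomm_ring

lemma ev_smul {I : ℍ} (hI : I ∈ imagUnits) (c : ℂ) (X : ℍ[ℂ]) :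
    ev I (c • X) = slice I c * ev I X := by
  rw [← ev_coe_mul hI, Quaternion.coe_mul_eq_smul]

lemma slice_mul {I : ℍ} (hI : I ∈ imagUnits) (z w : ℂ) :
    slice I (z * w) = slice I z * slice I w := by
  rw [slice_eq_ev, Quaternion.coe_mul, ev_coe_mul hI, ← slice_eq_ev]

lemma slice_pow {I : ℍ} (hI : I ∈ imagUnits) (z : ℂ) (n : ℕ) :
    slice I (z ^ n) = slice I z ^ n := by
  induction n with
  | zero => simp
  | succ n ih => rw [pow_succ, pow_succ, slice_mul hI, ih]

lemma slice_inv {I : ℍ} (hI : I ∈ imagUnits) (z : ℂ) : slice I z⁻¹ = (slice I z)⁻¹ := by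
  by_cases h : z = 0
  · simp [h]
  · symm
    apply inv_eq_of_mul_eq_one_right
    rw [← slice_mul hI, mul_inv_cancel₀ h, slice_one]

lemma ev_neg (I : ℍ) (X : ℍ[ℂ]) : ev (-I) X = ev I (conjC X) := by simp [ev]

/-- Two elements with the same evaluation at two different imaginary units agree. -/
lemma eq_of_ev_eq {I J : ℍ} (hIJ : I ≠ J) {X Y : ℍ[ℂ]} (h1 : ev I X = ev I Y)
    (h2 : ev J X = ev J Y) : X = Y := by
  simp only [ev] at h1 h2
  have h : (I - J) * (imH X - imH Y) = 0 := by
    have : (I - J) * (imH X - imH Y) =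
        (reH X + I * imH X) - (reH Y + I * imH Y) - ((reH X + J * imH X) - (reH Y + J * imH Y)) := by
      noncomm_ring
    rw [this, h1, h2]; simp
  have hi : imH X = imH Y := by
    rcases mul_eq_zero.1 h with h | h
    · exact absurd (sub_eq_zero.1 h) hIJ
    · exact sub_eq_zero.1 h
  refine ext_reH_imH ?_ hi
  rwa [hi, add_left_inj] at h1

lemma eq_of_forall_ev_eq {X Y : ℍ[ℂ]} (h : ∀ I ∈ imagUnits, ev I X = ev I Y) : X = Y := by
  refine eq_of_ev_eq (I := unitI) (J := -unitI) ?_ (h _ unitI_mem) (h _ (imagUnits_neg unitI_mem))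
  intro h
  have := congrArg (·.imI) h
  norm_num at this

/-! ### Stem functions -/

/-- `F` is the stem function of the slice function `f` on the ball of radius `R`:
`f(x + I y) = a + I b` where `F(x + ι y) = a + ι b`. -/
def IsStem (R : ℝ) (f : ℍ → ℍ) (F : ℂ → ℍ[ℂ]) : Prop :=
  ∀ I ∈ imagUnits, ∀ z ∈ Metric.ball (0 : ℂ) R, f (slice I z) = ev I (F z)

/-- The components of `F` are holomorphic on `U`. -/
structure Holo (F : ℂ → ℍ[ℂ]) (U : Set ℂ) : Prop where
  re : DifferentiableOn ℂ (fun z => (F z).re) U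
  imI : DifferentiableOn ℂ (fun z => (F z).imI) U
  imJ : DifferentiableOn ℂ (fun z => (F z).imJ) U
  imK : DifferentiableOn ℂ (fun z => (F z).imK) U

lemma imH_eq_zero_of_conjC {X : ℍ[ℂ]} (h : X = conjC X) : imH X = 0 := by
  have h2 := congrArg imH h
  rw [imH_conjC] at h2
  have h3 : (2 : ℝ) • imH X = 0 := by
    rw [two_smul]; nth_rewrite 1 [h2]; simp
  simpa using h3

lemma conj_mem_ball {z : ℂ} {R : ℝ} : conj z ∈ Metric.ball (0 : ℂ) R ↔ z ∈ Metric.ball (0 : ℂ) R := by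
  simp

lemma toC_mem_ball {q : ℍ} {R : ℝ} : toC q ∈ Metric.ball (0 : ℂ) R ↔ q ∈ Metric.ball (0 : ℍ) R := by
  simp

lemma slice_mem_ball {I : ℍ} (hI : I ∈ imagUnits) {z : ℂ} {R : ℝ} :
    slice I z ∈ Metric.ball (0 : ℍ) R ↔ z ∈ Metric.ball (0 : ℂ) R := by
  simp [hI]

namespace IsStem
variable {R : ℝ} {f g : ℍ → ℍ} {F G : ℂ → ℍ[ℂ]}

/-- The pairs `(I, conj z)` and `(-I, z)` parametrize the same quaternion, and the evaluations at
all imaginary units determine an element. -/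
lemma apply_conj (hf : IsStem R f F) {z : ℂ} (hz : z ∈ Metric.ball (0 : ℂ) R) :
    F (conj z) = conjC (F z) := by
  refine eq_of_forall_ev_eq fun I hI => ?_
  rw [← ev_neg, ← hf _ hI _ (conj_mem_ball.2 hz), ← hf _ (imagUnits_neg hI) _ hz, slice_neg]

lemma imH_eq_zero (hf : IsStem R f F) {z : ℂ} (hz : z ∈ Metric.ball (0 : ℂ) R) (h : z.im = 0) :
    imH (F z) = 0 := by
  have h1 := hf.apply_conj hz
  rw [Complex.conj_eq_iff_im.2 h] at h1
  exact imH_eq_zero_of_conjC h1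

lemma apply_eq (hf : IsStem R f F) {q : ℍ} (hq : q ∈ Metric.ball (0 : ℍ) R) {I : ℍ}
    (hI : I ∈ imagUnits) (h : slice I (toC q) = q) : f q = ev I (F (toC q)) := by
  rw [← hf I hI _ (toC_mem_ball.2 hq), h]

/-- It suffices to know a slice function on the closed upper half planes. -/
lemma of_nonneg (hF : ∀ z ∈ Metric.ball (0 : ℂ) R, F (conj z) = conjC (F z))
    (h : ∀ I ∈ imagUnits, ∀ z ∈ Metric.ball (0 : ℂ) R, 0 ≤ z.im → f (slice I z) = ev I (F z)) :
    IsStem R f F := by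
  intro I hI z hz
  rcases le_total 0 z.im with h0 | h0
  · exact h I hI z hz h0
  · have := h (-I) (imagUnits_neg hI) (conj z) (conj_mem_ball.2 hz) (by simpa using h0)
    rwa [slice_neg, Complex.conj_conj, ev_neg, hF z hz, conjC_conjC] at this

lemma unique (hf : IsStem R f F) (hg : IsStem R f G) {z : ℂ} (hz : z ∈ Metric.ball (0 : ℂ) R) :
    F z = G z :=
  eq_of_forall_ev_eq fun I hI => by rw [← hf I hI z hz, hg I hI z hz]

lemma congr_left (hf : IsStem R f F) (h : ∀ q ∈ Metric.ball (0 : ℍ) R, g q = f q) :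
    IsStem R g F := fun I hI z hz => by rw [h _ ((slice_mem_ball hI).2 hz), hf I hI z hz]

lemma congr_right (hf : IsStem R f F) (h : ∀ z ∈ Metric.ball (0 : ℂ) R, F z = G z) :
    IsStem R f G := fun I hI z hz => by rw [← h z hz, hf I hI z hz]

lemma mono (hf : IsStem R f F) {R' : ℝ} (h : R' ≤ R) : IsStem R' f F :=
  fun I hI z hz => hf I hI z (Metric.ball_subset_ball h hz)

lemma alpha_eq (hf : IsStem R f F) {I : ℍ} (hI : I ∈ imagUnits) {z : ℂ}
    (hz : z ∈ Metric.ball (0 : ℂ) R) : alpha f (slice I z) = reH (F z) := by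
  rw [alpha, star_slice hI, hf I hI z hz, hf _ (imagUnits_neg hI) z hz, ev, ev]
  have : reH (F z) + I * imH (F z) + (reH (F z) + -I * imH (F z)) = (2 : ℝ) • reH (F z) := by
    rw [two_smul]; noncomm_ring
  rw [this, smul_smul]; norm_num

/-- The closed upper half plane is needed because `imagUnit (slice I z)` is `-I` below the real
axis. On the axis both sides vanish. -/
lemma beta_eq (hf : IsStem R f F) {I : ℍ} (hI : I ∈ imagUnits) {z : ℂ}
    (hz : z ∈ Metric.ball (0 : ℂ) R) (h0 : 0 ≤ z.im) : beta f (slice I z) = imH (F z) := by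
  rw [beta, star_slice hI, hf I hI z hz, hf _ (imagUnits_neg hI) z hz, ev, ev]
  rcases h0.eq_or_lt with h | h
  · rw [imagUnit_slice_zero hI h.symm, hf.imH_eq_zero hz h.symm]; simp
  · rw [imagUnit_slice_pos hI h]
    have : I * (reH (F z) + -I * imH (F z) - (reH (F z) + I * imH (F z))) =
        (2 : ℝ) • imH (F z) := by
      have : I * (reH (F z) + -I * imH (F z) - (reH (F z) + I * imH (F z))) =
        - ((I * I) * imH (F z) + (I * I) * imH (F z)) := by noncomm_ring
      rw [this, imagUnits_mul_self hI, two_smul]; noncomm_ring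
    rw [this, smul_smul]; norm_num

/-- `imagUnit` has the default value `0` at real points, where `I` is arbitrary; the two agree in
front of anything that vanishes there. -/
lemma imagUnit_mul_eq {I : ℍ} (hI : I ∈ imagUnits) {z : ℂ} (h0 : 0 ≤ z.im) {w : ℍ}
    (hw : z.im = 0 → w = 0) : imagUnit (slice I z) * w = I * w := by
  rcases h0.eq_or_lt with h | h
  · rw [hw h.symm]; simp
  · rw [imagUnit_slice_pos hI h]

/-- The formula defining the ⋆-product is multiplication of `α + ι β` and `γ + ι δ` with `ι`
central. This is what makes stems useful here. -/
lemma starMul (hf : IsStem R f F) (hg : IsStem R g G) :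
    IsStem R (starMul f g) (fun z => F z * G z) := by
  refine of_nonneg (fun z hz => ?_) fun I hI z hz h0 => ?_
  · rw [hf.apply_conj hz, hg.apply_conj hz, conjC_mul]
  · rw [SliceRegular.starMul, hf.alpha_eq hI hz, hg.alpha_eq hI hz, hf.beta_eq hI hz h0,
      hg.beta_eq hI hz h0, imagUnit_mul_eq hI h0, ev, reH_mul, imH_mul]
    intro h
    rw [hf.imH_eq_zero hz h, hg.imH_eq_zero hz h]; simp

lemma starConj (hf : IsStem R f F) : IsStem R (starConj f) (fun z => star (F z)) := by
  refine of_nonneg (fun z hz => ?_) fun I hI z hz h0 => ?_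
  · rw [hf.apply_conj hz, conjC_star]
  · rw [SliceRegular.starConj, hf.alpha_eq hI hz, hf.beta_eq hI hz h0, imagUnit_mul_eq hI h0, ev,
      reH_star, imH_star]
    intro h
    rw [hf.imH_eq_zero hz h]; simp

lemma symmetrization (hf : IsStem R f F) :
    IsStem R (symmetrization f) (fun z => ((Quaternion.normSq (F z) : ℂ) : ℍ[ℂ])) :=
  (hf.starMul hf.starConj).congr_right fun _ _ => Quaternion.self_mul_star _

lemma starInv (hf : IsStem R f F) :
    IsStem R (starInv f) (fun z => (Quaternion.normSq (F z))⁻¹ • star (F z)) := by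
  intro I hI z hz
  rw [SliceRegular.starInv, hf.symmetrization I hI z hz, hf.starConj I hI z hz, ev_smul hI,
    slice_inv hI, slice_eq_ev]

lemma const (w : ℍ) : IsStem R (fun _ => w) (fun _ => ofH w) := fun I _ z _ => by simp

lemma id : IsStem R (fun q => q) (fun z => (z : ℍ[ℂ])) := fun I _ z _ => slice_eq_ev I z

lemma sub (hf : IsStem R f F) (hg : IsStem R g G) :
    IsStem R (fun q => f q - g q) (fun z => F z - G z) := fun I hI z hz => by
  simp only [ev_sub, hf I hI z hz, hg I hI z hz]

lemma add (hf : IsStem R f F) (hg : IsStem R g G) :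
    IsStem R (fun q => f q + g q) (fun z => F z + G z) := fun I hI z hz => by
  simp only [ev_add, hf I hI z hz, hg I hI z hz]

lemma mul_const (hf : IsStem R f F) (w : ℍ) :
    IsStem R (fun q => f q * w) (fun z => F z * ofH w) := fun I hI z hz => by
  simp only [ev_mul_ofH, hf I hI z hz]

/-- The pointwise product by a slice preserving function. -/
lemma coe_mul {c : ℂ → ℂ} (hf : IsStem R f (fun z => (c z : ℍ[ℂ]))) (hg : IsStem R g G) :
    IsStem R (fun q => f q * g q) (fun z => c z • G z) := fun I hI z hz => by
  simp only [ev_smul hI, slice_eq_ev I (c z), hf I hI z hz, hg I hI z hz]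

lemma coe_pow {c : ℂ → ℂ} (hf : IsStem R f (fun z => (c z : ℍ[ℂ]))) (n : ℕ) :
    IsStem R (fun q => f q ^ n) (fun z => ((c z ^ n : ℂ) : ℍ[ℂ])) := fun I hI z hz => by
  simp only [hf I hI z hz, ← slice_eq_ev, slice_pow hI]

lemma foldr {ι : Type*} (l : List ι) {φ : ι → ℍ → ℍ} {Φ : ι → ℂ → ℍ[ℂ]}
    (h : ∀ p ∈ l, IsStem R (φ p) (Φ p)) (hg : IsStem R g G) :
    IsStem R ((l.map φ).foldr SliceRegular.starMul g)
      (fun z => (l.map fun p => Φ p z).prod * G z) := by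
  induction l with
  | nil => simpa using hg
  | cons p l ih =>
    simp only [List.map_cons, List.foldr_cons, List.prod_cons]
    refine ((h p (by simp)).starMul (ih fun p hp => h p (by simp [hp]))).congr_right ?_
    intro z _; rw [mul_assoc]

end IsStem

/-- The slice function with the given stem function. -/
def ofStem (F : ℂ → ℍ[ℂ]) (q : ℍ) : ℍ := ev (imagUnit q) (F (toC q))

lemma isStem_ofStem {R : ℝ} {F : ℂ → ℍ[ℂ]}
    (hF : ∀ z ∈ Metric.ball (0 : ℂ) R, F (conj z) = conjC (F z)) : IsStem R (ofStem F) F := by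
  refine IsStem.of_nonneg hF fun I hI z hz h0 => ?_
  have : z.im = 0 → imH (F z) = 0 := fun h => by
    have h1 := hF z hz
    rw [Complex.conj_eq_iff_im.2 h] at h1
    exact imH_eq_zero_of_conjC h1
  rw [ofStem, toC_slice hI h0, ev, IsStem.imagUnit_mul_eq hI h0 this, ev]

namespace Holo
variable {U : Set ℂ} {F G : ℂ → ℍ[ℂ]}

lemma mul (hF : Holo F U) (hG : Holo G U) : Holo (fun z => F z * G z) U := by
  obtain ⟨_, _, _, _⟩ := hF
  obtain ⟨_, _, _, _⟩ := hG
  constructor <;> (simp; fun_prop)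

lemma sub (hF : Holo F U) (hG : Holo G U) : Holo (fun z => F z - G z) U := by
  obtain ⟨_, _, _, _⟩ := hF
  obtain ⟨_, _, _, _⟩ := hG
  constructor <;> (simp; fun_prop)

lemma star (hF : Holo F U) : Holo (fun z => star (F z)) U := by
  obtain ⟨_, _, _, _⟩ := hF
  constructor <;> (simp; fun_prop)

lemma smul {c : ℂ → ℂ} (hc : DifferentiableOn ℂ c U) (hF : Holo F U) :
    Holo (fun z => c z • F z) U := by
  obtain ⟨_, _, _, _⟩ := hF
  constructor <;> (simp; fun_prop)

lemma const (X : ℍ[ℂ]) : Holo (fun _ => X) U := by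
  constructor <;> fun_prop

lemma coe {c : ℂ → ℂ} (hc : DifferentiableOn ℂ c U) : Holo (fun z => (c z : ℍ[ℂ])) U :=
  ⟨by simpa using hc, by simp, by simp, by simp⟩

lemma normSq (hF : Holo F U) : DifferentiableOn ℂ (fun z => Quaternion.normSq (F z)) U := by
  obtain ⟨_, _, _, _⟩ := hF
  simp only [Quaternion.normSq_def']
  fun_prop

lemma mono (hF : Holo F U) {V : Set ℂ} (h : V ⊆ U) : Holo F V :=
  ⟨hF.re.mono h, hF.imI.mono h, hF.imJ.mono h, hF.imK.mono h⟩

end Holo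

/-! ### Slice regular functions and holomorphic stem functions -/

/-- The parametrization of a slice, as a continuous real linear map. -/
def sliceL (I : ℍ) : ℂ →L[ℝ] ℍ :=
  Complex.reCLM.smulRight (1 : ℍ) + Complex.imCLM.smulRight I

lemma sliceL_apply (I : ℍ) (z : ℂ) : sliceL I z = slice I z := by
  have : z.re • (1 : ℍ) = (z.re : ℍ) := by rw [← Quaternion.coe_mul_eq_smul, mul_one]
  simp [sliceL, slice, this]

lemma coe_sliceL (I : ℍ) : ⇑(sliceL I) = slice I := funext (sliceL_apply I)

lemma continuous_slice (I : ℍ) : Continuous (slice I) := coe_sliceL I ▸ (sliceL I).continuous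

namespace SliceRegularOn
variable {f g : ℍ → ℍ} {U : Set ℍ}

lemma congr (hU : IsOpen U) (hf : SliceRegularOn f U) (h : ∀ q ∈ U, g q = f q) :
    SliceRegularOn g U := by
  have he : ∀ q ∈ U, g =ᶠ[nhds q] f := fun q hq =>
    Filter.eventually_of_mem (hU.mem_nhds hq) h
  refine ⟨fun q hq => (hf.differentiableAt q hq).congr_of_eventuallyEq (he q hq), ?_⟩
  intro I hI x y hq
  rw [(he _ hq).fderiv_eq]
  exact hf.dbar I hI x y hq

lemma add (hf : SliceRegularOn f U) (hg : SliceRegularOn g U) :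
    SliceRegularOn (fun q => f q + g q) U := by
  refine ⟨fun q hq => (hf.differentiableAt q hq).add (hg.differentiableAt q hq), ?_⟩
  intro I hI x y hq
  rw [fderiv_fun_add (hf.differentiableAt _ hq) (hg.differentiableAt _ hq)]
  have h1 := hf.dbar I hI x y hq
  have h2 := hg.dbar I hI x y hq
  rw [add_apply, add_apply, mul_add, add_add_add_comm,
    h1, h2, add_zero]

lemma mul_const (hf : SliceRegularOn f U) (w : ℍ) : SliceRegularOn (fun q => f q * w) U := by
  refine ⟨fun q hq => (hf.differentiableAt q hq).mul_const w, ?_⟩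
  intro I hI x y hq
  rw [fderiv_mul_const' (hf.differentiableAt _ hq)]
  have h1 := hf.dbar I hI x y hq
  simp only [smul_apply, MulOpposite.smul_eq_mul_unop, MulOpposite.unop_op]
  rw [← mul_assoc, ← add_mul, h1, zero_mul]

lemma sub (hf : SliceRegularOn f U) (hg : SliceRegularOn g U) :
    SliceRegularOn (fun q => f q - g q) U := by
  have := hf.add (hg.mul_const (-1))
  simpa [sub_eq_add_neg] using this

lemma continuousOn (hf : SliceRegularOn f U) : ContinuousOn f U := fun q hq =>
  (hf.differentiableAt q hq).continuousAt.continuousWithinAt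

end SliceRegularOn

/-- Averaging the Taylor series with its conjugate reflection replaces each coefficient by its real
part. -/
lemma hasSum_of_conj {R : ℝ} {G : ℂ → ℂ} (hd : DifferentiableOn ℂ G (Metric.ball 0 R))
    (hc : ∀ z ∈ Metric.ball (0 : ℂ) R, G (conj z) = conj (G z)) :
    ∃ c : ℕ → ℝ, ∀ z ∈ Metric.ball (0 : ℂ) R, HasSum (fun n => (c n : ℂ) * z ^ n) (G z) := by
  set d : ℕ → ℂ := fun n => (n.factorial : ℂ)⁻¹ * iteratedDeriv n G 0 with hd'
  have h1 : ∀ z ∈ Metric.ball (0 : ℂ) R, HasSum (fun n => d n * z ^ n) (G z) := by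
    intro z hz
    have := Complex.hasSum_taylorSeries_on_ball hd hz
    refine this.congr_fun fun n => ?_
    simp only [smul_eq_mul, sub_zero, hd']; ring
  refine ⟨fun n => (d n).re, fun z hz => ?_⟩
  have h2 := (h1 (conj z) (conj_mem_ball.2 hz)).map (starRingEnd ℂ) Complex.continuous_conj
  rw [hc z hz, Complex.conj_conj] at h2
  have h3 := ((h1 z hz).add h2).mul_left (2⁻¹ : ℂ)
  rw [show (2⁻¹ : ℂ) * (G z + G z) = G z by ring] at h3
  refine h3.congr_fun fun n => ?_
  simp only [Function.comp, map_mul, map_pow, Complex.conj_conj, Complex.re_eq_add_conj]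
  ring

/-- Differentiability across the real axis is not visible from the stem, since `imagUnit` jumps
there. Real Taylor coefficients commute with everything, so the series can be read as `∑ c n • q ^
n` in the Banach algebra `ℍ`, where it is analytic. -/
lemma differentiableAt_of_isStem_coe {R : ℝ} {g : ℍ → ℍ} {G : ℂ → ℂ}
    (hg : IsStem R g fun z => (G z : ℍ[ℂ])) (hd : DifferentiableOn ℂ G (Metric.ball 0 R))
    {q : ℍ} (hq : q ∈ Metric.ball (0 : ℍ) R) : DifferentiableAt ℝ g q := by
  have hc : ∀ z ∈ Metric.ball (0 : ℂ) R, G (conj z) = conj (G z) := fun z hz => by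
    have := congrArg (·.re) (hg.apply_conj hz)
    simpa using this
  obtain ⟨c, hsum⟩ := hasSum_of_conj hd hc
  have hR : 0 < R := Metric.pos_of_mem_ball hq
  have hsumq : ∀ q ∈ Metric.ball (0 : ℍ) R, HasSum (fun n => c n • q ^ n) (g q) := by
    intro q hq
    obtain ⟨I, hI, h⟩ := exists_slice_eq q
    have h1 := (hsum (toC q) (toC_mem_ball.2 hq)).mapL (sliceL I)
    simp only [sliceL_apply, slice_mul hI, slice_pow hI, slice_ofReal, h] at h1
    rw [hg.apply_eq hq hI h, ← slice_eq_ev]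
    exact h1.congr_fun fun n => (Quaternion.coe_mul_eq_smul _ _).symm
  set p := FormalMultilinearSeries.ofScalars ℍ c with hp
  have hrad : ENNReal.ofReal R ≤ p.radius := by
    refine ENNReal.le_of_forall_nnreal_lt fun t ht => p.le_radius_of_summable_norm ?_
    have ht' : ((t : ℝ) : ℂ) ∈ Metric.ball (0 : ℂ) R := by
      have : (t : ℝ) < R := by
        rw [← ENNReal.ofReal_coe_nnreal] at ht
        exact (ENNReal.ofReal_lt_ofReal_iff hR).1 ht
      simpa using this
    refine (hsum _ ht').summable.norm.congr fun n => ?_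
    rw [hp, FormalMultilinearSeries.ofScalars_norm]
    simp
  have hpos : 0 < p.radius := lt_of_lt_of_le (by simpa using hR) hrad
  have hps := p.hasFPowerSeriesOnBall hpos
  have hq' : q ∈ Metric.eball (0 : ℍ) p.radius := by
    refine Metric.eball_subset_eball hrad ?_
    rwa [Metric.eball_ofReal]
  have hdiff : DifferentiableAt ℝ p.sum q :=
    (hps.differentiableOn q hq').differentiableAt (Metric.isOpen_eball.mem_nhds hq')
  refine hdiff.congr_of_eventuallyEq ?_
  filter_upwards [Metric.isOpen_ball.mem_nhds hq] with x hx
  rw [← (hsumq x hx).tsum_eq]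
  exact (FormalMultilinearSeries.ofScalars_sum_eq c x).symm

lemma sliceRegularOn_of_isStem_coe {R : ℝ} {g : ℍ → ℍ} {G : ℂ → ℂ}
    (hg : IsStem R g fun z => (G z : ℍ[ℂ])) (hd : DifferentiableOn ℂ G (Metric.ball 0 R)) :
    SliceRegularOn g (Metric.ball 0 R) := by
  refine ⟨fun q hq => differentiableAt_of_isStem_coe hg hd hq, ?_⟩
  intro I hI x y hq
  have hq' : slice I ⟨x, y⟩ ∈ Metric.ball (0 : ℍ) R := hq
  change fderiv ℝ g (slice I ⟨x, y⟩) 1 + I * fderiv ℝ g (slice I ⟨x, y⟩) I = 0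
  set z : ℂ := ⟨x, y⟩
  have hz : z ∈ Metric.ball (0 : ℂ) R := (slice_mem_ball hI).1 hq'
  have hG := (hd z hz).differentiableAt (Metric.isOpen_ball.mem_nhds hz)
  have h1 : HasFDerivAt (fun w => g (slice I w)) ((fderiv ℝ g (slice I z)).comp (sliceL I)) z := by
    have := (differentiableAt_of_isStem_coe hg hd hq').hasFDerivAt
    rw [← sliceL_apply] at this
    have := this.comp z (sliceL I).hasFDerivAt
    simpa only [Function.comp_def, sliceL_apply] using this
  have h2 : HasFDerivAt (fun w => g (slice I w))
      ((sliceL I).comp ((fderiv ℂ G z).restrictScalars ℝ)) z := by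
    have := (sliceL I).hasFDerivAt.comp z (hG.hasFDerivAt.restrictScalars ℝ)
    refine this.congr_of_eventuallyEq ?_
    filter_upwards [Metric.isOpen_ball.mem_nhds hz] with w hw
    rw [hg I hI w hw, ← slice_eq_ev, Function.comp, sliceL_apply]
  have h := h1.unique h2
  have e1 := congrArg (fun L => L 1) h
  have e2 := congrArg (fun L => L Complex.I) h
  simp only [ContinuousLinearMap.comp_apply, sliceL_apply, ContinuousLinearMap.coe_restrictScalars',
    slice_one, slice_I] at e1 e2
  have h3 : (fderiv ℂ G z) Complex.I = Complex.I * fderiv ℂ G z 1 := by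
    rw [← smul_eq_mul, ← map_smul, smul_eq_mul, mul_one]
  rw [e1, e2, h3, slice_mul hI, slice_I, ← mul_assoc, imagUnits_mul_self hI]
  simp

/-- A slice function with a holomorphic stem function is slice regular. -/
theorem sliceRegularOn_of_isStem {R : ℝ} {f : ℍ → ℍ} {F : ℂ → ℍ[ℂ]} (hf : IsStem R f F)
    (hF : Holo F (Metric.ball 0 R)) : SliceRegularOn f (Metric.ball 0 R) := by
  have key : ∀ G : ℂ → ℂ, DifferentiableOn ℂ G (Metric.ball 0 R) →
      (∀ z ∈ Metric.ball (0 : ℂ) R, G (conj z) = conj (G z)) →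
      IsStem R (ofStem fun z => (G z : ℍ[ℂ])) (fun z => (G z : ℍ[ℂ])) ∧
      SliceRegularOn (ofStem fun z => (G z : ℍ[ℂ])) (Metric.ball 0 R) := by
    intro G hG hc
    have := isStem_ofStem (R := R) (F := fun z => (G z : ℍ[ℂ])) fun z hz => by
      rw [hc z hz, conjC_coe]
    exact ⟨this, sliceRegularOn_of_isStem_coe this hG⟩
  have hc := fun z hz => hf.apply_conj (z := z) hz
  obtain ⟨s0, r0⟩ := key _ hF.re fun z hz => by rw [hc z hz, conjC_re]
  obtain ⟨s1, r1⟩ := key _ hF.imI fun z hz => by rw [hc z hz, conjC_imI]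
  obtain ⟨s2, r2⟩ := key _ hF.imJ fun z hz => by rw [hc z hz, conjC_imJ]
  obtain ⟨s3, r3⟩ := key _ hF.imK fun z hz => by rw [hc z hz, conjC_imK]
  -- The four components of the stem give slice preserving functions, and `f` is their combination
  -- with the constants `1, i, j, k` on the right, which preserve regularity.
  have hr := ((r0.add (r1.mul_const unitI)).add (r2.mul_const unitJ)).add
    (r3.mul_const unitK)
  have hs := ((s0.add (s1.mul_const unitI)).add (s2.mul_const unitJ)).add
    (s3.mul_const unitK)
  refine hr.congr Metric.isOpen_ball fun q hq => ?_
  obtain ⟨I, hI, h⟩ := exists_slice_eq q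
  rw [hf.apply_eq hq hI h, hs.apply_eq hq hI h]
  congr 1
  apply Quaternion.ext <;> simp

/-- The projection `p ↦ Re p - ι Re (I p)` onto the slice of `I`, with values in `ℂ`. -/
def projL (I : ℍ) : ℍ →L[ℝ] ℂ := LinearMap.toContinuousLinearMap
  { toFun := fun p => ⟨p.re, -(I * p).re⟩
    map_add' := fun p q => by
      rw [mul_add, Complex.ext_iff]
      exact ⟨rfl, by simp only [Quaternion.re_add, Complex.add_im]; ring⟩
    map_smul' := fun c p => by
      rw [mul_smul_comm, Complex.ext_iff]
      refine ⟨by simp, ?_⟩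
      simp only [Quaternion.re_smul, Complex.smul_im, smul_neg, RingHom.id_apply] }

lemma projL_apply (I p : ℍ) : projL I p = ⟨p.re, -(I * p).re⟩ := rfl

lemma projL_mul {I : ℍ} (hI : I ∈ imagUnits) (p : ℍ) :
    projL I (I * p) = Complex.I * projL I p := by
  rw [projL_apply, projL_apply, ← mul_assoc, imagUnits_mul_self hI]
  apply Complex.ext <;> simp

lemma norm_projL_le {I : ℍ} (hI : I ∈ imagUnits) (p : ℍ) : ‖projL I p‖ ≤ ‖p‖ := by
  rw [← sq_le_sq₀ (norm_nonneg _) (norm_nonneg _), ← Complex.normSq_eq_norm_sq,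
    Complex.normSq_apply, projL_apply, sq ‖p‖, ← Quaternion.normSq_eq_norm_mul_self,
    Quaternion.normSq_def']
  have h1 : I.imI ^ 2 + I.imJ ^ 2 + I.imK ^ 2 = 1 := by
    have := Quaternion.normSq_eq_norm_mul_self I
    rw [Quaternion.normSq_def', hI.1, hI.2] at this
    linarith
  simp only [Quaternion.re_mul, hI.1]
  -- Lagrange's identity for the imaginary parts, `|I|²|p|² = ⟨I, p⟩² + |I × p|²`, with `|I| = 1`.
  have e : p.imI ^ 2 + p.imJ ^ 2 + p.imK ^ 2 =
      (I.imI * p.imI + I.imJ * p.imJ + I.imK * p.imK) ^ 2 +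
      ((I.imI * p.imJ - I.imJ * p.imI) ^ 2 + (I.imI * p.imK - I.imK * p.imI) ^ 2 +
      (I.imJ * p.imK - I.imK * p.imJ) ^ 2) := by
    linear_combination -(p.imI ^ 2 + p.imJ ^ 2 + p.imK ^ 2) * h1
  have e2 : 0 ≤ (I.imI * p.imJ - I.imJ * p.imI) ^ 2 + (I.imI * p.imK - I.imK * p.imI) ^ 2 +
      (I.imJ * p.imK - I.imK * p.imJ) ^ 2 := by positivity
  linarith

namespace SliceRegularOn
variable {f : ℍ → ℍ} {R : ℝ}

/-- `projL I` turns left multiplication by `I` into multiplication by `ι`, and right multiplication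
by `w` commutes with it, so the slice condition becomes the Cauchy–Riemann equation. With `w = star
(f q)` the value at `q` is `|f q|²`; in this way the scalar identity and maximum principles apply to
`f`. -/
lemma differentiableOn_projL (hf : SliceRegularOn f (Metric.ball 0 R)) {I : ℍ}
    (hI : I ∈ imagUnits) (w : ℍ) :
    DifferentiableOn ℂ (fun z => projL I (f (slice I z) * w)) (Metric.ball 0 R) := by
  intro z hz
  refine DifferentiableAt.differentiableWithinAt ?_
  have hq : slice I z ∈ Metric.ball (0 : ℍ) R := (slice_mem_ball hI).2 hz
  set M : ℍ →L[ℝ] ℂ := (projL I).comp ((ContinuousLinearMap.mul ℝ ℍ).flip w) with hM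
  have hMa : ∀ p, M p = projL I (p * w) := fun p => rfl
  have h : HasFDerivAt (fun z => projL I (f (slice I z) * w))
      (M.comp ((fderiv ℝ f (slice I z)).comp (sliceL I))) z := by
    have h1 := (hf.differentiableAt _ hq).hasFDerivAt
    rw [← sliceL_apply] at h1
    have h2 := M.hasFDerivAt.comp z (h1.comp z (sliceL I).hasFDerivAt)
    simpa only [Function.comp_def, sliceL_apply, hMa] using h2
  rw [differentiableAt_complex_iff_differentiableAt_real]
  refine ⟨h.differentiableAt, ?_⟩
  rw [h.fderiv]
  simp only [ContinuousLinearMap.comp_apply, sliceL_apply, slice_I, slice_one, hMa]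
  have hd := hf.dbar I hI z.re z.im hq
  have hd' : fderiv ℝ f (slice I z) I = I * fderiv ℝ f (slice I z) 1 := by
    have h3 := eq_neg_of_add_eq_zero_left hd
    change fderiv ℝ f (slice I z) 1 = -(I * fderiv ℝ f (slice I z) I) at h3
    rw [h3, mul_neg, ← mul_assoc, imagUnits_mul_self hI]
    simp
  rw [hd', mul_assoc, projL_mul hI, smul_eq_mul]

lemma eq_zero_of_real (hf : SliceRegularOn f (Metric.ball 0 R))
    (h0 : ∀ x : ℝ, (x : ℍ) ∈ Metric.ball (0 : ℍ) R → f x = 0) {q : ℍ}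
    (hq : q ∈ Metric.ball (0 : ℍ) R) : f q = 0 := by
  obtain ⟨I, hI, h⟩ := exists_slice_eq q
  have hR : 0 < R := Metric.pos_of_mem_ball hq
  have hd := hf.differentiableOn_projL hI (star (f q))
  have ha := hd.analyticOnNhd Metric.isOpen_ball
  have hfreq : ∃ᶠ z in nhdsWithin (0 : ℂ) {0}ᶜ, projL I (f (slice I z) * star (f q)) = 0 := by
    have ht : Filter.Tendsto (fun n : ℕ => (((1 / ((n : ℝ) + 1) : ℝ)) : ℂ)) Filter.atTop
        (nhdsWithin (0 : ℂ) {0}ᶜ) := by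
      rw [tendsto_nhdsWithin_iff]
      constructor
      · have := (Complex.continuous_ofReal.tendsto 0).comp
          (tendsto_one_div_add_atTop_nhds_zero_nat (𝕜 := ℝ))
        simpa only [Complex.ofReal_zero, Function.comp_def] using this
      · refine Filter.Eventually.of_forall fun n => ?_
        simp only [Set.mem_compl_iff, Set.mem_singleton_iff, Complex.ofReal_eq_zero]
        positivity
    refine ht.frequently ?_
    have hb : ∀ᶠ n : ℕ in Filter.atTop, (((1 / ((n : ℝ) + 1) : ℝ)) : ℂ) ∈ Metric.ball (0 : ℂ) R :=
      (ht.mono_right nhdsWithin_le_nhds).eventually (Metric.ball_mem_nhds 0 hR)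
    refine (hb.mono fun n hn => ?_).frequently
    rw [slice_ofReal, h0 _ (by rw [← slice_ofReal I]; exact (slice_mem_ball hI).2 hn)]
    simp
  have hz := ha.eqOn_zero_of_preconnected_of_frequently_eq_zero
    (convex_ball (0 : ℂ) R).isPreconnected (Metric.mem_ball_self hR) hfreq (toC_mem_ball.2 hq)
  simp only [h, Pi.zero_apply] at hz
  rw [Quaternion.self_mul_star] at hz
  have h2 := congrArg Complex.re hz
  simpa [projL_apply] using h2

/-- The maximum modulus principle. -/
lemma norm_le_of_sphere (hf : SliceRegularOn f (Metric.ball 0 R))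
    (hc : ContinuousOn f (Metric.closedBall 0 R)) {M : ℝ}
    (hM : ∀ q ∈ Metric.sphere (0 : ℍ) R, ‖f q‖ ≤ M) {q : ℍ} (hq : q ∈ Metric.ball (0 : ℍ) R) :
    ‖f q‖ ≤ M := by
  obtain ⟨I, hI, h⟩ := exists_slice_eq q
  have hR : 0 < R := Metric.pos_of_mem_ball hq
  have hd := hf.differentiableOn_projL hI (star (f q))
  have hcl : ContinuousOn (fun z => projL I (f (slice I z) * star (f q)))
      (Metric.closedBall 0 R) := by
    refine (projL I).continuous.comp_continuousOn (ContinuousOn.mul ?_ continuousOn_const)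
    refine hc.comp (continuous_slice I).continuousOn fun z hz => ?_
    simpa [hI] using hz
  have hdc : DiffContOnCl ℂ (fun z => projL I (f (slice I z) * star (f q))) (Metric.ball 0 R) :=
    ⟨hd, by rwa [closure_ball _ hR.ne']⟩
  have hb := Complex.norm_le_of_forall_mem_frontier_norm_le Metric.isBounded_ball hdc
    (C := M * ‖f q‖) (fun z hz => by
      rw [frontier_ball _ hR.ne'] at hz
      refine (norm_projL_le hI _).trans ?_
      rw [norm_mul, norm_star]
      refine mul_le_mul_of_nonneg_right (hM _ ?_) (norm_nonneg _)
      simpa [hI] using hz) (subset_closure (toC_mem_ball.2 hq))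
  rw [h, Quaternion.self_mul_star, Quaternion.normSq_eq_norm_mul_self] at hb
  have h3 : ‖f q‖ * ‖f q‖ ≤ M * ‖f q‖ := by
    refine le_trans ?_ hb
    refine le_trans (le_of_eq ?_) (Complex.re_le_norm _)
    simp [projL_apply]
  rcases (norm_nonneg (f q)).eq_or_lt with h4 | h4
  · rw [← h4]
    have hs : ((R : ℝ) : ℍ) ∈ Metric.sphere (0 : ℍ) R := by simp [abs_of_pos hR]
    exact (norm_nonneg _).trans (hM _ hs)
  · exact le_of_mul_le_mul_right h3 h4

/-- A slice regular function on a ball has a holomorphic stem function. -/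
theorem exists_isStem (hf : SliceRegularOn f (Metric.ball 0 R)) :
    ∃ F : ℂ → ℍ[ℂ], Holo F (Metric.ball 0 R) ∧ IsStem R f F := by
  -- On the slice of `i` one has `f = G 1 + G (-j) j`. Combining each `G w` with its conjugate
  -- reflection gives holomorphic extensions of the four real coordinates of `f` on the real axis.
  -- The slice function of the resulting `F` agrees with `f` there, hence everywhere.
  set G : ℍ → ℂ → ℂ := fun w z => projL unitI (f (slice unitI z) * w) with hG
  have hd : ∀ w, DifferentiableOn ℂ (G w) (Metric.ball 0 R) := fun w =>
    hf.differentiableOn_projL unitI_mem w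
  have hd' : ∀ w, DifferentiableOn ℂ (fun z => conj (G w (conj z))) (Metric.ball 0 R) := by
    intro w z hz
    have h1 := (hd w (conj z) (conj_mem_ball.2 hz)).differentiableAt
      (Metric.isOpen_ball.mem_nhds (conj_mem_ball.2 hz))
    have h2 := h1.conj_conj
    rw [Complex.conj_conj] at h2
    exact h2.differentiableWithinAt
  set F : ℂ → ℍ[ℂ] := fun z =>
    mkC (2⁻¹ * (G 1 z + conj (G 1 (conj z)))) (-Complex.I * 2⁻¹ * (G 1 z - conj (G 1 (conj z))))
      (2⁻¹ * (G (-unitJ) z + conj (G (-unitJ) (conj z))))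
      (-Complex.I * 2⁻¹ * (G (-unitJ) z - conj (G (-unitJ) (conj z)))) with hF
  have hFH : Holo F (Metric.ball 0 R) :=
    ⟨((hd 1).add (hd' 1)).const_mul _, ((hd 1).sub (hd' 1)).const_mul _,
      ((hd _).add (hd' _)).const_mul _, ((hd _).sub (hd' _)).const_mul _⟩
  have hs : IsStem R (ofStem F) F := by
    refine isStem_ofStem fun z _ => ?_
    have h2 : conj (2⁻¹ : ℂ) = 2⁻¹ := by rw [map_inv₀, map_ofNat]
    apply Quaternion.ext
    · simp only [hF, conjC_re, mkC_re, map_mul, map_add, Complex.conj_conj, h2]; ring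
    · simp only [hF, conjC_imI, mkC_imI, map_mul, map_sub, map_neg, Complex.conj_conj, h2, Complex.conj_I]
      ring
    · simp only [hF, conjC_imJ, mkC_imJ, map_mul, map_add, Complex.conj_conj, h2]; ring
    · simp only [hF, conjC_imK, mkC_imK, map_mul, map_sub, map_neg, Complex.conj_conj, h2, Complex.conj_I]
      ring
  refine ⟨F, hFH, hs.congr_left fun q hq => ?_⟩
  have hr := sliceRegularOn_of_isStem hs hFH
  have hz := (hf.sub hr).eq_zero_of_real (fun x hx => ?_) hq
  · exact sub_eq_zero.1 hz
  · have hx' : (x : ℂ) ∈ Metric.ball (0 : ℂ) R := by simpa using hx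
    rw [← slice_ofReal unitI, hs _ unitI_mem _ hx', sub_eq_zero]
    have e2 : (2⁻¹ : ℂ).re = 2⁻¹ := by norm_num
    have e3 : (2⁻¹ : ℂ).im = 0 := by norm_num
    apply Quaternion.ext <;> simp [ev, hF, hG, projL_apply, e2, e3] <;> ring

end SliceRegularOn

/-! ### Linear and quadratic factors -/

/-- The quadratic polynomial with roots `w` and its conjugate. -/
def quad (w z : ℂ) : ℂ := (z - w) * (z - conj w)

/-- The stem function of `q - p`. -/
def lin (p : ℍ) (z : ℂ) : ℍ[ℂ] := (z : ℍ[ℂ]) - ofH p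

@[simp] lemma quad_self (w : ℂ) : quad w w = 0 := by simp [quad]

lemma quad_conj (w z : ℂ) : quad w (conj z) = conj (quad w z) := by
  simp only [quad, map_mul, map_sub, Complex.conj_conj]; ring

lemma quad_eq (w z : ℂ) : quad w z = (z - w.re) ^ 2 + (w.im : ℂ) ^ 2 := by
  have h1 : (w + conj w) = 2 * (w.re : ℂ) := by
    apply Complex.ext <;> simp; ring
  have h2 : w * conj w = (w.re : ℂ) ^ 2 + (w.im : ℂ) ^ 2 := by
    rw [Complex.mul_conj, Complex.normSq_apply]; push_cast; ring
  rw [quad]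
  linear_combination -z * h1 + h2

lemma differentiable_quad (w : ℂ) : Differentiable ℂ (quad w) := by
  unfold quad; fun_prop

lemma analyticAt_quad (w z : ℂ) : AnalyticAt ℂ (quad w) z := (differentiable_quad w).analyticAt z

lemma quad_eventually_ne (w z₀ : ℂ) : ∀ᶠ z in nhdsWithin z₀ {z₀}ᶜ, quad w z ≠ 0 := by
  have h : ∀ a : ℂ, ∀ᶠ z in nhdsWithin z₀ {z₀}ᶜ, z - a ≠ 0 := by
    intro a
    by_cases ha : z₀ = a
    · subst ha
      filter_upwards [self_mem_nhdsWithin] with z hz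
      exact sub_ne_zero.2 hz
    · have : ∀ᶠ z in nhds z₀, z ≠ a := isOpen_ne.mem_nhds ha
      exact (this.filter_mono nhdsWithin_le_nhds).mono fun z hz => sub_ne_zero.2 hz
  filter_upwards [h w, h (conj w)] with z h1 h2 using mul_ne_zero h1 h2

lemma smul_mul_HC (c : ℂ) (X Y : ℍ[ℂ]) : c • X * Y = c • (X * Y) := by
  rw [← Quaternion.coe_mul_eq_smul, mul_assoc, Quaternion.coe_mul_eq_smul]

lemma mul_smul_HC (c : ℂ) (X Y : ℍ[ℂ]) : X * c • Y = c • (X * Y) := by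
  rw [← Quaternion.coe_mul_eq_smul, ← mul_assoc, ← Quaternion.coe_commutes, mul_assoc,
    Quaternion.coe_mul_eq_smul]

lemma conjC_lin (p : ℍ) (z : ℂ) : conjC (lin p z) = lin p (conj z) := by simp [lin, conjC_sub]

lemma star_lin (p : ℍ) (z : ℂ) : star (lin p z) = lin (star p) z := by
  apply Quaternion.ext <;> simp [lin]

lemma normSq_lin (p : ℍ) (z : ℂ) : Quaternion.normSq (lin p z) = quad (toC p) z := by
  have h : ‖p.im‖ ^ 2 = p.imI ^ 2 + p.imJ ^ 2 + p.imK ^ 2 := by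
    rw [sq, ← Quaternion.normSq_eq_norm_mul_self, Quaternion.normSq_def']; simp
  have h' : ((‖p.im‖ : ℝ) : ℂ) ^ 2 = (p.imI : ℂ) ^ 2 + (p.imJ : ℂ) ^ 2 + (p.imK : ℂ) ^ 2 := by
    exact_mod_cast h
  rw [quad_eq, toC_re, toC_im, h', Quaternion.normSq_def']
  simp [lin]; ring

lemma lin_mul_star_lin (p : ℍ) (z : ℂ) : lin p z * lin (star p) z = (quad (toC p) z : ℍ[ℂ]) := by
  rw [← star_lin, Quaternion.self_mul_star, normSq_lin]

lemma star_lin_mul_lin (p : ℍ) (z : ℂ) : lin (star p) z * lin p z = (quad (toC p) z : ℍ[ℂ]) := by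
  rw [← star_lin, Quaternion.star_mul_self, normSq_lin]

lemma isStem_lin (R : ℝ) (p : ℍ) : IsStem R (fun q => q - p) (lin p) := IsStem.id.sub (IsStem.const p)

lemma isStem_spherePoly (R : ℝ) (q₀ : ℍ) :
    IsStem R (spherePoly q₀) (fun z => (quad (toC q₀) z : ℍ[ℂ])) := by
  have h1 : IsStem R (fun q => q - (q₀.re : ℍ)) (fun z => ((z - q₀.re : ℂ) : ℍ[ℂ])) :=
    (IsStem.id.sub (IsStem.const _)).congr_right fun z _ => by
      rw [Quaternion.coe_sub, ofH_coe]
  refine ((h1.coe_pow 2).add (IsStem.const ((‖q₀.im‖ ^ 2 : ℝ) : ℍ))).congr_right fun z _ => ?_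
  rw [quad_eq, ofH_coe, ← Quaternion.coe_add]
  simp

/-! ### Zeros and zero divisors -/

lemma mul_eq_zero_of_normSq_right {X Y : ℍ[ℂ]} (hY : Quaternion.normSq Y ≠ 0) (h : X * Y = 0) :
    X = 0 := by
  have h2 : X * Y * star Y = 0 := by rw [h, zero_mul]
  rw [mul_assoc, Quaternion.self_mul_star, Quaternion.mul_coe_eq_smul] at h2
  exact (smul_eq_zero.1 h2).resolve_left hY

/-- If `a = -I b` then `a + ι b = (ι - I) b`: vanishing at `I` is divisibility by the zero divisor
`ι - I`. -/
lemma eq_of_ev_eq_zero {I : ℍ} {X : ℍ[ℂ]} (h : ev I X = 0) :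
    X = lin I Complex.I * ofH (imH X) := by
  have h1 : reH X = -(I * imH X) := eq_neg_of_add_eq_zero_left h
  refine ext_reH_imH ?_ ?_
  · rw [reH_mul, lin, reH_sub, imH_sub]; simp [h1]
  · rw [imH_mul, lin, reH_sub, imH_sub]; simp

lemma toC_imagUnit {I : ℍ} (hI : I ∈ imagUnits) : toC I = Complex.I := by
  apply Complex.ext
  · simp [hI.1]
  · simp [imagUnits_im_eq hI, hI.2]

lemma normSq_eq_zero_of_ev {I : ℍ} (hI : I ∈ imagUnits) {X : ℍ[ℂ]} (h : ev I X = 0) :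
    Quaternion.normSq X = 0 := by
  rw [eq_of_ev_eq_zero h, map_mul, normSq_lin, toC_imagUnit hI, quad_self, zero_mul]

/-- For `X = a + ι b`, the real and imaginary parts of `normSq X = 0` say `|a| = |b|` and `Re (a b̄)
= 0`, which is what makes `-a b⁻¹` an imaginary unit. Thus a zero of the symmetrization forces a
zero of the function on the sphere. -/
lemma exists_ev_eq_zero {X : ℍ[ℂ]} (h : Quaternion.normSq X = 0) :
    ∃ I ∈ imagUnits, ev I X = 0 := by
  set a := reH X with ha
  set b := imH X with hb
  have hre := congrArg Complex.re h
  have him := congrArg Complex.im h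
  rw [Quaternion.normSq_def'] at hre him
  simp only [sq, Complex.add_re, Complex.mul_re, Complex.add_im, Complex.mul_im, Complex.zero_re,
    Complex.zero_im] at hre him
  have e1 : Quaternion.normSq a = Quaternion.normSq b := by
    rw [Quaternion.normSq_def', Quaternion.normSq_def']
    simp only [ha, hb, reH_re, reH_imI, reH_imJ, reH_imK, imH_re, imH_imI, imH_imJ, imH_imK]
    linarith
  have e2 : (a * star b).re = 0 := by
    simp only [Quaternion.re_mul, Quaternion.re_star, Quaternion.imI_star, Quaternion.imJ_star,
      Quaternion.imK_star, ha, hb, reH_re, reH_imI, reH_imJ, reH_imK, imH_re, imH_imI, imH_imJ,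
      imH_imK]
    linarith
  by_cases hb0 : b = 0
  · have ha0 : a = 0 := by
      rw [← Quaternion.normSq_eq_zero, e1, hb0, map_zero]
    refine ⟨unitI, unitI_mem, ?_⟩
    rw [ev, ← ha, ← hb, ha0, hb0]; simp
  · have hbn : Quaternion.normSq b ≠ 0 := Quaternion.normSq_ne_zero.2 hb0
    refine ⟨-(a * b⁻¹), ⟨?_, ?_⟩, ?_⟩
    · rw [Quaternion.inv_def, mul_smul_comm, Quaternion.re_neg, Quaternion.re_smul, e2]; simp
    · have : ‖a‖ = ‖b‖ := by
        rw [Quaternion.normSq_eq_norm_mul_self, Quaternion.normSq_eq_norm_mul_self] at e1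
        exact (mul_self_inj (norm_nonneg _) (norm_nonneg _)).1 e1
      rw [norm_neg, norm_mul, norm_inv, this, mul_inv_cancel₀ (by simpa using hb0)]
    · rw [ev, ← ha, ← hb, neg_mul, mul_assoc, inv_mul_cancel₀ hb0, mul_one, add_neg_cancel]

/-- This is the statement that `(q - p) ⋆ g` vanishes at `p`. -/
lemma ev_lin_mul {I : ℍ} (hI : I ∈ imagUnits) (z : ℂ) (X : ℍ[ℂ]) :
    ev I (lin (slice I z) z * X) = 0 := by
  have hc : I * slice I z = slice I z * I := by
    simp only [slice, mul_add, add_mul, mul_smul_comm, smul_mul_assoc]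
    rw [Quaternion.coe_commutes]
  rw [lin, sub_mul, ev_sub, ev_coe_mul hI, ev_mul hI, ev_ofH, hc, ev]
  noncomm_ring

/-- Here `X = (ι - I) b` and `z - star p = y (ι + I)` with `p = x + y I`, while `(ι + I)(ι - I) =
0`. -/
lemma lin_star_mul_eq_zero {I : ℍ} (hI : I ∈ imagUnits) {z : ℂ} {X : ℍ[ℂ]} (h : ev I X = 0) :
    lin (star (slice I z)) z * X = 0 := by
  have h1 : lin (star (slice I z)) z = (z.im : ℂ) • lin (star I) Complex.I := by
    rw [star_slice hI, imagUnits_star_eq hI, lin, lin]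
    apply ext_reH_imH
    · rw [reH_sub, ← Quaternion.coe_mul_eq_smul, reH_mul, reH_sub, imH_sub]
      simp [slice, Quaternion.coe_mul_eq_smul]
    · rw [imH_sub, ← Quaternion.coe_mul_eq_smul, imH_mul, reH_sub, imH_sub]
      simp
  rw [h1, eq_of_ev_eq_zero h, smul_mul_HC, ← mul_assoc, star_lin_mul_lin, toC_imagUnit hI,
    quad_self]
  simp

lemma lin_ne_zero {p : ℍ} {z : ℂ} (hz : z.im ≠ 0) : lin p z ≠ 0 := by
  intro h
  have h1 := congrArg (fun X => (imH X).re) h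
  simp only [lin, imH_sub, imH_coe, imH_ofH, sub_zero, Quaternion.re_coe, imH_zero] at h1
  exact hz h1

/-- Consecutive linear factors on the same sphere can be cancelled unless they are conjugate. -/
lemma lin_mul_cancel {p p' : ℍ} (hpp : toC p = toC p') (hne : star p' ≠ p) {Y : ℍ[ℂ]}
    (h : lin p (toC p) * (lin p' (toC p) * Y) = 0) : lin p' (toC p) * Y = 0 := by
  set z := toC p with hz
  set A := lin p' z with hA
  set B := lin p z with hB
  have hAA : A * star A = 0 := by
    rw [Quaternion.self_mul_star, hA, normSq_lin, ← hpp, quad_self]; simp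
  -- Since `B * A = 2 Re (B * A) - star (B * A)` and `A * star A = 0`, multiplying `B * A * Y = 0`
  -- by `A` leaves `2 Re (B * A) A Y = 0`. The scalar vanishes only when the imaginary parts of `p`
  -- and `p'` are opposite.
  have h1 : A * (B * A) = (2 * (B * A).re) • A := by
    have h2 : B * A = ((2 * (B * A).re : ℂ) : ℍ[ℂ]) - star (B * A) := by
      rw [eq_sub_iff_add_eq]
      have := Quaternion.self_add_star' (B * A)
      exact this
    nth_rewrite 1 [h2]
    rw [mul_sub, star_mul, ← mul_assoc A, hAA, zero_mul, sub_zero, Quaternion.mul_coe_eq_smul]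
  have h3 : (2 * (B * A).re) • (A * Y) = 0 := by
    rw [← smul_mul_HC, ← h1, mul_assoc, mul_assoc, h, mul_zero]
  refine (smul_eq_zero.1 h3).resolve_left fun h4 => hne ?_
  have h5 : (B * A).re = 0 := (mul_eq_zero.1 h4).resolve_left two_ne_zero
  have hre : p'.re = p.re := (congrArg Complex.re hpp).symm
  have him : ‖p'.im‖ = ‖p.im‖ := (congrArg Complex.im hpp).symm
  have n1 : ‖p.im‖ ^ 2 = p.imI ^ 2 + p.imJ ^ 2 + p.imK ^ 2 := by
    rw [sq, ← Quaternion.normSq_eq_norm_mul_self, Quaternion.normSq_def']; simp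
  have n2 : ‖p.im‖ ^ 2 = p'.imI ^ 2 + p'.imJ ^ 2 + p'.imK ^ 2 := by
    rw [← him, sq, ← Quaternion.normSq_eq_norm_mul_self, Quaternion.normSq_def']; simp
  have h6 := congrArg Complex.re h5
  simp only [hA, hB, lin, Quaternion.re_mul, Quaternion.re_sub, Quaternion.imI_sub,
    Quaternion.imJ_sub, Quaternion.imK_sub, Quaternion.re_coe, Quaternion.imI_coe,
    Quaternion.imJ_coe, Quaternion.imK_coe, ofH_re, ofH_imI, ofH_imJ, ofH_imK, hre, zero_sub,
    neg_mul_neg, Complex.sub_re, Complex.mul_re, Complex.sub_im, Complex.ofReal_re,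
    Complex.ofReal_im, Complex.zero_re, hz, toC_re, toC_im, sub_self, sub_zero, mul_zero] at h6
  have h7 : (p.imI + p'.imI) ^ 2 + (p.imJ + p'.imJ) ^ 2 + (p.imK + p'.imK) ^ 2 = 0 := by
    nlinarith
  have i1 : p.imI + p'.imI = 0 := by
    nlinarith [sq_nonneg (p.imI + p'.imI), sq_nonneg (p.imJ + p'.imJ), sq_nonneg (p.imK + p'.imK)]
  have i2 : p.imJ + p'.imJ = 0 := by
    nlinarith [sq_nonneg (p.imI + p'.imI), sq_nonneg (p.imJ + p'.imJ), sq_nonneg (p.imK + p'.imK)]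
  have i3 : p.imK + p'.imK = 0 := by
    nlinarith [sq_nonneg (p.imI + p'.imI), sq_nonneg (p.imJ + p'.imJ), sq_nonneg (p.imK + p'.imK)]
  ext
  · simpa using hre
  · rw [Quaternion.imI_star]; linarith
  · rw [Quaternion.imJ_star]; linarith
  · rw [Quaternion.imK_star]; linarith

/-- A product without consecutive conjugate factors hides no further spherical factor: by
`lin_mul_cancel` the factors can be removed one by one until a single one, nonzero off the real
axis, is left. -/
lemma prod_lin_mul_ne_zero {z : ℂ} (hz : z.im ≠ 0) {X : ℍ[ℂ]} (hX : Quaternion.normSq X ≠ 0)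
    {l : List ℍ} (hl : ∀ p ∈ l, toC p = z) (hc : l.IsChain fun p p' => star p' ≠ p) :
    (l.map fun p => lin p z).prod * X ≠ 0 := by
  induction l with
  | nil =>
    intro h
    rw [List.map_nil, List.prod_nil, one_mul] at h
    rw [h, map_zero] at hX
    exact hX rfl
  | cons p t ih =>
    have ih' := ih (fun p hp => hl p (by simp [hp])) hc.tail
    cases t with
    | nil =>
      intro h
      simp only [List.map_cons, List.map_nil, List.prod_cons, List.prod_nil, mul_one] at h
      exact lin_ne_zero hz (mul_eq_zero_of_normSq_right hX h)
    | cons p' t =>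
      intro h
      apply ih'
      simp only [List.map_cons, List.prod_cons, mul_assoc] at h ⊢
      have hp := hl p (by simp)
      rw [← hp] at h ⊢
      refine lin_mul_cancel ?_ (List.isChain_cons_cons.1 hc).1 h
      rw [hp, hl p' (by simp)]

lemma normSq_prod_lin {z w : ℂ} {l : List ℍ} (hl : ∀ p ∈ l, toC p = w) :
    Quaternion.normSq (l.map fun p => lin p z).prod = quad w z ^ l.length := by
  induction l with
  | nil => simp
  | cons p t ih =>
    rw [List.map_cons, List.prod_cons, map_mul, normSq_lin, hl p (by simp),
      ih fun p hp => hl p (by simp [hp]), List.length_cons, pow_succ']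

/-! ### Holomorphic stem functions and division -/

/-- A holomorphic stem function on the disc of radius `R`. -/
structure Stem (R : ℝ) (F : ℂ → ℍ[ℂ]) : Prop where
  holo : Holo F (Metric.ball 0 R)
  symm : ∀ z ∈ Metric.ball (0 : ℂ) R, F (conj z) = conjC (F z)

lemma SliceRegularOn.exists_stem {R : ℝ} {f : ℍ → ℍ} (hf : SliceRegularOn f (Metric.ball 0 R)) :
    ∃ F, Stem R F ∧ IsStem R f F := by
  obtain ⟨F, h1, h2⟩ := hf.exists_isStem
  exact ⟨F, ⟨h1, fun z hz => h2.apply_conj hz⟩, h2⟩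

namespace Stem
variable {R : ℝ} {F G : ℂ → ℍ[ℂ]}

lemma isStem_ofStem (hF : Stem R F) : IsStem R (ofStem F) F := SliceRegular.isStem_ofStem hF.symm

lemma regular (hF : Stem R F) : SliceRegularOn (ofStem F) (Metric.ball 0 R) :=
  sliceRegularOn_of_isStem hF.isStem_ofStem hF.holo

lemma mul (hF : Stem R F) (hG : Stem R G) : Stem R (fun z => F z * G z) :=
  ⟨hF.holo.mul hG.holo, fun z hz => by rw [hF.symm z hz, hG.symm z hz, conjC_mul]⟩

lemma smul {c : ℂ → ℂ} (hc : DifferentiableOn ℂ c (Metric.ball 0 R))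
    (hcc : ∀ z, c (starRingEnd ℂ z) = starRingEnd ℂ (c z)) (hF : Stem R F) :
    Stem R (fun z => c z • F z) :=
  ⟨hF.holo.smul hc, fun z hz => by rw [hF.symm z hz, hcc, conjC_smul]⟩

lemma mono (hF : Stem R F) {R' : ℝ} (h : R' ≤ R) : Stem R' F :=
  ⟨hF.holo.mono (Metric.ball_subset_ball h), fun z hz =>
    hF.symm z (Metric.ball_subset_ball h hz)⟩

lemma const (R : ℝ) (w : ℍ) : Stem R (fun _ => ofH w) := ⟨Holo.const _, fun z _ => by simp⟩

lemma lin (R : ℝ) (p : ℍ) : Stem R (lin p) := by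
  refine ⟨?_, fun z _ => (conjC_lin p z).symm⟩
  exact (Holo.coe differentiableOn_id).sub (Holo.const _)

lemma list_prod {ι : Type*} (l : List ι) {Φ : ι → ℂ → ℍ[ℂ]} (h : ∀ p ∈ l, Stem R (Φ p)) :
    Stem R (fun z => (l.map fun p => Φ p z).prod) := by
  induction l with
  | nil => simpa using const R 1
  | cons p l ih =>
    simp only [List.map_cons, List.prod_cons]
    exact (h p (by simp)).mul (ih fun p hp => h p (by simp [hp]))

lemma imH_eq_zero (hF : Stem R F) {z : ℂ} (hz : z ∈ Metric.ball (0 : ℂ) R) (h : z.im = 0) :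
    imH (F z) = 0 := hF.isStem_ofStem.imH_eq_zero hz h

lemma analyticAt_normSq (hF : Stem R F) {z : ℂ} (hz : z ∈ Metric.ball (0 : ℂ) R) :
    AnalyticAt ℂ (fun z => Quaternion.normSq (F z)) z :=
  hF.holo.normSq.analyticAt (Metric.isOpen_ball.mem_nhds hz)

end Stem

lemma Holo.conj {R : ℝ} {F : ℂ → ℍ[ℂ]} (hF : Holo F (Metric.ball 0 R)) :
    Holo (fun z => conjC (F (conj z))) (Metric.ball 0 R) := by
  have key : ∀ G : ℂ → ℂ, DifferentiableOn ℂ G (Metric.ball 0 R) →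
      DifferentiableOn ℂ (fun z => conj (G (conj z))) (Metric.ball 0 R) := by
    intro G hG z hz
    have h1 := (hG (conj z) (conj_mem_ball.2 hz)).differentiableAt
      (Metric.isOpen_ball.mem_nhds (conj_mem_ball.2 hz))
    have h2 := h1.conj_conj
    rw [Complex.conj_conj] at h2
    exact h2.differentiableWithinAt
  exact ⟨key _ hF.re, key _ hF.imI, key _ hF.imJ, key _ hF.imK⟩

lemma eq_of_mul_eq_mul_of_eventually_ne {R : ℝ} {c x y : ℂ → ℂ}
    (hc : ∀ z₀ : ℂ, ∀ᶠ z in nhdsWithin z₀ {z₀}ᶜ, c z ≠ 0)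
    (hx : DifferentiableOn ℂ x (Metric.ball 0 R)) (hy : DifferentiableOn ℂ y (Metric.ball 0 R))
    (h : ∀ z ∈ Metric.ball (0 : ℂ) R, c z * x z = c z * y z) {z : ℂ}
    (hz : z ∈ Metric.ball (0 : ℂ) R) : x z = y z := by
  have hn := Metric.isOpen_ball.mem_nhds hz
  have h1 : x =ᶠ[nhdsWithin z {z}ᶜ] y := by
    filter_upwards [hc z, nhdsWithin_le_nhds hn] with w hw hwb
    exact mul_left_cancel₀ hw (h w hwb)
  exact ((((hx z hz).differentiableAt hn).continuousAt.eventuallyEq_nhds_iff_eventuallyEq_nhdsNE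
    ((hy z hz).differentiableAt hn).continuousAt).1 h1).self_of_nhds

lemma Holo.eq_of_smul_eq {R : ℝ} {c : ℂ → ℂ} {X Y : ℂ → ℍ[ℂ]}
    (hc : ∀ z₀ : ℂ, ∀ᶠ z in nhdsWithin z₀ {z₀}ᶜ, c z ≠ 0)
    (hX : Holo X (Metric.ball 0 R)) (hY : Holo Y (Metric.ball 0 R))
    (h : ∀ z ∈ Metric.ball (0 : ℂ) R, c z • X z = c z • Y z) {z : ℂ}
    (hz : z ∈ Metric.ball (0 : ℂ) R) : X z = Y z := by
  apply Quaternion.ext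
  · exact eq_of_mul_eq_mul_of_eventually_ne hc hX.re hY.re
      (fun z hz => by simpa using congrArg (·.re) (h z hz)) hz
  · exact eq_of_mul_eq_mul_of_eventually_ne hc hX.imI hY.imI
      (fun z hz => by simpa using congrArg (·.imI) (h z hz)) hz
  · exact eq_of_mul_eq_mul_of_eventually_ne hc hX.imJ hY.imJ
      (fun z hz => by simpa using congrArg (·.imJ) (h z hz)) hz
  · exact eq_of_mul_eq_mul_of_eventually_ne hc hX.imK hY.imK
      (fun z hz => by simpa using congrArg (·.imK) (h z hz)) hz

lemma exists_eq_sub_mul {R : ℝ} {x : ℂ → ℂ} (hx : DifferentiableOn ℂ x (Metric.ball 0 R)) {w : ℂ}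
    (hw : w ∈ Metric.ball (0 : ℂ) R) (h : x w = 0) :
    ∃ y : ℂ → ℂ, DifferentiableOn ℂ y (Metric.ball 0 R) ∧ ∀ z, x z = (z - w) * y z := by
  refine ⟨dslope x w, (Complex.differentiableOn_dslope (Metric.isOpen_ball.mem_nhds hw)).2 hx, ?_⟩
  intro z
  rw [← smul_eq_mul, sub_smul_dslope, h, sub_zero]

lemma Holo.exists_eq_sub_smul {R : ℝ} {F : ℂ → ℍ[ℂ]} (hF : Holo F (Metric.ball 0 R)) {w : ℂ}
    (hw : w ∈ Metric.ball (0 : ℂ) R) (h : F w = 0) :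
    ∃ G, Holo G (Metric.ball 0 R) ∧ ∀ z, F z = (z - w) • G z := by
  obtain ⟨y0, d0, h0⟩ := exists_eq_sub_mul hF.re hw (by rw [h, Quaternion.re_zero])
  obtain ⟨y1, d1, h1⟩ := exists_eq_sub_mul hF.imI hw (by rw [h, Quaternion.imI_zero])
  obtain ⟨y2, d2, h2⟩ := exists_eq_sub_mul hF.imJ hw (by rw [h, Quaternion.imJ_zero])
  obtain ⟨y3, d3, h3⟩ := exists_eq_sub_mul hF.imK hw (by rw [h, Quaternion.imK_zero])
  refine ⟨fun z => mkC (y0 z) (y1 z) (y2 z) (y3 z), ⟨d0, d1, d2, d3⟩, fun z => ?_⟩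
  apply Quaternion.ext
  · simpa using h0 z
  · simpa using h1 z
  · simpa using h2 z
  · simpa using h3 z

/-- The quotient and its conjugate reflection become equal after multiplication by `c`, and `c` has
only isolated zeros. -/
lemma Stem.of_smul {R : ℝ} {c : ℂ → ℂ} {F G : ℂ → ℍ[ℂ]} (hF : Stem R F)
    (hG : Holo G (Metric.ball 0 R)) (hc : ∀ z₀ : ℂ, ∀ᶠ z in nhdsWithin z₀ {z₀}ᶜ, c z ≠ 0)
    (hcc : ∀ z, c (conj z) = conj (c z)) (h : ∀ z ∈ Metric.ball (0 : ℂ) R, F z = c z • G z) :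
    Stem R G := by
  refine ⟨hG, fun z hz => ?_⟩
  have h1 := Holo.eq_of_smul_eq hc hG.conj hG (fun w hw => ?_) hz
  · rw [← h1, conjC_conjC]
  · have h2 := h (conj w) (conj_mem_ball.2 hw)
    rw [hF.symm w hw, hcc] at h2
    have h3 := congrArg conjC h2
    rw [conjC_conjC, conjC_smul, Complex.conj_conj] at h3
    rw [← h3, h w hw]

lemma sub_eventually_ne (a z₀ : ℂ) : ∀ᶠ z in nhdsWithin z₀ {z₀}ᶜ, z - a ≠ 0 := by
  filter_upwards [quad_eventually_ne a z₀] with z hz h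
  exact hz (by rw [quad, h, zero_mul])

namespace Stem
variable {R : ℝ} {F : ℂ → ℍ[ℂ]}

lemma div_real (hF : Stem R F) {x : ℝ} (hx : (x : ℂ) ∈ Metric.ball (0 : ℂ) R) (h : F x = 0) :
    ∃ G, Stem R G ∧ ∀ z ∈ Metric.ball (0 : ℂ) R, F z = (z - x) • G z := by
  obtain ⟨G, hG, h1⟩ := hF.holo.exists_eq_sub_smul hx h
  exact ⟨G, hF.of_smul (c := fun z => z - x) hG (sub_eventually_ne _) (fun z => by simp)
    fun z _ => h1 z, fun z _ => h1 z⟩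

/-- By symmetry the stem vanishes at both `w` and `conj w`, and these are distinct. -/
lemma div_quad (hF : Stem R F) {w : ℂ} (hw : w ∈ Metric.ball (0 : ℂ) R) (hi : w.im ≠ 0)
    (h : F w = 0) :
    ∃ G, Stem R G ∧ ∀ z ∈ Metric.ball (0 : ℂ) R, F z = quad w z • G z := by
  obtain ⟨G, hG, h1⟩ := hF.holo.exists_eq_sub_smul hw h
  have h2 : G (starRingEnd ℂ w) = 0 := by
    have h3 := hF.symm w hw
    rw [h, conjC_zero, h1] at h3
    refine (smul_eq_zero.1 h3).resolve_left ?_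
    rw [sub_eq_zero, Complex.conj_eq_iff_im]
    exact hi
  obtain ⟨K, hK, h3⟩ := hG.exists_eq_sub_smul (conj_mem_ball.2 hw) h2
  have h4 : ∀ z, F z = quad w z • K z := fun z => by rw [h1, h3, smul_smul, quad]
  exact ⟨K, hF.of_smul hK (quad_eventually_ne w) (quad_conj w) fun z _ => h4 z, fun z _ => h4 z⟩

/-- Multiplying on the left by the conjugate linear factor makes the stem vanish at `w`, hence
divisible by `quad w`. Multiplying back by the linear factor and cancelling `quad w` gives the
quotient. -/
lemma div_lin (hF : Stem R F) {w : ℂ} (hw : w ∈ Metric.ball (0 : ℂ) R) (hi : 0 < w.im) {I : ℍ}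
    (hI : I ∈ imagUnits) (h : ev I (F w) = 0) :
    ∃ G, Stem R G ∧ ∀ z ∈ Metric.ball (0 : ℂ) R, F z = SliceRegular.lin (slice I w) z * G z := by
  obtain ⟨G, hG, h1⟩ := ((Stem.lin R (star (slice I w))).mul hF).div_quad hw hi.ne'
    (lin_star_mul_eq_zero hI h)
  refine ⟨G, hG, fun z hz => ?_⟩
  refine Holo.eq_of_smul_eq (quad_eventually_ne w) hF.holo ((Stem.lin R _).mul hG).holo
    (fun z hz => ?_) hz
  have h2 := congrArg (SliceRegular.lin (slice I w) z * ·) (h1 z hz)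
  rw [← mul_assoc, lin_mul_star_lin, toC_slice hI hi.le, Quaternion.coe_mul_eq_smul,
    mul_smul_HC] at h2
  exact h2

end Stem

/-! ### Factorization at a sphere and at a real point -/

lemma analyticOrderAt_of_eq_pow_mul {D c E : ℂ → ℂ} {z₀ : ℂ} {k : ℕ} (hc : AnalyticAt ℂ c z₀)
    (hE : AnalyticAt ℂ E z₀) (h : ∀ᶠ z in nhds z₀, D z = c z ^ k * E z) :
    analyticOrderAt D z₀ = k • analyticOrderAt c z₀ + analyticOrderAt E z₀ := by
  have h1 : D =ᶠ[nhds z₀] (c ^ k * E) := h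
  rw [analyticOrderAt_congr h1, analyticOrderAt_mul (hc.pow k) hE, analyticOrderAt_pow hc]

lemma analyticOrderAt_quad_self {w : ℂ} (hw : w.im ≠ 0) : analyticOrderAt (quad w) w = 1 := by
  have h1 : quad w = (· - w) * (· - conj w) := rfl
  have hne : w ≠ conj w := fun h => hw (Complex.conj_eq_iff_im.1 h.symm)
  rw [h1, analyticOrderAt_mul (by fun_prop) (by fun_prop), analyticOrderAt_id_sub_const_self,
    analyticOrderAt_id_sub_const_of_ne hne, add_zero]

/-- The factorization of a stem function at a nonreal point. -/
lemma Stem.exists_factorization {R : ℝ} {z₀ : ℂ} (hz₀ : z₀ ∈ Metric.ball (0 : ℂ) R)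
    (hi : 0 < z₀.im) (N : ℕ) {F : ℂ → ℍ[ℂ]} (hF : Stem R F)
    (hN : analyticOrderAt (fun z => Quaternion.normSq (F z)) z₀ = N) :
    ∃ (l : List ℍ) (m : ℕ) (G : ℂ → ℍ[ℂ]), Stem R G ∧ (∀ p ∈ l, toC p = z₀) ∧
      (l.IsChain fun p p' => star p' ≠ p) ∧ Quaternion.normSq (G z₀) ≠ 0 ∧
      ∀ z ∈ Metric.ball (0 : ℂ) R,
        F z = (l.map fun p => SliceRegular.lin p z).prod * quad z₀ z ^ m • G z := by
  induction N generalizing F with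
  | zero =>
    refine ⟨[], 0, F, hF, by simp, by simp, ?_, by simp⟩
    rw [Nat.cast_zero, (hF.analyticAt_normSq hz₀).analyticOrderAt_eq_zero] at hN
    exact hN
  | succ N ih =>
    have h0 : Quaternion.normSq (F z₀) = 0 := by
      by_contra h
      have h := (hF.analyticAt_normSq hz₀).analyticOrderAt_eq_zero.2 h
      rw [h] at hN
      exact absurd hN (by norm_cast)
    obtain ⟨I, hI, hev⟩ := exists_ev_eq_zero h0
    obtain ⟨F₁, hF₁, h1⟩ := hF.div_lin hz₀ hi hI hev
    set p := slice I z₀ with hp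
    have hpz : toC p = z₀ := toC_slice hI hi.le
    have hord := analyticOrderAt_of_eq_pow_mul (D := fun z => Quaternion.normSq (F z)) (k := 1)
      (analyticAt_quad z₀ z₀) (hF₁.analyticAt_normSq hz₀) (by
        filter_upwards [Metric.isOpen_ball.mem_nhds hz₀] with z hz
        rw [h1 z hz, map_mul, normSq_lin, hpz, pow_one])
    rw [hN, analyticOrderAt_quad_self hi.ne', one_smul] at hord
    have hN1 : analyticOrderAt (fun z => Quaternion.normSq (F₁ z)) z₀ = N := by
      have hne : analyticOrderAt (fun z => Quaternion.normSq (F₁ z)) z₀ ≠ ⊤ := by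
        intro h
        rw [h] at hord
        simp at hord
      obtain ⟨M, hM⟩ := ENat.ne_top_iff_exists.1 hne
      rw [← hM] at hord ⊢
      norm_cast at hord ⊢
      omega
    obtain ⟨l, m, G, hG, hl, hc, hn, h2⟩ := ih hF₁ hN1
    cases l with
    | nil =>
      refine ⟨[p], m, G, hG, by simpa using hpz, by simp, hn, fun z hz => ?_⟩
      rw [h1 z hz, h2 z hz]; simp
    | cons p' t =>
      by_cases hpp : star p' = p
      -- A new factor conjugate to the head of the list multiplies with it to `quad z₀`, so the pair
      -- moves into the spherical part.
      · refine ⟨t, m + 1, G, hG, fun x hx => hl x (by simp [hx]), hc.tail, hn, fun z hz => ?_⟩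
        rw [h1 z hz, h2 z hz, List.map_cons, List.prod_cons, ← hpp]
        rw [mul_assoc (SliceRegular.lin p' z), ← mul_assoc, star_lin_mul_lin, hl p' (by simp),
          Quaternion.coe_mul_eq_smul, ← mul_smul_HC, smul_smul, pow_succ']
      · refine ⟨p :: p' :: t, m, G, hG, ?_, List.isChain_cons_cons.2 ⟨hpp, hc⟩, hn, fun z hz => ?_⟩
        · intro x hx
          rcases List.mem_cons.1 hx with rfl | hx
          · exact hpz
          · exact hl x hx
        · rw [h1 z hz, h2 z hz, List.map_cons, List.prod_cons, mul_assoc]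
          simp only [List.map_cons, List.prod_cons, mul_assoc]

lemma Stem.order_of_factorization {R : ℝ} {z₀ : ℂ} (hz₀ : z₀ ∈ Metric.ball (0 : ℂ) R)
    (hi : z₀.im ≠ 0) {F G : ℂ → ℍ[ℂ]} {l : List ℍ} {m : ℕ} (hG : Stem R G)
    (hl : ∀ p ∈ l, toC p = z₀) (hn : Quaternion.normSq (G z₀) ≠ 0)
    (h : ∀ z ∈ Metric.ball (0 : ℂ) R,
        F z = (l.map fun p => SliceRegular.lin p z).prod * quad z₀ z ^ m • G z) :
    analyticOrderAt (fun z => Quaternion.normSq (F z)) z₀ = (l.length + 2 * m : ℕ) := by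
  have hord := analyticOrderAt_of_eq_pow_mul (D := fun z => Quaternion.normSq (F z))
    (k := l.length + 2 * m) (analyticAt_quad z₀ z₀) (hG.analyticAt_normSq hz₀) (by
      filter_upwards [Metric.isOpen_ball.mem_nhds hz₀] with z hz
      rw [h z hz, map_mul, normSq_prod_lin hl, Quaternion.normSq_smul]
      ring)
  rw [hord, analyticOrderAt_quad_self hi, (hG.analyticAt_normSq hz₀).analyticOrderAt_eq_zero.2 hn]
  simp

lemma quad_pow_eventually_ne (w : ℂ) (m : ℕ) (z₀ : ℂ) :
    ∀ᶠ z in nhdsWithin z₀ {z₀}ᶜ, quad w z ^ m ≠ 0 :=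
  (quad_eventually_ne w z₀).mono fun _ hz => pow_ne_zero m hz

/-- After cancelling the common power, a surplus power of `quad z₀` would make one of the two
quotients vanish at `z₀`. -/
lemma Holo.quad_pow_unique {R : ℝ} {z₀ : ℂ} (hz₀ : z₀ ∈ Metric.ball (0 : ℂ) R)
    {G₁ G₂ : ℂ → ℍ[ℂ]} {m₁ m₂ : ℕ} (h1 : Holo G₁ (Metric.ball 0 R))
    (h2 : Holo G₂ (Metric.ball 0 R)) (n1 : G₁ z₀ ≠ 0) (n2 : G₂ z₀ ≠ 0)
    (h : ∀ z ∈ Metric.ball (0 : ℂ) R, quad z₀ z ^ m₁ • G₁ z = quad z₀ z ^ m₂ • G₂ z) :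
    m₁ = m₂ ∧ G₁ z₀ = G₂ z₀ := by
  wlog hle : m₁ ≤ m₂ generalizing m₁ m₂ G₁ G₂
  · obtain ⟨e1, e2⟩ := this h2 h1 n2 n1 (fun z hz => (h z hz).symm) (by omega)
    exact ⟨e1.symm, e2.symm⟩
  obtain ⟨d, rfl⟩ := Nat.exists_eq_add_of_le hle
  have h3 : G₁ z₀ = quad z₀ z₀ ^ d • G₂ z₀ := by
    refine Holo.eq_of_smul_eq (quad_pow_eventually_ne z₀ m₁) h1
      (h2.smul (c := fun z => quad z₀ z ^ d) ((differentiable_quad z₀).pow d).differentiableOn)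
      (fun z hz => ?_) hz₀
    rw [h z hz, smul_smul, pow_add]
  rcases Nat.eq_zero_or_pos d with rfl | hd
  · simpa using h3
  · refine absurd ?_ n1
    rw [h3, quad_self, zero_pow hd.ne']
    apply Quaternion.ext <;> simp

/-- The factorization of a stem function at a real point. -/
lemma Stem.exists_factorization_real {R : ℝ} {x : ℝ} (hx : (x : ℂ) ∈ Metric.ball (0 : ℂ) R)
    (N : ℕ) {F : ℂ → ℍ[ℂ]} (hF : Stem R F)
    (hN : analyticOrderAt (fun z => Quaternion.normSq (F z)) x = N) :
    ∃ (k : ℕ) (G : ℂ → ℍ[ℂ]), Stem R G ∧ Quaternion.normSq (G x) ≠ 0 ∧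
      ∀ z ∈ Metric.ball (0 : ℂ) R, F z = (z - x) ^ k • G z := by
  induction N using Nat.strong_induction_on generalizing F with
  | _ N ih =>
    by_cases h0 : Quaternion.normSq (F x) = 0
    · have hz : F x = 0 := by
        rw [eq_ofH_of_imH_eq_zero (hF.imH_eq_zero hx (by simp)), normSq_ofH] at h0
        rw [eq_ofH_of_imH_eq_zero (hF.imH_eq_zero hx (by simp))]
        have : reH (F x) = 0 := by simpa using h0
        rw [this, ofH_zero]
      obtain ⟨F₁, hF₁, h1⟩ := hF.div_real hx hz
      have hord := analyticOrderAt_of_eq_pow_mul (D := fun z => Quaternion.normSq (F z)) (k := 2)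
        (c := fun z => z - (x : ℂ)) (by fun_prop) (hF₁.analyticAt_normSq hx) (by
          filter_upwards [Metric.isOpen_ball.mem_nhds hx] with z hz
          rw [h1 z hz, Quaternion.normSq_smul])
      rw [hN, analyticOrderAt_id_sub_const_self] at hord
      have hne : analyticOrderAt (fun z => Quaternion.normSq (F₁ z)) x ≠ ⊤ := by
        intro h
        rw [h] at hord
        simp at hord
      obtain ⟨M, hM⟩ := ENat.ne_top_iff_exists.1 hne
      rw [← hM] at hord
      have hNM : N = 2 + M := by
        have : (N : ℕ∞) = ((2 + M : ℕ) : ℕ∞) := by rw [hord]; simp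
        exact_mod_cast this
      obtain ⟨k, G, hG, hn, h2⟩ := ih M (by omega) hF₁ hM.symm
      refine ⟨k + 1, G, hG, hn, fun z hz => ?_⟩
      rw [h1 z hz, h2 z hz, smul_smul, pow_succ']
    · exact ⟨0, F, hF, h0, by simp⟩

lemma Stem.order_of_factorization_real {R : ℝ} {x : ℝ} (hx : (x : ℂ) ∈ Metric.ball (0 : ℂ) R)
    {F G : ℂ → ℍ[ℂ]} {k : ℕ} (hG : Stem R G) (hn : Quaternion.normSq (G x) ≠ 0)
    (h : ∀ z ∈ Metric.ball (0 : ℂ) R, F z = (z - x) ^ k • G z) :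
    analyticOrderAt (fun z => Quaternion.normSq (F z)) x = (2 * k : ℕ) := by
  have hord := analyticOrderAt_of_eq_pow_mul (D := fun z => Quaternion.normSq (F z)) (k := 2 * k)
    (c := fun z => z - (x : ℂ)) (by fun_prop) (hG.analyticAt_normSq hx) (by
      filter_upwards [Metric.isOpen_ball.mem_nhds hx] with z hz
      rw [h z hz, Quaternion.normSq_smul, ← pow_mul, mul_comm k])
  rw [hord, analyticOrderAt_id_sub_const_self,
    (hG.analyticAt_normSq hx).analyticOrderAt_eq_zero.2 hn]
  simp

/-! ### Multiplicities and the order of the symmetrization -/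

lemma csSup_eq_of_forall {s : Set ℕ} {k : ℕ} (h : k ∈ s) (hu : ∀ j ∈ s, j = k) : sSup s = k := by
  rw [show s = {k} from Set.eq_singleton_iff_unique_mem.2 ⟨h, hu⟩, csSup_singleton]

/-- The empty set also has supremum `0` in `ℕ`, so multiplicity zero does not require exhibiting a
factorization. -/
lemma csSup_eq_zero_of_forall {s : Set ℕ} (hu : ∀ j ∈ s, j = 0) : sSup s = 0 := by
  rcases s.eq_empty_or_nonempty with rfl | ⟨j, hj⟩
  · simp
  · have := hu j hj
    exact csSup_eq_of_forall (this ▸ hj) hu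

lemma normSq_ne_zero_of_forall {R : ℝ} {g : ℍ → ℍ} {G : ℂ → ℍ[ℂ]} (hg : IsStem R g G) {q : ℍ}
    (hq : toC q ∈ Metric.ball (0 : ℂ) R) (h : ∀ p ∈ sphereOf q, g p ≠ 0) :
    Quaternion.normSq (G (toC q)) ≠ 0 := by
  intro h0
  obtain ⟨I, hI, hev⟩ := exists_ev_eq_zero h0
  refine h (slice I (toC q)) ?_ (by rw [hg I hI _ hq, hev])
  rw [mem_sphereOf, toC_slice hI (toC_im_nonneg q)]

lemma forall_ne_zero_of_normSq {R : ℝ} {g : ℍ → ℍ} {G : ℂ → ℍ[ℂ]} (hg : IsStem R g G) {q : ℍ}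
    (hq : toC q ∈ Metric.ball (0 : ℂ) R) (h : Quaternion.normSq (G (toC q)) ≠ 0) :
    ∀ p ∈ sphereOf q, g p ≠ 0 := by
  intro p hp h0
  rw [mem_sphereOf] at hp
  obtain ⟨I, hI, hs⟩ := exists_slice_eq p
  rw [hp] at hs
  rw [← hs, hg I hI _ hq] at h0
  exact h (normSq_eq_zero_of_ev hI h0)

lemma exists_ne_zero_iff {R : ℝ} {g : ℍ → ℍ} {G : ℂ → ℍ[ℂ]} (hg : IsStem R g G) {q : ℍ}
    (hq : toC q ∈ Metric.ball (0 : ℂ) R) : (∃ p ∈ sphereOf q, g p ≠ 0) ↔ G (toC q) ≠ 0 := by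
  constructor
  · rintro ⟨p, hp, h⟩ h0
    rw [mem_sphereOf] at hp
    obtain ⟨I, hI, hs⟩ := exists_slice_eq p
    rw [hp] at hs
    rw [← hs, hg I hI _ hq, h0, ev_zero] at h
    exact h rfl
  · intro h
    by_contra! h0
    refine h (eq_of_forall_ev_eq fun I hI => ?_)
    rw [ev_zero, ← hg I hI _ hq]
    exact h0 _ (by rw [mem_sphereOf, toC_slice hI (toC_im_nonneg q)])

lemma isStem_spherePoly_pow_mul {R : ℝ} {g : ℍ → ℍ} {G : ℂ → ℍ[ℂ]} (hg : IsStem R g G) (q : ℍ)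
    (m : ℕ) : IsStem R (fun z => spherePoly q z ^ m * g z)
      (fun z => quad (toC q) z ^ m • G z) :=
  ((isStem_spherePoly R q).coe_pow m).coe_mul hg

section
variable {R : ℝ} {f : ℍ → ℍ} {F : ℂ → ℍ[ℂ]}

/-- Passage from functions to stems: not vanishing identically on the sphere means that the stem is
nonzero at its point. Having no zero on the sphere, as in `mem_nonrealMult`, is the stronger
condition that `normSq` of the stem is nonzero. -/
lemma mem_sphericalMult {q : ℍ} (hq : toC q ∈ Metric.ball (0 : ℂ) R) (hf : IsStem R f F) {m : ℕ} :
    (∃ g : ℍ → ℍ, SliceRegularOn g (Metric.ball 0 R) ∧ (∃ p ∈ sphereOf q, g p ≠ 0) ∧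
      ∀ x ∈ Metric.ball (0 : ℍ) R, f x = spherePoly q x ^ m * g x) ↔
    ∃ G, Stem R G ∧ G (toC q) ≠ 0 ∧
      ∀ z ∈ Metric.ball (0 : ℂ) R, F z = quad (toC q) z ^ m • G z := by
  constructor
  · rintro ⟨g, hg, hn, h⟩
    obtain ⟨G, hG, hgG⟩ := hg.exists_stem
    exact ⟨G, hG, (exists_ne_zero_iff hgG hq).1 hn, fun z hz =>
      hf.unique ((isStem_spherePoly_pow_mul hgG q m).congr_left h) hz⟩
  · rintro ⟨G, hG, hn, h⟩
    refine ⟨ofStem G, hG.regular, (exists_ne_zero_iff hG.isStem_ofStem hq).2 hn, fun x hx => ?_⟩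
    obtain ⟨I, hI, hs⟩ := exists_slice_eq x
    have hx' := toC_mem_ball.2 hx
    rw [hf.apply_eq hx hI hs, h _ hx',
      (isStem_spherePoly_pow_mul hG.isStem_ofStem q m).apply_eq hx hI hs]

lemma mem_nonrealMult {q : ℍ} (hq : toC q ∈ Metric.ball (0 : ℂ) R) (hf : IsStem R f F)
    {l : List ℍ} {m : ℕ} :
    (∃ g : ℍ → ℍ, SliceRegularOn g (Metric.ball 0 R) ∧ (∀ p ∈ sphereOf q, g p ≠ 0) ∧
      ∀ x ∈ Metric.ball (0 : ℍ) R, f x = (l.map (fun p z => z - p)).foldr starMul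
        (fun z => spherePoly q z ^ m * g z) x) ↔
    ∃ G, Stem R G ∧ Quaternion.normSq (G (toC q)) ≠ 0 ∧
      ∀ z ∈ Metric.ball (0 : ℂ) R,
        F z = (l.map fun p => lin p z).prod * quad (toC q) z ^ m • G z := by
  constructor
  · rintro ⟨g, hg, hn, h⟩
    obtain ⟨G, hG, hgG⟩ := hg.exists_stem
    refine ⟨G, hG, normSq_ne_zero_of_forall hgG hq hn, fun z hz => ?_⟩
    exact hf.unique ((IsStem.foldr l (fun p _ => isStem_lin R p)
      (isStem_spherePoly_pow_mul hgG q m)).congr_left h) hz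
  · rintro ⟨G, hG, hn, h⟩
    refine ⟨ofStem G, hG.regular, forall_ne_zero_of_normSq hG.isStem_ofStem hq hn, fun x hx => ?_⟩
    obtain ⟨I, hI, hs⟩ := exists_slice_eq x
    have hx' := toC_mem_ball.2 hx
    rw [hf.apply_eq hx hI hs, h _ hx', (IsStem.foldr l (fun p _ => isStem_lin R p)
      (isStem_spherePoly_pow_mul hG.isStem_ofStem q m)).apply_eq hx hI hs]

lemma mem_realMult {x : ℝ} (hx : (x : ℂ) ∈ Metric.ball (0 : ℂ) R) (hf : IsStem R f F) {k : ℕ} :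
    (∃ g : ℍ → ℍ, SliceRegularOn g (Metric.ball 0 R) ∧ g x ≠ 0 ∧
      ∀ q ∈ Metric.ball (0 : ℍ) R, f q = (q - x) ^ k * g q) ↔
    ∃ G, Stem R G ∧ Quaternion.normSq (G x) ≠ 0 ∧
      ∀ z ∈ Metric.ball (0 : ℂ) R, F z = (z - x) ^ k • G z := by
  have hl : IsStem R (fun q => q - (x : ℍ)) (fun z => ((z - x : ℂ) : ℍ[ℂ])) :=
    (isStem_lin R x).congr_right fun z _ => by rw [lin, ofH_coe, Quaternion.coe_sub]
  have key : ∀ {g G}, Stem R G → IsStem R g G → (g x ≠ 0 ↔ Quaternion.normSq (G x) ≠ 0) := by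
    intro g G hG hg
    rw [← slice_ofReal unitI, hg _ unitI_mem _ hx,
      eq_ofH_of_imH_eq_zero (hG.imH_eq_zero hx (by simp)), ev_ofH, normSq_ofH]
    simp
  constructor
  · rintro ⟨g, hg, hn, h⟩
    obtain ⟨G, hG, hgG⟩ := hg.exists_stem
    refine ⟨G, hG, (key hG hgG).1 hn, fun z hz => ?_⟩
    exact hf.unique (((hl.coe_pow k).coe_mul hgG).congr_left h) hz
  · rintro ⟨G, hG, hn, h⟩
    refine ⟨ofStem G, hG.regular, (key hG hG.isStem_ofStem).2 hn, fun q hq => ?_⟩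
    obtain ⟨I, hI, hs⟩ := exists_slice_eq q
    rw [hf.apply_eq hq hI hs, h _ (toC_mem_ball.2 hq),
      ((hl.coe_pow k).coe_mul hG.isStem_ofStem).apply_eq hq hI hs]

lemma im_ne_zero_of_toC {q : ℍ} {z₀ : ℂ} (hi : 0 < z₀.im) (hq : toC q = z₀) : q.im ≠ 0 := by
  intro h
  rw [← toC_im_eq_zero, hq] at h
  exact hi.ne' h

/-- The multiplicities on a nonreal sphere add up to the order of the symmetrization. -/
theorem multiplicities_of_nonreal (hF : Stem R F) (hf : IsStem R f F) {z₀ : ℂ}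
    (hz₀ : z₀ ∈ Metric.ball (0 : ℂ) R) (hi : 0 < z₀.im) {N : ℕ}
    (hN : analyticOrderAt (fun z => Quaternion.normSq (F z)) z₀ = N) :
    ∃ (k m : ℕ) (p : ℍ), k + 2 * m = N ∧ toC p = z₀ ∧
      isolatedMult f (Metric.ball 0 R) p = k ∧
      (∀ q, toC q = z₀ → q ≠ p → isolatedMult f (Metric.ball 0 R) q = 0) ∧
      ∀ q, toC q = z₀ → sphericalMult f (Metric.ball 0 R) q = m := by
  obtain ⟨l, m, G, hG, hl, hc, hn, h⟩ := hF.exists_factorization hz₀ hi N hN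
  have hord := Stem.order_of_factorization hz₀ hi.ne' hG hl hn h
  rw [hN] at hord
  have hkm : N = l.length + 2 * m := by exact_mod_cast hord
  have hstem : ∀ {l : List ℍ} {G}, Stem R G → Stem R (fun z => (l.map fun p => lin p z).prod * G z) :=
    fun {l G} hG => (Stem.list_prod l fun p _ => Stem.lin R p).mul hG
  have hG1 : Stem R (fun z => (l.map fun p => lin p z).prod * G z) := hstem hG
  have hne1 := prod_lin_mul_ne_zero hi.ne' hn hl hc
  have hFG1 : ∀ z ∈ Metric.ball (0 : ℂ) R,
      F z = quad z₀ z ^ m • ((l.map fun p => lin p z).prod * G z) := fun z hz => by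
    rw [h z hz, mul_smul_HC]
  have hsph : ∀ q, toC q = z₀ → sphericalMult f (Metric.ball 0 R) q = m := by
    intro q hq
    rw [sphericalMult]
    apply csSup_eq_of_forall
    · rw [Set.mem_ofPred_eq, mem_sphericalMult (by rwa [hq]) hf, hq]
      exact ⟨_, hG1, hne1, hFG1⟩
    · intro m' hm'
      rw [Set.mem_ofPred_eq, mem_sphericalMult (by rwa [hq]) hf, hq] at hm'
      obtain ⟨G', hG', hn', h'⟩ := hm'
      exact (Holo.quad_pow_unique hz₀ hG'.holo hG1.holo hn' hne1 fun z hz => by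
        rw [← h' z hz, hFG1 z hz]).1
  have hiso : ∀ q, toC q = z₀ → ∀ k', (∃ (l' : List ℍ) (m' : ℕ) (g : ℍ → ℍ), l'.length = k' ∧
      (∀ p ∈ l', p ∈ sphereOf q) ∧ (∀ p ∈ l'.head?, p = q) ∧
      l'.IsChain (fun p p' => star p' ≠ p) ∧
      SliceRegularOn g (Metric.ball 0 R) ∧ (∀ p ∈ sphereOf q, g p ≠ 0) ∧
      ∀ x ∈ Metric.ball 0 R, f x = (l'.map (fun p z => z - p)).foldr starMul
        (fun z => spherePoly q z ^ m' * g z) x) → k' = l.length ∧ (k' = 0 ∨ l.head? = some q) := by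
    rintro q hq k' ⟨l', m', g, hk', hl', hh', hc', hg⟩
    obtain ⟨G', hG', hn', h'⟩ := (mem_nonrealMult (by rwa [hq]) hf).1 ⟨g, hg⟩
    rw [hq] at hn' h'
    have hl'' : ∀ p ∈ l', toC p = z₀ := fun p hp => (mem_sphereOf.1 (hl' p hp)).trans hq
    have hne' := prod_lin_mul_ne_zero hi.ne' hn' hl'' hc'
    obtain ⟨hm, he⟩ := Holo.quad_pow_unique hz₀ hG1.holo (hstem hG').holo hne1 hne'
      fun z hz => by rw [← hFG1 z hz, h' z hz, mul_smul_HC]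
    have hord' := Stem.order_of_factorization hz₀ hi.ne' hG' hl'' hn' h'
    rw [hN] at hord'
    have hkm' : N = l'.length + 2 * m' := by exact_mod_cast hord'
    refine ⟨by omega, ?_⟩
    cases l' with
    | nil => left; simpa using hk'.symm
    | cons a t =>
      right
      cases l with
      -- Excluded because both lists have the same length, the exponents `m` and `m'` being equal.
      | nil => simp at hkm hkm'; omega
      | cons b s =>
        have ha : a = q := hh' a (by simp)
        obtain ⟨I, hI, hIa⟩ := exists_slice_eq a
        obtain ⟨J, hJ, hJb⟩ := exists_slice_eq b
        rw [hl'' a (by simp)] at hIa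
        rw [hl b (by simp)] at hJb
        -- Both factorizations have the same nonzero value at `z₀` once the power of `quad z₀` is
        -- removed. Each head makes its evaluation vanish, so two different heads would force that
        -- value to be zero.
        have e1 : ev J (((b :: s).map fun p => lin p z₀).prod * G z₀) = 0 := by
          rw [List.map_cons, List.prod_cons, mul_assoc, ← hJb]
          exact ev_lin_mul hJ _ _
        have e2 : ev I (((b :: s).map fun p => lin p z₀).prod * G z₀) = 0 := by
          rw [he, List.map_cons, List.prod_cons, mul_assoc, ← hIa]
          exact ev_lin_mul hI _ _
        by_cases hIJ : I = J
        · rw [List.head?_cons, ← hJb, ← hIJ, hIa, ha]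
        · exact absurd (eq_of_ev_eq hIJ (e2.trans (ev_zero I).symm) (e1.trans (ev_zero J).symm)) hne1
  have hmult : ∀ q, toC q = z₀ → isolatedMult f (Metric.ball 0 R) q =
      nonrealMult f (Metric.ball 0 R) q := fun q hq => by
    rw [isolatedMult, if_neg (im_ne_zero_of_toC hi hq)]
  cases l with
  | nil =>
    refine ⟨0, m, slice unitI z₀, by simpa using hkm.symm, toC_slice unitI_mem hi.le, ?_, ?_, hsph⟩
    · rw [hmult _ (toC_slice unitI_mem hi.le), nonrealMult]
      exact csSup_eq_zero_of_forall fun j hj => (hiso _ (toC_slice unitI_mem hi.le) j hj).1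
    · intro q hq _
      rw [hmult q hq, nonrealMult]
      exact csSup_eq_zero_of_forall fun j hj => (hiso q hq j hj).1
  | cons b s =>
    have hb := hl b (by simp)
    refine ⟨(b :: s).length, m, b, hkm.symm, hb, ?_, ?_, hsph⟩
    · rw [hmult b hb, nonrealMult]
      apply csSup_eq_of_forall
      · obtain ⟨g, hg1, hg2, hg3⟩ := (mem_nonrealMult (q := b) (l := b :: s) (m := m)
          (by rwa [hb]) hf).2 ⟨G, hG, by rwa [hb], by rwa [hb]⟩
        exact ⟨b :: s, m, g, rfl, fun p hp => mem_sphereOf.2 ((hl p hp).trans hb.symm),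
          by simp, hc, hg1, hg2, hg3⟩
      · exact fun j hj => (hiso b hb j hj).1
    · intro q hq hqb
      rw [hmult q hq, nonrealMult]
      refine csSup_eq_zero_of_forall fun j hj => ?_
      refine (hiso q hq j hj).2.resolve_right fun h => hqb ?_
      simpa using h.symm

/-- Twice the multiplicity at a real point is the order of the symmetrization. -/
theorem multiplicity_of_real (hF : Stem R F) (hf : IsStem R f F) {x : ℝ}
    (hx : (x : ℂ) ∈ Metric.ball (0 : ℂ) R) {N : ℕ}
    (hN : analyticOrderAt (fun z => Quaternion.normSq (F z)) x = N) :
    2 * isolatedMult f (Metric.ball 0 R) x = N := by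
  obtain ⟨k, G, hG, hn, h⟩ := hF.exists_factorization_real hx N hN
  have hord := Stem.order_of_factorization_real hx hG hn h
  rw [hN] at hord
  have hk : N = 2 * k := by exact_mod_cast hord
  rw [isolatedMult, if_pos (by simp), realMult, hk]
  congr 1
  apply csSup_eq_of_forall
  · exact (mem_realMult hx hf).2 ⟨G, hG, hn, h⟩
  · intro k' hk'
    obtain ⟨G', hG', hn', h'⟩ := (mem_realMult hx hf).1 hk'
    have hord' := Stem.order_of_factorization_real hx hG' hn' h'
    rw [hN] at hord'
    have hk' : N = 2 * k' := by exact_mod_cast hord'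
    omega

end

/-! ### Counting zeros by spheres -/

/-- The terms of the list of isolated zeros which lie on the sphere of `z`. -/
def isolatedFiber (f : ℍ → ℍ) (U : Set ℍ) (z : ℂ) : Set (ℍ × ℕ) :=
  {a | toC a.1 = z ∧ a.2 < isolatedMult f U a.1}

/-- The terms of the list of spherical zeros which belong to the sphere of `z`. -/
def sphericalFiber (f : ℍ → ℍ) (U : Set ℍ) (z : ℂ) : Set (Set ℍ × ℕ) :=
  {a | ∃ q, toC q = z ∧ q.im ≠ 0 ∧ a.1 = sphereOf q ∧ a.2 < sphericalMult f U q}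

lemma encard_singleton_prod_lt {α : Type*} (a : α) (k : ℕ) :
    {x : α × ℕ | x.1 = a ∧ x.2 < k}.encard = k := by
  have : {x : α × ℕ | x.1 = a ∧ x.2 < k} = (fun n => (a, n)) '' (Finset.range k : Set ℕ) := by
    ext ⟨b, n⟩
    simp only [Set.mem_ofPred_eq, Finset.coe_range, Set.mem_image, Set.mem_Iio, Prod.mk.injEq]
    constructor
    · rintro ⟨rfl, h⟩; exact ⟨n, h, rfl, rfl⟩
    · rintro ⟨j, h, rfl, rfl⟩; exact ⟨rfl, h⟩
  rw [this, Function.Injective.encard_image (fun x y h => (Prod.mk.inj h).2),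
    Set.encard_coe_eq_coe_finsetCard, Finset.card_range]

/-- A real point carries order `2c`, while a nonreal sphere corresponds to two conjugate points of
order `c` each. Either way a sphere with `c` listed zeros contributes `2c` to the total order. -/
lemma encard_fibers {R : ℝ} {f : ℍ → ℍ} {F : ℂ → ℍ[ℂ]} (hF : Stem R F) (hf : IsStem R f F) {z₀ : ℂ}
    (hz₀ : z₀ ∈ Metric.ball (0 : ℂ) R) (hi : 0 ≤ z₀.im) {N : ℕ}
    (hN : analyticOrderAt (fun z => Quaternion.normSq (F z)) z₀ = N) :
    ∃ c : ℕ, (isolatedFiber f (Metric.ball 0 R) z₀).encard +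
      2 * (sphericalFiber f (Metric.ball 0 R) z₀).encard = c ∧
      N = (if z₀.im = 0 then 2 else 1) * c := by
  rcases hi.eq_or_lt with h0 | h0
  · obtain ⟨x, rfl⟩ : ∃ x : ℝ, z₀ = x := ⟨z₀.re, by apply Complex.ext <;> simp [← h0]⟩
    refine ⟨isolatedMult f (Metric.ball 0 R) x, ?_, ?_⟩
    · have hq : ∀ q : ℍ, toC q = x ↔ q = x := by
        intro q
        constructor
        · intro h
          obtain ⟨I, hI, hs⟩ := exists_slice_eq q
          rw [h, slice_ofReal] at hs
          exact hs.symm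
        · rintro rfl
          apply Complex.ext <;> simp
      have e1 : isolatedFiber f (Metric.ball 0 R) x =
          {a | a.1 = (x : ℍ) ∧ a.2 < isolatedMult f (Metric.ball 0 R) x} := by
        ext ⟨q, n⟩
        simp only [isolatedFiber, Set.mem_ofPred_eq, hq]
        constructor
        · rintro ⟨rfl, h⟩; exact ⟨rfl, h⟩
        · rintro ⟨rfl, h⟩; exact ⟨rfl, h⟩
      have e2 : sphericalFiber f (Metric.ball 0 R) x = ∅ := by
        ext ⟨q, n⟩
        simp only [sphericalFiber, Set.mem_ofPred_eq, Set.mem_empty_iff_false, iff_false, hq]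
        rintro ⟨q, rfl, h, -⟩
        simp at h
      rw [e1, e2, encard_singleton_prod_lt]; simp
    · rw [if_pos (by simp), multiplicity_of_real hF hf hz₀ hN]
  · obtain ⟨k, m, p, hkm, hp, hk, hk0, hm⟩ := multiplicities_of_nonreal hF hf hz₀ h0 hN
    refine ⟨k + 2 * m, ?_, by rw [if_neg h0.ne', one_mul, hkm]⟩
    have e1 : isolatedFiber f (Metric.ball 0 R) z₀ = {a | a.1 = p ∧ a.2 < k} := by
      ext ⟨q, n⟩
      simp only [isolatedFiber, Set.mem_ofPred_eq]
      constructor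
      · rintro ⟨h1, h2⟩
        by_cases hqp : q = p
        · subst hqp; exact ⟨rfl, hk ▸ h2⟩
        · rw [hk0 q h1 hqp] at h2; omega
      · rintro ⟨rfl, h⟩; exact ⟨hp, hk.symm ▸ h⟩
    have e2 : sphericalFiber f (Metric.ball 0 R) z₀ = {a | a.1 = sphereOf p ∧ a.2 < m} := by
      ext ⟨s, n⟩
      simp only [sphericalFiber, Set.mem_ofPred_eq]
      constructor
      · rintro ⟨q, h1, -, rfl, h2⟩
        refine ⟨?_, hm q h1 ▸ h2⟩
        ext x
        rw [mem_sphereOf, mem_sphereOf, h1, hp]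
      · rintro ⟨rfl, h⟩
        exact ⟨p, hp, im_ne_zero_of_toC h0 hp, rfl, (hm p hp).symm ▸ h⟩
    rw [e1, e2, encard_singleton_prod_lt, encard_singleton_prod_lt]
    push_cast; rfl

lemma encard_biUnion_finset_le {α β : Type*} (Z : Finset α) (t : α → Set β) :
    (⋃ z ∈ Z, t z).encard ≤ ∑ z ∈ Z, (t z).encard := by
  classical
  induction Z using Finset.induction_on with
  | empty => simp
  | insert a Z ha ih =>
    rw [Finset.set_biUnion_insert, Finset.sum_insert ha]
    exact (Set.encard_union_le _ _).trans (add_le_add le_rfl ih)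

lemma encard_biUnion_finset {α β : Type*} (Z : Finset α) (t : α → Set β)
    (h : ∀ x y b, b ∈ t x → b ∈ t y → x = y) :
    (⋃ z ∈ Z, t z).encard = ∑ z ∈ Z, (t z).encard := by
  classical
  induction Z using Finset.induction_on with
  | empty => simp
  | insert a Z ha ih =>
    rw [Finset.set_biUnion_insert, Finset.sum_insert ha, Set.encard_union_eq, ih]
    rw [Set.disjoint_left]
    intro b hb hb'
    simp only [Set.mem_iUnion] at hb'
    obtain ⟨y, hy, hby⟩ := hb'
    exact ha (h a y b hb hby ▸ hy)

lemma zeroCount_le_sum {f : ℍ → ℍ} {U s : Set ℍ} (Z : Finset ℂ)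
    (h1 : ∀ q ∈ s, toC q ∉ Z → isolatedFiber f U (toC q) = ∅)
    (h2 : ∀ q ∈ s, toC q ∉ Z → sphericalFiber f U (toC q) = ∅) :
    zeroCount f U s ≤
      ∑ z ∈ Z, ((isolatedFiber f U z).encard + 2 * (sphericalFiber f U z).encard) := by
  rw [Finset.sum_add_distrib, ← Finset.mul_sum, zeroCount]
  refine add_le_add ?_ (mul_le_mul_right ?_ _)
  · refine le_trans (Set.encard_le_encard ?_) (encard_biUnion_finset_le Z _)
    rintro ⟨q, n⟩ ⟨hq, hn⟩
    simp only [Set.mem_iUnion]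
    have hmem : (q, n) ∈ isolatedFiber f U (toC q) := ⟨rfl, hn⟩
    by_cases hZ : toC q ∈ Z
    · exact ⟨_, hZ, hmem⟩
    · rw [h1 q hq hZ] at hmem; exact hmem.elim
  · refine le_trans (Set.encard_le_encard ?_) (encard_biUnion_finset_le Z _)
    rintro ⟨t, n⟩ ⟨q, hq, hi, ht, hn⟩
    simp only [Set.mem_iUnion]
    have hmem : (t, n) ∈ sphericalFiber f U (toC q) := ⟨q, rfl, hi, ht, hn⟩
    by_cases hZ : toC q ∈ Z
    · exact ⟨_, hZ, hmem⟩
    · rw [h2 q hq hZ] at hmem; exact hmem.elim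

/-- In contrast to `zeroCount_le_sum`, where covering suffices, the fibres must be disjoint here: a
listed point or sphere determines its `toC`. -/
lemma sum_le_zeroCount {f : ℍ → ℍ} {U s : Set ℍ} (Z : Finset ℂ)
    (h : ∀ q, toC q ∈ Z → q ∈ s) :
    ∑ z ∈ Z, ((isolatedFiber f U z).encard + 2 * (sphericalFiber f U z).encard) ≤
      zeroCount f U s := by
  rw [Finset.sum_add_distrib, ← Finset.mul_sum, zeroCount, ← encard_biUnion_finset,
    ← encard_biUnion_finset]
  · refine add_le_add (Set.encard_le_encard ?_) (mul_le_mul_right (Set.encard_le_encard ?_) _)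
    · rintro ⟨q, n⟩ hq
      simp only [Set.mem_iUnion] at hq
      obtain ⟨z, hz, rfl, hn⟩ := hq
      exact ⟨h q hz, hn⟩
    · rintro ⟨t, n⟩ hq
      simp only [Set.mem_iUnion] at hq
      obtain ⟨z, hz, q, rfl, hi, ht, hn⟩ := hq
      exact ⟨q, h q hz, hi, ht, hn⟩
  · rintro x y ⟨t, n⟩ ⟨q, rfl, -, h1, -⟩ ⟨q', rfl, -, h2, -⟩
    have : q ∈ sphereOf q := mem_sphereOf.2 rfl
    simp only at h1 h2
    rw [← h1, h2] at this
    exact mem_sphereOf.1 this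
  · rintro x y b ⟨h1, -⟩ ⟨h2, -⟩
    exact h1.symm.trans h2

lemma zeroCount_mono {f : ℍ → ℍ} {U s t : Set ℍ} (h : s ⊆ t) :
    zeroCount f U s ≤ zeroCount f U t := by
  refine add_le_add (Set.encard_le_encard ?_) (mul_le_mul_right (Set.encard_le_encard ?_) _)
  · exact fun a ha => ⟨h ha.1, ha.2⟩
  · rintro a ⟨q, hq, ha⟩
    exact ⟨q, h hq, ha⟩

/-! ### Jensen's inequality for holomorphic functions -/

section holomorphic
variable {R : ℝ} {D : ℂ → ℂ}

lemma exists_eq_sub_pow_mul (hD : DifferentiableOn ℂ D (Metric.ball 0 R)) {w : ℂ}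
    (hw : w ∈ Metric.ball (0 : ℂ) R) {k : ℕ} (hk : (k : ℕ∞) ≤ analyticOrderAt D w) :
    ∃ G : ℂ → ℂ, DifferentiableOn ℂ G (Metric.ball 0 R) ∧ ∀ z, D z = (z - w) ^ k * G z := by
  induction k generalizing D with
  | zero => exact ⟨D, hD, by simp⟩
  | succ k ih =>
    have h0 : D w = 0 := apply_eq_zero_of_analyticOrderAt_ne_zero fun h => by
      rw [h] at hk
      exact absurd hk (by simp)
    obtain ⟨D₁, hD₁, h1⟩ := exists_eq_sub_mul hD hw h0
    have hord := analyticOrderAt_of_eq_pow_mul (D := D) (k := 1) (c := fun z => z - w)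
      (by fun_prop) (hD₁.analyticAt (Metric.isOpen_ball.mem_nhds hw))
      (Filter.Eventually.of_forall fun z => by rw [h1 z, pow_one])
    rw [analyticOrderAt_id_sub_const_self, one_smul] at hord
    have hk' : (k : ℕ∞) ≤ analyticOrderAt D₁ w := by
      rw [hord] at hk
      push_cast at hk
      rw [add_comm] at hk
      exact (ENat.add_le_add_iff_left (by simp)).1 hk
    obtain ⟨G, hG, h2⟩ := ih hD₁ hk'
    exact ⟨G, hG, fun z => by rw [h1, h2, pow_succ', mul_assoc]⟩

lemma exists_eq_prod_mul (hD : DifferentiableOn ℂ D (Metric.ball 0 R)) (T : Finset ℂ)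
    (hT : ∀ w ∈ T, w ∈ Metric.ball (0 : ℂ) R) (o : ℂ → ℕ)
    (ho : ∀ w ∈ T, (o w : ℕ∞) ≤ analyticOrderAt D w) :
    ∃ G : ℂ → ℂ, DifferentiableOn ℂ G (Metric.ball 0 R) ∧
      ∀ z, D z = (∏ w ∈ T, (z - w) ^ o w) * G z := by
  induction T using Finset.induction_on with
  | empty => exact ⟨D, hD, by simp⟩
  | insert a T ha ih =>
    obtain ⟨G, hG, h1⟩ := ih (fun w hw => hT w (by simp [hw])) (fun w hw => ho w (by simp [hw]))
    have haR := hT a (by simp)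
    have hP : AnalyticAt ℂ (fun z => ∏ w ∈ T, (z - w) ^ o w) a := by
      have : Differentiable ℂ (fun z => ∏ w ∈ T, (z - w) ^ o w) := by fun_prop
      exact this.analyticAt a
    have hord := analyticOrderAt_of_eq_pow_mul (D := D) (k := 1) hP
      (hG.analyticAt (Metric.isOpen_ball.mem_nhds haR))
      (Filter.Eventually.of_forall fun z => by rw [h1 z, pow_one])
    have hP0 : (∏ w ∈ T, (a - w) ^ o w) ≠ 0 := by
      refine Finset.prod_ne_zero_iff.2 fun w hw => pow_ne_zero _ (sub_ne_zero.2 ?_)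
      rintro rfl
      exact ha hw
    rw [hP.analyticOrderAt_eq_zero.2 hP0, smul_zero, zero_add] at hord
    obtain ⟨K, hK, h2⟩ := exists_eq_sub_pow_mul hG haR (hord ▸ ho a (by simp))
    refine ⟨K, hK, fun z => ?_⟩
    rw [h1, h2, Finset.prod_insert ha]; ring

/-- Jensen's inequality, for zeros in a closed disc. -/
theorem pow_le_of_zeros (hD : DifferentiableOn ℂ D (Metric.ball 0 R)) {r M : ℝ} (hr : 0 < r)
    (hrR : r < R) (hM : ∀ z ∈ Metric.ball (0 : ℂ) R, ‖D z‖ ≤ M) (h0 : ‖D 0‖ = 1) (T : Finset ℂ)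
    (hT : ∀ w ∈ T, ‖w‖ ≤ r) (o : ℂ → ℕ) (ho : ∀ w ∈ T, (o w : ℕ∞) ≤ analyticOrderAt D w) :
    R ^ (∑ w ∈ T, o w) ≤ M * r ^ (∑ w ∈ T, o w) := by
  set N := ∑ w ∈ T, o w with hN
  obtain ⟨G, hG, h1⟩ := exists_eq_prod_mul hD T
    (fun w hw => by simpa using (hT w hw).trans_lt hrR) o ho
  have hG0 : 1 ≤ r ^ N * ‖G 0‖ := by
    rw [← h0, h1, norm_mul, norm_prod]
    refine mul_le_mul_of_nonneg_right ?_ (norm_nonneg _)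
    rw [hN, ← Finset.prod_pow_eq_pow_sum]
    refine Finset.prod_le_prod (fun _ _ => norm_nonneg _) fun w hw => ?_
    rw [zero_sub, norm_pow, norm_neg]
    exact pow_le_pow_left₀ (norm_nonneg _) (hT w hw) _
  -- `D` is controlled only in the open disc, so the argument runs on smaller circles, and `ρ` tends
  -- to `R` at the end.
  have key : ∀ ρ ∈ Set.Ioo r R, ρ ^ N ≤ M * r ^ N := by
    rintro ρ ⟨hρ, hρR⟩
    have hρ0 : 0 < ρ := hr.trans hρ
    -- Each factor `z - w` is replaced by `(ρ² - w̄ z) / ρ`, which has the same modulus on `|z| = ρ`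
    -- and equals `ρ` at `0`. So `|H| ≤ M` on the circle and `|H 0| = ρ ^ N * |G 0|`.
    set H : ℂ → ℂ := fun z => (∏ w ∈ T, (((ρ : ℂ) ^ 2 - conj w * z) / ρ) ^ o w) * G z with hH
    have hHd : DifferentiableOn ℂ H (Metric.ball 0 R) := by
      refine DifferentiableOn.mul (Differentiable.differentiableOn ?_) hG
      fun_prop
    have hcl : DiffContOnCl ℂ H (Metric.ball 0 ρ) := by
      apply DifferentiableOn.diffContOnCl
      rw [closure_ball _ hρ0.ne']
      exact hHd.mono (Metric.closedBall_subset_ball hρR)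
    have hb := Complex.norm_le_of_forall_mem_frontier_norm_le Metric.isBounded_ball hcl (C := M)
      (fun z hz => by
        rw [frontier_ball _ hρ0.ne', mem_sphere_zero_iff_norm] at hz
        refine le_trans (le_of_eq ?_) (hM z (by simpa [hz] using hρR))
        rw [h1, hH, norm_mul, norm_mul, norm_prod, norm_prod]
        congr 1
        refine Finset.prod_congr rfl fun w _ => ?_
        rw [norm_pow, norm_pow]
        congr 1
        have hzz : (ρ : ℂ) ^ 2 = z * conj z := by
          rw [Complex.mul_conj, Complex.normSq_eq_norm_sq, hz]; push_cast; rfl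
        have : (ρ : ℂ) ^ 2 - conj w * z = z * conj (z - w) := by
          rw [hzz, map_sub]; ring
        rw [this, norm_div, norm_mul, Complex.norm_conj, hz, Complex.norm_real, Real.norm_eq_abs,
          abs_of_pos hρ0, mul_div_cancel_left₀ _ hρ0.ne'])
      (subset_closure (Metric.mem_ball_self hρ0))
    have hH0 : ‖H 0‖ = ρ ^ N * ‖G 0‖ := by
      rw [hH, norm_mul, norm_prod, hN, ← Finset.prod_pow_eq_pow_sum]
      congr 1
      refine Finset.prod_congr rfl fun w _ => ?_
      rw [mul_zero, sub_zero, sq, mul_div_assoc, div_self (by exact_mod_cast hρ0.ne'), mul_one,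
        norm_pow, Complex.norm_real, Real.norm_eq_abs, abs_of_pos hρ0]
    rw [hH0] at hb
    calc ρ ^ N ≤ ρ ^ N * (r ^ N * ‖G 0‖) := le_mul_of_one_le_right (by positivity) hG0
      _ = (ρ ^ N * ‖G 0‖) * r ^ N := by ring
      _ ≤ M * r ^ N := mul_le_mul_of_nonneg_right hb (by positivity)
  by_contra! hlt
  have h2 : ∀ᶠ ρ in nhdsWithin R (Set.Iio R), M * r ^ N < ρ ^ N :=
    (((continuous_pow N).tendsto R).eventually (lt_mem_nhds hlt)).filter_mono nhdsWithin_le_nhds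
  obtain ⟨ρ, h3, h4⟩ := (h2.and (Ioo_mem_nhdsLT hrR)).exists
  exact absurd (key ρ h4) (not_le.2 h3)

/-- With `n` distinct zeros the Jensen bound gives `(R / r) ^ n ≤ M`, which fails for large `n`. -/
lemma finite_zeros (hD : DifferentiableOn ℂ D (Metric.ball 0 R)) {r M : ℝ} (hr : 0 < r)
    (hrR : r < R) (hM : ∀ z ∈ Metric.ball (0 : ℂ) R, ‖D z‖ ≤ M) (h0 : ‖D 0‖ = 1) :
    {z : ℂ | ‖z‖ ≤ r ∧ D z = 0}.Finite := by
  by_contra hinf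
  have hgrow : ∃ n : ℕ, M < (R / r) ^ n :=
    pow_unbounded_of_one_lt M ((one_lt_div hr).2 hrR)
  obtain ⟨n, hn⟩ := hgrow
  obtain ⟨T, hT, hcard⟩ := Set.Infinite.exists_subset_card_eq hinf n
  have h1 := pow_le_of_zeros hD hr hrR hM h0 T (fun w hw => (hT hw).1) (fun _ => 1) (fun w hw => by
    have hwR : w ∈ Metric.ball (0 : ℂ) R := by simpa using (hT hw).1.trans_lt hrR
    have := (hD.analyticAt (Metric.isOpen_ball.mem_nhds hwR)).analyticOrderAt_ne_zero.2 (hT hw).2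
    rw [Nat.cast_one]
    exact Order.one_le_iff_ne_zero.2 this)
  rw [Finset.sum_const, smul_eq_mul, mul_one, hcard] at h1
  rw [div_pow, lt_div_iff₀ (by positivity)] at hn
  exact absurd h1 (not_le.2 hn)

lemma le_analyticOrderAt_conj (hD : DifferentiableOn ℂ D (Metric.ball 0 R))
    (hc : ∀ z ∈ Metric.ball (0 : ℂ) R, D (conj z) = conj (D z)) {w : ℂ}
    (hw : w ∈ Metric.ball (0 : ℂ) R) {k : ℕ} (hk : (k : ℕ∞) ≤ analyticOrderAt D w) :
    (k : ℕ∞) ≤ analyticOrderAt D (conj w) := by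
  obtain ⟨G, hG, h1⟩ := exists_eq_sub_pow_mul hD hw hk
  have hcw := conj_mem_ball.2 hw
  have hG' : DifferentiableOn ℂ (fun z => conj (G (conj z))) (Metric.ball 0 R) := by
    intro z hz
    have h1 := (hG (conj z) (conj_mem_ball.2 hz)).differentiableAt
      (Metric.isOpen_ball.mem_nhds (conj_mem_ball.2 hz))
    have h2 := h1.conj_conj
    rw [Complex.conj_conj] at h2
    exact h2.differentiableWithinAt
  have hord := analyticOrderAt_of_eq_pow_mul (D := D) (k := k) (c := fun z => z - conj w)
    (by fun_prop) (hG'.analyticAt (Metric.isOpen_ball.mem_nhds hcw)) (by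
      filter_upwards [Metric.isOpen_ball.mem_nhds hcw] with z hz
      have h2 := hc (conj z) (conj_mem_ball.2 hz)
      rw [Complex.conj_conj] at h2
      rw [h2, h1, map_mul, map_pow, map_sub, Complex.conj_conj])
  rw [hord, analyticOrderAt_id_sub_const_self]
  simp

end holomorphic

/-! ### Jensen's inequality for slice regular functions -/

lemma norm_normSq_le (X : ℍ[ℂ]) :
    ‖Quaternion.normSq X‖ ≤ ‖reH X‖ ^ 2 + ‖imH X‖ ^ 2 := by
  have h : ∀ c : ℂ, ‖c ^ 2‖ = c.re ^ 2 + c.im ^ 2 := fun c => by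
    rw [norm_pow, ← Complex.normSq_eq_norm_sq, Complex.normSq_apply]; ring
  rw [Quaternion.normSq_def', sq ‖reH X‖, sq ‖imH X‖, ← Quaternion.normSq_eq_norm_mul_self,
    ← Quaternion.normSq_eq_norm_mul_self, Quaternion.normSq_def', Quaternion.normSq_def']
  refine (norm_add_le _ _).trans ?_
  refine (add_le_add (norm_add_le _ _) le_rfl).trans ?_
  refine (add_le_add (add_le_add (norm_add_le _ _) le_rfl) le_rfl).trans ?_
  rw [h, h, h, h]
  simp only [reH_re, reH_imI, reH_imJ, reH_imK, imH_re, imH_imI, imH_imJ, imH_imK]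
  linarith

/-- For `X = a + ι b`, the parallelogram law at `I` and `-I` gives `|a|² + |b|² = (|a + I b|² + |a -
I b|²) / 2 ≤ M²`. -/
lemma norm_normSq_le_of_ev {X : ℍ[ℂ]} {M : ℝ} (h : ∀ I ∈ imagUnits, ‖ev I X‖ ≤ M) :
    ‖Quaternion.normSq X‖ ≤ M ^ 2 := by
  refine (norm_normSq_le X).trans ?_
  have hp := parallelogram_law_with_norm ℝ (reH X) (unitI * imH X)
  have h1 := h _ unitI_mem
  have h2 := h _ (imagUnits_neg unitI_mem)
  rw [ev] at h1 h2
  rw [neg_mul, ← sub_eq_add_neg] at h2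
  rw [norm_mul unitI, unitI_mem.2, one_mul] at hp
  have h1' := pow_le_pow_left₀ (norm_nonneg _) h1 2
  have h2' := pow_le_pow_left₀ (norm_nonneg _) h2 2
  nlinarith

lemma norm_le_maxModulus {g : ℍ → ℍ} {R : ℝ} (hc : ContinuousOn g (Metric.closedBall 0 R)) {q : ℍ}
    (hq : q ∈ Metric.sphere (0 : ℍ) R) : ‖g q‖ ≤ maxModulus g R := by
  refine le_csSup ?_ ⟨q, hq, rfl⟩
  exact ((isCompact_sphere (0 : ℍ) R).image_of_continuousOn
    (hc.mono Metric.sphere_subset_closedBall).norm).bddAbove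

lemma Stem.analyticOrderAt_ne_top {R : ℝ} {F : ℂ → ℍ[ℂ]} (hF : Stem R F)
    (h0 : Quaternion.normSq (F 0) ≠ 0) {z : ℂ} (hz : z ∈ Metric.ball (0 : ℂ) R) :
    analyticOrderAt (fun z => Quaternion.normSq (F z)) z ≠ ⊤ := by
  have h00 : (0 : ℂ) ∈ Metric.ball (0 : ℂ) R := Metric.mem_ball_self (Metric.pos_of_mem_ball hz)
  refine AnalyticOnNhd.analyticOrderAt_ne_top_of_isPreconnected
    (hF.holo.normSq.analyticOnNhd Metric.isOpen_ball) (convex_ball (0 : ℂ) R).isPreconnected h00 hz ?_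
  rw [(hF.analyticAt_normSq h00).analyticOrderAt_eq_zero.2 h0]
  simp

lemma Stem.normSq_zero {R : ℝ} (hR : 0 < R) {F : ℂ → ℍ[ℂ]} {f : ℍ → ℍ} (hf : IsStem R f F) :
    Quaternion.normSq (F 0) = ((‖f 0‖ ^ 2 : ℝ) : ℂ) := by
  have h00 : (0 : ℂ) ∈ Metric.ball (0 : ℂ) R := Metric.mem_ball_self hR
  have h := hf _ unitI_mem 0 h00
  have h2 := eq_ofH_of_imH_eq_zero (hf.imH_eq_zero h00 (by simp))
  rw [h2, ev_ofH, slice_zero] at h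
  rw [h2, normSq_ofH, h]

/-- Jensen's inequality for a slice regular function with values bounded by `M`. -/
theorem jensen_le_log {r : ℝ} (hr : 0 < r) {f : ℍ → ℍ} {M : ℝ}
    (hf : SliceRegularOn f (Metric.ball 0 (Real.exp 1 * r)))
    (hM : ∀ q ∈ Metric.ball (0 : ℍ) (Real.exp 1 * r), ‖f q‖ ≤ M) (h0 : ‖f 0‖ = 1) :
    ∃ n : ℕ, zeroCount f (Metric.ball 0 (Real.exp 1 * r)) (Metric.closedBall 0 r) = n ∧
      (n : ℝ) ≤ Real.log M := by
  set R := Real.exp 1 * r with hR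
  have hrR : r < R := lt_mul_of_one_lt_left hr (Real.one_lt_exp_iff.2 one_pos)
  have hR0 : 0 < R := hr.trans hrR
  obtain ⟨F, hF, hfF⟩ := hf.exists_stem
  set D : ℂ → ℂ := fun z => Quaternion.normSq (F z) with hDdef
  have hD : DifferentiableOn ℂ D (Metric.ball 0 R) := hF.holo.normSq
  have hDM : ∀ z ∈ Metric.ball (0 : ℂ) R, ‖D z‖ ≤ M ^ 2 := fun z hz =>
    norm_normSq_le_of_ev fun I hI => by
      rw [← hfF I hI z hz]
      exact hM _ ((slice_mem_ball hI).2 hz)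
  have hD0 : D 0 = 1 := by rw [hDdef]; simp only [Stem.normSq_zero hR0 hfF, h0]; norm_num
  have hDn : ‖D 0‖ = 1 := by rw [hD0, norm_one]
  have hDc : ∀ z ∈ Metric.ball (0 : ℂ) R, D (conj z) = conj (D z) := fun z hz => by
    simp only [hDdef, hF.symm z hz, normSq_conjC]
  set o : ℂ → ℕ := fun z => analyticOrderNatAt D z with ho
  have hord : ∀ z ∈ Metric.ball (0 : ℂ) R, analyticOrderAt D z = o z := fun z hz =>
    (Nat.cast_analyticOrderNatAt (hF.analyticOrderAt_ne_top
      (by change D 0 ≠ 0; rw [hD0]; exact one_ne_zero) hz)).symm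
  have hoc : ∀ z ∈ Metric.ball (0 : ℂ) R, o (conj z) = o z := by
    have hle : ∀ z ∈ Metric.ball (0 : ℂ) R, o z ≤ o (conj z) := fun z hz => by
      have := le_analyticOrderAt_conj hD hDc hz (hord z hz).ge
      rw [hord _ (conj_mem_ball.2 hz)] at this
      exact_mod_cast this
    intro z hz
    refine le_antisymm ?_ (hle z hz)
    have := hle _ (conj_mem_ball.2 hz)
    rwa [Complex.conj_conj] at this
  have hfin := finite_zeros hD hr hrR hDM hDn
  set Z := hfin.toFinset with hZ
  have hmemZ : ∀ z, z ∈ Z ↔ ‖z‖ ≤ r ∧ D z = 0 := fun z => by simp [hZ]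
  have hZR : ∀ z ∈ Z, z ∈ Metric.ball (0 : ℂ) R := fun z hz => by
    simpa using ((hmemZ z).1 hz).1.trans_lt hrR
  set Zp := Z.filter (fun z => 0 ≤ z.im) with hZp
  -- The hypotheses on `z` stand inside the existential so that `choose` yields a function on all of
  -- `ℂ`.
  have hc : ∀ z : ℂ, ∃ c : ℕ, z ∈ Metric.ball (0 : ℂ) R → 0 ≤ z.im →
      (isolatedFiber f (Metric.ball 0 R) z).encard +
      2 * (sphericalFiber f (Metric.ball 0 R) z).encard = c ∧
      o z = (if z.im = 0 then 2 else 1) * c := by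
    intro z
    by_cases h : z ∈ Metric.ball (0 : ℂ) R ∧ 0 ≤ z.im
    · obtain ⟨c, h1⟩ := encard_fibers hF hfF h.1 h.2 (hord z h.1)
      exact ⟨c, fun _ _ => h1⟩
    · exact ⟨0, fun h1 h2 => absurd ⟨h1, h2⟩ h⟩
  choose c hc using hc
  have hempty : ∀ q ∈ Metric.closedBall (0 : ℍ) r, toC q ∉ Zp →
      isolatedFiber f (Metric.ball 0 R) (toC q) = ∅ ∧
      sphericalFiber f (Metric.ball 0 R) (toC q) = ∅ := by
    intro q hq hqZ
    have hqr : ‖toC q‖ ≤ r := by simpa using hq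
    have hqR : toC q ∈ Metric.ball (0 : ℂ) R := by
      rw [mem_ball_zero_iff]; exact hqr.trans_lt hrR
    have hDq : D (toC q) ≠ 0 := fun h => hqZ (by
      rw [hZp, Finset.mem_filter, hmemZ]
      exact ⟨⟨hqr, h⟩, toC_im_nonneg q⟩)
    obtain ⟨h1, h2⟩ := hc (toC q) hqR (toC_im_nonneg q)
    have h3 : o (toC q) = 0 := by
      have := (hF.analyticAt_normSq hqR).analyticOrderAt_eq_zero.2 hDq
      have h4 := hord _ hqR
      rw [hDdef, this] at h4
      exact_mod_cast h4.symm
    have h4 : c (toC q) = 0 := by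
      rw [h3] at h2
      rcases mul_eq_zero.1 h2.symm with h | h
      · split_ifs at h
      · exact h
    rw [h4, Nat.cast_zero, add_eq_zero] at h1
    refine ⟨Set.encard_eq_zero.1 h1.1, Set.encard_eq_zero.1 ?_⟩
    exact (mul_eq_zero.1 h1.2).resolve_left (by norm_num)
  have hle := zeroCount_le_sum (U := Metric.ball 0 R) Zp (fun q hq h => (hempty q hq h).1)
    (fun q hq h => (hempty q hq h).2)
  have hsum : ∑ z ∈ Zp, ((isolatedFiber f (Metric.ball 0 R) z).encard +
      2 * (sphericalFiber f (Metric.ball 0 R) z).encard) = ((∑ z ∈ Zp, c z : ℕ) : ℕ∞) := by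
    push_cast
    refine Finset.sum_congr rfl fun z hz => ?_
    rw [hZp, Finset.mem_filter] at hz
    exact (hc z (hZR z hz.1) hz.2).1
  rw [hsum] at hle
  obtain ⟨n, hn, hnle⟩ := ENat.le_natCast_iff.1 hle
  refine ⟨n, hn, ?_⟩
  -- Zeros in the lower half plane mirror the nonreal ones in the upper half plane with equal
  -- orders, and real zeros already carry the factor two.
  have htotal : 2 * ∑ z ∈ Zp, c z = ∑ z ∈ Z, o z := by
    rw [← Finset.sum_filter_add_sum_filter_not Z (fun z : ℂ => 0 ≤ z.im), ← hZp]
    have e1 : ∑ z ∈ Z.filter (fun z : ℂ => ¬ 0 ≤ z.im), o z =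
        ∑ z ∈ Zp.filter (fun z : ℂ => z.im ≠ 0), o z := by
      refine Finset.sum_nbij' (fun z => conj z) (fun z => conj z) ?_ ?_ ?_ ?_ ?_
      · intro z hz
        simp only [hZp, Finset.mem_filter, hmemZ, not_le] at hz ⊢
        obtain ⟨⟨h1, h2⟩, h3⟩ := hz
        have hzR : z ∈ Metric.ball (0 : ℂ) R := by simpa using h1.trans_lt hrR
        refine ⟨⟨⟨by simpa using h1, by rw [hDc z hzR, h2, map_zero]⟩, ?_⟩, ?_⟩
        · rw [Complex.conj_im]; linarith
        · rw [Complex.conj_im]; intro h; linarith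
      · intro z hz
        simp only [hZp, Finset.mem_filter, hmemZ, not_le] at hz ⊢
        obtain ⟨⟨⟨h1, h2⟩, h3⟩, h4⟩ := hz
        have hzR : z ∈ Metric.ball (0 : ℂ) R := by simpa using h1.trans_lt hrR
        refine ⟨⟨by simpa using h1, by rw [hDc z hzR, h2, map_zero]⟩, ?_⟩
        rw [Complex.conj_im]
        have := lt_of_le_of_ne h3 (Ne.symm h4)
        linarith
      · intro z _; exact Complex.conj_conj z
      · intro z _; exact Complex.conj_conj z
      · intro z hz
        exact (hoc z (hZR z (Finset.mem_filter.1 hz).1)).symm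
    rw [e1, Finset.sum_filter (s := Zp), ← Finset.sum_add_distrib, Finset.mul_sum]
    refine Finset.sum_congr rfl fun z hz => ?_
    rw [hZp, Finset.mem_filter] at hz
    have := (hc z (hZR z hz.1) hz.2).2
    by_cases h : z.im = 0
    · rw [if_pos h] at this
      rw [if_neg (by simpa using h), this]; ring
    · rw [if_neg h] at this
      rw [if_pos h, this]; ring
  have hJ := pow_le_of_zeros hD hr hrR hDM hDn Z (fun w hw => ((hmemZ w).1 hw).1) o
    (fun w hw => (hord w (hZR w hw)).ge)
  rw [← htotal, hR, mul_pow] at hJ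
  -- With `R = e r` the powers of `r` cancel; the total order `2 ∑ c` then matches the square on
  -- `M`.
  have hJ2 : Real.exp 1 ^ (2 * ∑ z ∈ Zp, c z) ≤ M ^ 2 := le_of_mul_le_mul_right hJ (by positivity)
  rw [← Real.exp_nat_mul, mul_one] at hJ2
  have hlog := (Real.le_log_iff_exp_le (by
    exact lt_of_lt_of_le (Real.exp_pos _) hJ2)).2 hJ2
  rw [Real.log_pow] at hlog
  push_cast at hlog
  have hn' : (n : ℝ) ≤ ((∑ z ∈ Zp, c z : ℕ) : ℝ) := by exact_mod_cast hnle
  push_cast at hn'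
  linarith

lemma IsJensenFactorization.norm_le {R : ℝ} {f g h : ℍ → ℍ} (hfgh : IsJensenFactorization R f g h)
    {q : ℍ} (hq : q ∈ Metric.ball (0 : ℍ) R) :
    ‖f q‖ ≤ maxModulus g R * maxModulus h R := by
  rw [hfgh.eq_mul q hq, norm_mul]
  have h1 := hfgh.regular_g.norm_le_of_sphere hfgh.continuousOn_g
    (fun q hq => norm_le_maxModulus hfgh.continuousOn_g hq) hq
  have h2 := hfgh.regular_h.norm_le_of_sphere hfgh.continuousOn_h
    (fun q hq => norm_le_maxModulus hfgh.continuousOn_h hq) hq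
  exact mul_le_mul h1 h2 (norm_nonneg _) ((norm_nonneg _).trans h1)

/-- The Jensen inequality for slice regular functions. -/
theorem jensen_inequality {r : ℝ} (hr : 0 < r) {f g h : ℍ → ℍ}
    (hfgh : IsJensenFactorization (Real.exp 1 * r) f g h) :
    ∃ n : ℕ, zeroCount f (Metric.ball 0 (Real.exp 1 * r)) (Metric.closedBall 0 r) = n ∧
      (n : ℝ) ≤ Real.log (maxModulus g (Real.exp 1 * r) * maxModulus h (Real.exp 1 * r)) := by
  refine jensen_le_log hr hfgh.regular_f (fun q hq => hfgh.norm_le hq) ?_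
  rw [hfgh.eq_mul 0 (Metric.mem_ball_self (by positivity)), norm_mul, hfgh.norm_g_zero,
    hfgh.norm_h_zero, mul_one]

/-! ### Blaschke factors of a disc -/

/-- The denominator of the Blaschke factors with zeros `w` and its conjugate. -/
def den (R : ℝ) (w z : ℂ) : ℂ := ((R : ℂ) ^ 2 - w * z) * ((R : ℂ) ^ 2 - conj w * z)

/-- The product of the Blaschke factors of the disc of radius `R` with zeros `w` and its
conjugate. -/
def sphBlaschke (R : ℝ) (w z : ℂ) : ℂ := (R : ℂ) ^ 2 * quad w z / den R w z

section disc
variable {R r R' : ℝ} {w z : ℂ}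

/-- The zeros of the denominator have modulus `R ^ 2 / r = R'`, so the Blaschke factors are regular
on the larger ball of radius `R'`. -/
lemma den_ne_zero (hr : 0 < r) (hRR : R' * r = R ^ 2) (hw : ‖w‖ = r)
    (hz : z ∈ Metric.ball (0 : ℂ) R') : den R w z ≠ 0 := by
  have hz' : ‖z‖ < R' := by simpa using hz
  have key : ∀ v : ℂ, ‖v‖ = r → (R : ℂ) ^ 2 - v * z ≠ 0 := by
    intro v hv h
    have h1 := congrArg norm (sub_eq_zero.1 h)
    rw [norm_mul, hv, norm_pow, Complex.norm_real, Real.norm_eq_abs, sq_abs, ← hRR] at h1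
    nlinarith
  exact mul_ne_zero (key w hw) (key _ (by rw [Complex.norm_conj, hw]))

lemma den_conj : den R w (conj z) = conj (den R w z) := by
  simp only [den, map_mul, map_sub, map_pow, Complex.conj_ofReal, Complex.conj_conj]; ring

lemma differentiable_den (R : ℝ) (w : ℂ) : Differentiable ℂ (den R w) := by
  unfold den; fun_prop

lemma sphBlaschke_conj : sphBlaschke R w (conj z) = conj (sphBlaschke R w z) := by
  simp only [sphBlaschke, quad_conj, den_conj, map_mul, map_div₀, map_pow, Complex.conj_ofReal]

lemma differentiableOn_sphBlaschke (hr : 0 < r) (hRR : R' * r = R ^ 2) (hw : ‖w‖ = r) :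
    DifferentiableOn ℂ (sphBlaschke R w) (Metric.ball 0 R') :=
  ((differentiable_quad w).const_mul _).differentiableOn.div
    (differentiable_den R w).differentiableOn fun _ hz => den_ne_zero hr hRR hw hz

/-- On `|z| = R` one has `R² = z z̄`, and the denominator equals `z² conj (quad w z)`. -/
lemma norm_den_of_sphere (hz : ‖z‖ = R) : ‖den R w z‖ = R ^ 2 * ‖quad w z‖ := by
  have hzz : (R : ℂ) ^ 2 = z * conj z := by
    rw [Complex.mul_conj, Complex.normSq_eq_norm_sq, hz]; push_cast; rfl
  have : den R w z = z ^ 2 * conj (quad w z) := by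
    simp only [den, quad, hzz, map_mul, map_sub, Complex.conj_conj]; ring
  rw [this, norm_mul, norm_pow, hz, Complex.norm_conj]

lemma norm_sphBlaschke (hr : 0 < r) (hRR : R' * r = R ^ 2) (hw : ‖w‖ = r)
    (hz' : z ∈ Metric.ball (0 : ℂ) R') (hz : ‖z‖ = R) : ‖sphBlaschke R w z‖ = 1 := by
  have hd := den_ne_zero hr hRR hw hz'
  rw [sphBlaschke, norm_div, norm_mul, norm_pow, Complex.norm_real, Real.norm_eq_abs, sq_abs,
    ← norm_den_of_sphere hz, div_self (by simpa using hd)]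

lemma sphBlaschke_zero (hR : 0 < R) : sphBlaschke R w 0 = ((‖w‖ ^ 2 / R ^ 2 : ℝ) : ℂ) := by
  have h1 : w * conj w = ((‖w‖ ^ 2 : ℝ) : ℂ) := by
    rw [Complex.mul_conj, Complex.normSq_eq_norm_sq]
  have hR' : (R : ℂ) ≠ 0 := by exact_mod_cast hR.ne'
  have h2 : quad w 0 = w * conj w := by simp [quad]
  have h3 : den R w 0 = (R : ℂ) ^ 2 * (R : ℂ) ^ 2 := by simp [den]
  rw [sphBlaschke, h2, h3, h1]
  push_cast
  field_simp

lemma quad_eq_zero : quad w z = 0 ↔ z = w ∨ z = conj w := by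
  rw [quad, mul_eq_zero, sub_eq_zero, sub_eq_zero]

lemma analyticOrderAt_quad (w : ℂ) :
    analyticOrderAt (quad w) w = (if w.im = 0 then 2 else 1 : ℕ) := by
  split_ifs with h
  · have h1 : quad w = (· - w) * (· - w) := by
      funext z
      rw [quad, Complex.conj_eq_iff_im.2 h]; rfl
    rw [h1, analyticOrderAt_mul (by fun_prop) (by fun_prop), analyticOrderAt_id_sub_const_self]
    norm_num
  · rw [analyticOrderAt_quad_self h]; simp

end disc

/-! ### Stem functions of the quaternionic Blaschke factors -/

/-- The stem function of `R² - q ā`. -/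
def blaschkeDen (R : ℝ) (a : ℍ) (z : ℂ) : ℍ[ℂ] :=
  ofH ((R ^ 2 : ℝ) : ℍ) - (z : ℍ[ℂ]) * ofH (star a)

/-- The stem function of the Blaschke factor. -/
def blaschkeStem (R : ℝ) (a : ℍ) (z : ℂ) : ℍ[ℂ] :=
  (Quaternion.normSq (blaschkeDen R a z))⁻¹ • star (blaschkeDen R a z) *
    (lin a z * ofH (R : ℍ))

lemma isStem_blaschkeFactor (R' R : ℝ) (a : ℍ) :
    IsStem R' (blaschkeFactor R a) (blaschkeStem R a) :=
  IsStem.starMul (((IsStem.const _).sub (IsStem.id.mul_const (star a))).starInv)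
    ((isStem_lin R' a).mul_const (R : ℍ))

lemma normSq_blaschkeDen (R : ℝ) (a : ℍ) (z : ℂ) :
    Quaternion.normSq (blaschkeDen R a z) = den R (toC a) z := by
  have h : ‖a.im‖ ^ 2 = a.imI ^ 2 + a.imJ ^ 2 + a.imK ^ 2 := by
    rw [sq, ← Quaternion.normSq_eq_norm_mul_self, Quaternion.normSq_def']; simp
  have h' : ((‖a.im‖ : ℝ) : ℂ) ^ 2 = (a.imI : ℂ) ^ 2 + (a.imJ : ℂ) ^ 2 + (a.imK : ℂ) ^ 2 := by
    exact_mod_cast h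
  have h1 : toC a + conj (toC a) = 2 * (a.re : ℂ) := by
    apply Complex.ext <;> simp; ring
  have h2 : toC a * conj (toC a) = (a.re : ℂ) ^ 2 + ((‖a.im‖ : ℝ) : ℂ) ^ 2 := by
    rw [Complex.mul_conj, Complex.normSq_apply]; push_cast; simp only [toC_re, toC_im]; ring
  rw [h'] at h2
  rw [Quaternion.normSq_def']
  simp only [blaschkeDen, den, ofH_coe, Quaternion.re_sub, Quaternion.imI_sub, Quaternion.imJ_sub,
    Quaternion.imK_sub, Quaternion.re_coe, Quaternion.imI_coe, Quaternion.imJ_coe,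
    Quaternion.imK_coe, Quaternion.coe_mul_eq_smul, Quaternion.re_smul, Quaternion.imI_smul,
    Quaternion.imJ_smul, Quaternion.imK_smul, ofH_re, ofH_imI, ofH_imJ, ofH_imK,
    Quaternion.re_star, Quaternion.imI_star, Quaternion.imJ_star, Quaternion.imK_star, smul_eq_mul]
  push_cast
  linear_combination (R : ℂ) ^ 2 * z * h1 - z ^ 2 * h2

lemma norm_toC_eq {a : ℍ} {r : ℝ} (ha : ‖a‖ = r) : ‖toC a‖ = r := by rw [norm_toC, ha]

section blaschke
variable {R r R' : ℝ} {a : ℍ}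

lemma stem_blaschkeStem (hr : 0 < r) (hRR : R' * r = R ^ 2) (ha : ‖a‖ = r) :
    Stem R' (blaschkeStem R a) := by
  refine ⟨?_, fun z hz => (isStem_blaschkeFactor R' R a).apply_conj hz⟩
  have h1 : Holo (blaschkeDen R a) (Metric.ball 0 R') :=
    (Holo.const _).sub ((Holo.coe differentiableOn_id).mul (Holo.const _))
  refine Holo.mul (Holo.smul ?_ h1.star) ((Stem.lin R' a).holo.mul (Holo.const _))
  refine h1.normSq.inv fun z hz => ?_
  rw [normSq_blaschkeDen]
  exact den_ne_zero hr hRR (norm_toC_eq ha) hz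

lemma normSq_blaschkeStem (hr : 0 < r) (hRR : R' * r = R ^ 2) (ha : ‖a‖ = r) {z : ℂ}
    (hz : z ∈ Metric.ball (0 : ℂ) R') :
    Quaternion.normSq (blaschkeStem R a z) = sphBlaschke R (toC a) z := by
  have hd := den_ne_zero hr hRR (norm_toC_eq ha) hz
  rw [blaschkeStem, map_mul, map_mul, Quaternion.normSq_smul, Quaternion.normSq_star,
    normSq_blaschkeDen, normSq_lin, normSq_ofH, Quaternion.norm_coe, Real.norm_eq_abs, sq_abs,
    sphBlaschke]
  push_cast
  field_simp

lemma lin_comm (a : ℍ) (z z' : ℂ) : lin a z * lin a z' = lin a z' * lin a z := by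
  have h1 := Quaternion.coe_commutes z (ofH a)
  have h2 := Quaternion.coe_commutes z' (ofH a)
  have h3 := Quaternion.coe_commutes z (z' : ℍ[ℂ])
  simp only [lin, sub_mul, mul_sub]
  rw [h1, h2, h3]
  abel

/-- On `|z| = R` the conjugate denominator is `R² - z a = z (z̄ - a)`, and `(z̄ - a)(z - a)` is
fixed by conjugation because its factors commute. Hence the stem is a complex scalar times a
quaternionic constant, whose evaluation has the same norm at every `I`. -/
lemma norm_ev_blaschkeStem (hr : 0 < r) (hR : 0 < R) (hRR : R' * r = R ^ 2) (ha : ‖a‖ = r) {z : ℂ}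
    (hz' : z ∈ Metric.ball (0 : ℂ) R') (hz : ‖z‖ = R) {I : ℍ} (hI : I ∈ imagUnits) :
    ‖ev I (blaschkeStem R a z)‖ = 1 := by
  have hd := den_ne_zero hr hRR (norm_toC_eq ha) hz'
  have hzz : ((R ^ 2 : ℝ) : ℂ) = z * conj z := by
    rw [Complex.mul_conj, Complex.normSq_eq_norm_sq, hz]
  have h1 : star (blaschkeDen R a z) = z • lin a (conj z) := by
    rw [blaschkeDen, ofH_coe, hzz, ← Quaternion.coe_mul_eq_smul, lin, mul_sub, ← Quaternion.coe_mul]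
    apply Quaternion.ext <;> simp [Quaternion.coe_mul_eq_smul]
  set X := lin a (conj z) * lin a z with hX
  have hXr : X = ofH (reH X) := by
    apply eq_ofH_of_imH_eq_zero
    apply imH_eq_zero_of_conjC
    rw [hX, conjC_mul, conjC_lin, conjC_lin, Complex.conj_conj, lin_comm]
  have hn : ‖reH X‖ ^ 2 = ‖quad (toC a) z‖ ^ 2 := by
    have h2 : ((‖reH X‖ ^ 2 : ℝ) : ℂ) = ((‖quad (toC a) z‖ ^ 2 : ℝ) : ℂ) := by
      rw [← normSq_ofH, ← hXr, hX, map_mul, normSq_lin, normSq_lin, quad_conj, mul_comm,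
        Complex.mul_conj, Complex.normSq_eq_norm_sq]
    exact_mod_cast h2
  have hn' : ‖reH X‖ = ‖quad (toC a) z‖ := (sq_eq_sq₀ (norm_nonneg _) (norm_nonneg _)).1 hn
  have h3 : blaschkeStem R a z = ((den R (toC a) z)⁻¹ * z) • (ofH (reH X) * ofH (R : ℍ)) := by
    rw [blaschkeStem, normSq_blaschkeDen, h1, ← hXr, hX, smul_smul, smul_mul_HC, mul_assoc]
  rw [h3, ev_smul hI, ev_mul_ofH, ev_ofH, norm_mul, norm_mul, norm_slice hI, norm_mul, norm_inv,
    hz, hn', Quaternion.norm_coe, Real.norm_eq_abs, abs_of_pos hR]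
  have hd2 := norm_den_of_sphere (w := toC a) hz
  have hd3 : ‖den R (toC a) z‖ ≠ 0 := by simpa using hd
  field_simp
  rw [hd2]

end blaschke

/-- This is `(f ⋆ g)(q) = f(q) g(f(q)⁻¹ q f(q))`: conjugation by `f(q)` moves `I` to another
imaginary unit, so moduli constant on a sphere multiply. -/
lemma norm_ev_mul {X Y : ℍ[ℂ]} {x y : ℝ} (hx : 0 < x) (hX : ∀ I ∈ imagUnits, ‖ev I X‖ = x)
    (hY : ∀ I ∈ imagUnits, ‖ev I Y‖ = y) {I : ℍ} (hI : I ∈ imagUnits) :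
    ‖ev I (X * Y)‖ = x * y := by
  set f := ev I X with hf
  have hfx : ‖f‖ = x := hX I hI
  have hf0 : f ≠ 0 := by
    rw [← norm_ne_zero_iff, hfx]; exact hx.ne'
  have hJ : f⁻¹ * I * f ∈ imagUnits := by
    constructor
    · have hcomm : ∀ p q : ℍ, (p * q).re = (q * p).re := fun p q => by
        simp only [Quaternion.re_mul]; ring
      rw [mul_assoc, hcomm, mul_assoc, mul_inv_cancel₀ hf0, mul_one, hI.1]
    · rw [norm_mul, norm_mul, norm_inv, hI.2, mul_one, inv_mul_cancel₀ (by simpa using hf0)]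
  have h1 : ev I (X * Y) = f * ev (f⁻¹ * I * f) Y := by
    rw [ev_mul hI, ← hf, ev, mul_add]
    congr 1
    rw [← mul_assoc, ← mul_assoc, ← mul_assoc, mul_inv_cancel₀ hf0, one_mul]
  rw [h1, norm_mul, hfx, hY _ hJ]

/-! ### The extremal functions -/

/-- The stem function of the Blaschke product. -/
def blaschkeProductStem (R : ℝ) {n : ℕ} (u : ℍ) (a : Fin n → ℍ) (z : ℂ) : ℍ[ℂ] :=
  ofH (Real.exp n • u) * (((List.finRange n).map fun k => blaschkeStem R (a k) z).prod * ofH 1)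

lemma isStem_blaschkeProduct (R' R : ℝ) {n : ℕ} (u : ℍ) (a : Fin n → ℍ) :
    IsStem R' (blaschkeProduct R u a) (blaschkeProductStem R u a) := by
  rw [blaschkeProduct, List.ofFn_eq_map]
  exact (IsStem.const _).starMul
    (IsStem.foldr _ (fun k _ => isStem_blaschkeFactor R' R (a k)) (IsStem.const 1))

lemma norm_exp_smul {u : ℍ} (hu : ‖u‖ = 1) (x : ℝ) : ‖Real.exp x • u‖ = Real.exp x := by
  rw [norm_smul, hu, mul_one, Real.norm_eq_abs, Real.abs_exp]

section product
variable {R r R' : ℝ} {n : ℕ} {u : ℍ} {a : Fin n → ℍ}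

lemma stem_blaschkeProductStem (hr : 0 < r) (hRR : R' * r = R ^ 2) (ha : ∀ k, ‖a k‖ = r) :
    Stem R' (blaschkeProductStem R u a) :=
  (Stem.const R' _).mul ((Stem.list_prod _ fun k _ => stem_blaschkeStem hr hRR (ha k)).mul
    (Stem.const R' 1))

lemma normSq_blaschkeProductStem (hr : 0 < r) (hRR : R' * r = R ^ 2) (ha : ∀ k, ‖a k‖ = r)
    (hu : ‖u‖ = 1) {z : ℂ} (hz : z ∈ Metric.ball (0 : ℂ) R') :
    Quaternion.normSq (blaschkeProductStem R u a z) =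
      ((Real.exp n ^ 2 : ℝ) : ℂ) * ∏ k, sphBlaschke R (toC (a k)) z := by
  rw [blaschkeProductStem, map_mul, map_mul, normSq_ofH, norm_exp_smul hu, ofH_one, map_one,
    mul_one, Fin.prod_univ_def]
  congr 1
  induction (List.finRange n) with
  | nil => simp
  | cons k l ih =>
    rw [List.map_cons, List.prod_cons, List.map_cons, List.prod_cons, map_mul, ih,
      normSq_blaschkeStem hr hRR (ha k) hz]

lemma norm_ev_blaschkeProductStem (hr : 0 < r) (hR : 0 < R) (hRR : R' * r = R ^ 2)
    (ha : ∀ k, ‖a k‖ = r) (hu : ‖u‖ = 1) {z : ℂ} (hz' : z ∈ Metric.ball (0 : ℂ) R') (hz : ‖z‖ = R)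
    {I : ℍ} (hI : I ∈ imagUnits) : ‖ev I (blaschkeProductStem R u a z)‖ = Real.exp n := by
  have h1 : ∀ l : List (Fin n), ∀ I ∈ imagUnits,
      ‖ev I ((l.map fun k => blaschkeStem R (a k) z).prod * ofH 1)‖ = 1 := by
    intro l
    induction l with
    | nil => intro I _; rw [List.map_nil, List.prod_nil, one_mul, ev_ofH, norm_one]
    | cons k l ih =>
      intro I hI
      rw [List.map_cons, List.prod_cons, mul_assoc, norm_ev_mul one_pos (fun I hI =>
        norm_ev_blaschkeStem hr hR hRR (ha k) hz' hz hI) ih hI, one_mul]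
  rw [blaschkeProductStem, norm_ev_mul (Real.exp_pos n) (fun I _ => by
    rw [ev_ofH, norm_exp_smul hu]) (h1 _) hI, mul_one]

end product

lemma IsStem.ext {R : ℝ} {f g : ℍ → ℍ} {F G : ℂ → ℍ[ℂ]} (hf : IsStem R f F) (hg : IsStem R g G)
    (h : ∀ z ∈ Metric.ball (0 : ℂ) R, F z = G z) {q : ℍ} (hq : q ∈ Metric.ball (0 : ℍ) R) :
    f q = g q := by
  obtain ⟨I, hI, hs⟩ := exists_slice_eq q
  rw [hf.apply_eq hq hI hs, hg.apply_eq hq hI hs, h _ (toC_mem_ball.2 hq)]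

lemma maxModulus_eq {R c : ℝ} (hR : 0 ≤ R) {g : ℍ → ℍ}
    (h : ∀ q ∈ Metric.sphere (0 : ℍ) R, ‖g q‖ = c) : maxModulus g R = c := by
  have hs : ((R : ℝ) : ℍ) ∈ Metric.sphere (0 : ℍ) R := by simp [abs_of_nonneg hR]
  have : (fun q => ‖g q‖) '' Metric.sphere (0 : ℍ) R = {c} := by
    ext y
    constructor
    · rintro ⟨q, hq, rfl⟩; exact h q hq
    · rintro rfl; exact ⟨_, hs, h _ hs⟩
  rw [maxModulus, this, csSup_singleton]

/-! ### Products of Blaschke factors of a disc -/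

/-- The finite Blaschke product of the disc of radius `R` whose zeros are the points of a list and
their conjugates. -/
def sphProd (R : ℝ) (l : List ℂ) (z : ℂ) : ℂ := (l.map fun w => sphBlaschke R w z).prod

section sphProd
variable {R r R' : ℝ} {l : List ℂ} {z : ℂ}

lemma sphProd_conj : sphProd R l (conj z) = conj (sphProd R l z) := by
  induction l with
  | nil => simp [sphProd]
  | cons w l ih =>
    simp only [sphProd] at ih
    rw [sphProd, sphProd, List.map_cons, List.prod_cons, List.map_cons, List.prod_cons, ih,
      sphBlaschke_conj, map_mul]

lemma differentiableOn_sphProd (hr : 0 < r) (hRR : R' * r = R ^ 2) (hl : ∀ w ∈ l, ‖w‖ = r) :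
    DifferentiableOn ℂ (sphProd R l) (Metric.ball 0 R') := by
  induction l with
  | nil => exact (differentiableOn_const 1).congr fun z _ => by simp [sphProd]
  | cons w l ih =>
    have h1 : sphProd R (w :: l) = fun z => sphBlaschke R w z * sphProd R l z := by
      funext z
      rw [sphProd, List.map_cons, List.prod_cons, sphProd]
    rw [h1]
    exact (differentiableOn_sphBlaschke hr hRR (hl w (by simp))).mul
      (ih fun v hv => hl v (by simp [hv]))

lemma norm_sphProd (hr : 0 < r) (hRR : R' * r = R ^ 2) (hl : ∀ w ∈ l, ‖w‖ = r)
    (hz' : z ∈ Metric.ball (0 : ℂ) R') (hz : ‖z‖ = R) : ‖sphProd R l z‖ = 1 := by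
  induction l with
  | nil => simp [sphProd]
  | cons w l ih =>
    have ih := ih fun v hv => hl v (by simp [hv])
    rw [sphProd] at ih ⊢
    rw [List.map_cons, List.prod_cons, norm_mul, ih,
      norm_sphBlaschke hr hRR (hl w (by simp)) hz' hz, one_mul]

lemma sphProd_zero (hR : 0 < R) (hl : ∀ w ∈ l, ‖w‖ = r) :
    sphProd R l 0 = (((r ^ 2 / R ^ 2) ^ l.length : ℝ) : ℂ) := by
  induction l with
  | nil => simp [sphProd]
  | cons w l ih =>
    have ih := ih fun v hv => hl v (by simp [hv])
    rw [sphProd] at ih ⊢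
    rw [List.map_cons, List.prod_cons, ih, sphBlaschke_zero hR, hl w (by simp), List.length_cons,
      pow_succ' _ l.length, Complex.ofReal_mul]

end sphProd

/-! ### Removing the spherical zeros of the extremal functions -/

section extremal
variable {r R R' : ℝ} {n : ℕ} {u : ℍ} {a : Fin n → ℍ}

lemma sq_div_sq_eq (hr : 0 < r) (hR : R = Real.exp 1 * r) : r ^ 2 / R ^ 2 = Real.exp (-2) := by
  rw [hR, mul_pow, ← Real.exp_nat_mul, Real.exp_neg]
  push_cast
  field_simp

lemma lt_of_mul_eq_sq (hr : 0 < r) (hR : R = Real.exp 1 * r) (hRR : R' * r = R ^ 2) :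
    r < R ∧ R < R' := by
  have h1 : r < R := hR ▸ lt_mul_of_one_lt_left hr (Real.one_lt_exp_iff.2 one_pos)
  refine ⟨h1, ?_⟩
  have h2 : R * r < R' * r := by rw [hRR, sq]; exact mul_lt_mul_of_pos_left h1 (hr.trans h1)
  exact lt_of_mul_lt_mul_right h2 hr.le

lemma normSq_blaschkeProductStem_zero (hr : 0 < r) (hR : R = Real.exp 1 * r)
    (hRR : R' * r = R ^ 2) (ha : ∀ k, ‖a k‖ = r) (hu : ‖u‖ = 1) :
    Quaternion.normSq (blaschkeProductStem R u a 0) = 1 := by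
  obtain ⟨h1, h2⟩ := lt_of_mul_eq_sq hr hR hRR
  have hR0 := hr.trans h1
  rw [normSq_blaschkeProductStem hr hRR ha hu (Metric.mem_ball_self (hR0.trans h2))]
  have : ∀ k, sphBlaschke R (toC (a k)) 0 = ((Real.exp (-2) : ℝ) : ℂ) := fun k => by
    rw [sphBlaschke_zero hR0, norm_toC, ha k, sq_div_sq_eq hr hR]
  rw [Finset.prod_congr rfl fun k _ => this k, Finset.prod_const, Finset.card_univ,
    Fintype.card_fin, ← Complex.ofReal_pow, ← Complex.ofReal_mul, ← Real.exp_nat_mul,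
    ← Real.exp_nat_mul, ← Real.exp_add]
  have : ((2 : ℕ) : ℝ) * n + n * -2 = 0 := by push_cast; ring
  rw [this, Real.exp_zero, Complex.ofReal_one]

lemma norm_normSq_blaschkeProductStem (hr : 0 < r) (hRR : R' * r = R ^ 2)
    (ha : ∀ k, ‖a k‖ = r) (hu : ‖u‖ = 1) {z : ℂ} (hz' : z ∈ Metric.ball (0 : ℂ) R')
    (hz : ‖z‖ = R) :
    ‖Quaternion.normSq (blaschkeProductStem R u a z)‖ = Real.exp n ^ 2 := by
  rw [normSq_blaschkeProductStem hr hRR ha hu hz', norm_mul, norm_prod,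
    Finset.prod_congr rfl fun k _ => norm_sphBlaschke hr hRR (norm_toC_eq (ha k)) hz' hz,
    Finset.prod_const_one, mul_one, Complex.norm_real, Real.norm_eq_abs,
    abs_of_pos (by positivity)]

/-- The scalar Blaschke factors have modulus one on the boundary and value `e^(-2)` at `0`. By the
maximum principle `normSq H` is bounded by `e^(2n)`, yet at `0` it has modulus `e^(4 l.length)`.
Only boundedness of the length matters later. -/
lemma length_le_of_factorization (hr : 0 < r) (hR : R = Real.exp 1 * r) (hRR : R' * r = R ^ 2)
    (ha : ∀ k, ‖a k‖ = r) (hu : ‖u‖ = 1) {l : List ℂ} (hl : ∀ w ∈ l, ‖w‖ = r) {H : ℂ → ℍ[ℂ]}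
    (hH : Stem R' H)
    (h : ∀ z ∈ Metric.ball (0 : ℂ) R', blaschkeProductStem R u a z = sphProd R l z • H z) :
    l.length ≤ n := by
  obtain ⟨h1, h2⟩ := lt_of_mul_eq_sq hr hR hRR
  have hR0 := hr.trans h1
  have hcl : DiffContOnCl ℂ (fun z => Quaternion.normSq (H z)) (Metric.ball 0 R) := by
    apply DifferentiableOn.diffContOnCl
    rw [closure_ball _ hR0.ne']
    exact hH.holo.normSq.mono (Metric.closedBall_subset_ball h2)
  have hb := Complex.norm_le_of_forall_mem_frontier_norm_le Metric.isBounded_ball hcl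
    (C := Real.exp n ^ 2) (fun z hz => by
      rw [frontier_ball _ hR0.ne', mem_sphere_zero_iff_norm] at hz
      have hz' : z ∈ Metric.ball (0 : ℂ) R' := by simpa [hz] using h2
      have h3 := norm_normSq_blaschkeProductStem hr hRR ha hu hz' hz
      rw [h z hz', Quaternion.normSq_smul, norm_mul, norm_pow, norm_sphProd hr hRR hl hz' hz,
        one_pow, one_mul] at h3
      exact h3.le) (subset_closure (Metric.mem_ball_self hR0))
  have h0 := normSq_blaschkeProductStem_zero hr hR hRR ha hu
  rw [h 0 (Metric.mem_ball_self (hR0.trans h2)), Quaternion.normSq_smul, sphProd_zero hR0 hl,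
    sq_div_sq_eq hr hR] at h0
  have h0 := congrArg norm h0
  rw [norm_mul, norm_pow, Complex.norm_real, Real.norm_eq_abs, abs_of_pos (by positivity),
    norm_one] at h0
  have h3 : 1 ≤ ((Real.exp (-2)) ^ l.length) ^ 2 * Real.exp n ^ 2 := by
    rw [← h0]
    exact mul_le_mul_of_nonneg_left hb (by positivity)
  rw [← mul_pow, ← Real.exp_nat_mul, ← Real.exp_add, ← Real.exp_nat_mul, Real.one_le_exp_iff] at h3
  push_cast at h3
  have h4 : (l.length : ℝ) ≤ n := by
    have : (0 : ℝ) ≤ l.length := Nat.cast_nonneg _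
    linarith
  exact_mod_cast h4

lemma exists_toC_eq_of_normSq_eq_zero (hr : 0 < r) (hRR : R' * r = R ^ 2) (hR0 : 0 < R)
    (ha : ∀ k, ‖a k‖ = r) (hu : ‖u‖ = 1) {z : ℂ} (hz : z ∈ Metric.ball (0 : ℂ) R')
    (h : Quaternion.normSq (blaschkeProductStem R u a z) = 0) :
    ∃ k, z = toC (a k) ∨ z = conj (toC (a k)) := by
  rw [normSq_blaschkeProductStem hr hRR ha hu hz, mul_eq_zero,
    or_iff_right (by exact_mod_cast (by positivity : Real.exp n ^ 2 ≠ 0)),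
    Finset.prod_eq_zero_iff] at h
  obtain ⟨k, -, hk⟩ := h
  have hd := den_ne_zero hr hRR (norm_toC_eq (ha k)) hz
  rw [sphBlaschke, div_eq_zero_iff, or_iff_left hd, mul_eq_zero,
    or_iff_right (by exact_mod_cast (by positivity : R ^ 2 ≠ 0)), quad_eq_zero] at hk
  exact ⟨k, hk⟩

/-- The extremal function is the product of a Blaschke product with spherical zeros and a function
without spherical zeros. -/
lemma exists_spherical_factorization (hr : 0 < r) (hR : R = Real.exp 1 * r)
    (hRR : R' * r = R ^ 2) (ha : ∀ k, ‖a k‖ = r) (hu : ‖u‖ = 1) :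
    ∃ (l : List ℂ) (H : ℂ → ℍ[ℂ]), (∀ w ∈ l, ‖w‖ = r) ∧ Stem R' H ∧
      (∀ z ∈ Metric.ball (0 : ℂ) R', blaschkeProductStem R u a z = sphProd R l z • H z) ∧
      ∀ z ∈ Metric.ball (0 : ℂ) R', z.im ≠ 0 → H z ≠ 0 := by
  obtain ⟨h1, h2⟩ := lt_of_mul_eq_sq hr hR hRR
  have hR0 := hr.trans h1
  -- A factorization of maximal length leaves no nonreal zero of the stem `H`, since such a zero
  -- would yield one more factor.
  set S : Set ℕ := {m | ∃ (l : List ℂ) (H : ℂ → ℍ[ℂ]), l.length = m ∧ (∀ w ∈ l, ‖w‖ = r) ∧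
    Stem R' H ∧ ∀ z ∈ Metric.ball (0 : ℂ) R', blaschkeProductStem R u a z = sphProd R l z • H z}
    with hS
  have hne : S.Nonempty := ⟨0, [], blaschkeProductStem R u a, rfl, by simp,
    stem_blaschkeProductStem hr hRR ha, fun z _ => by simp [sphProd]⟩
  have hbdd : BddAbove S := ⟨n, by
    rintro m ⟨l, H, rfl, hl, hH, h⟩
    exact length_le_of_factorization hr hR hRR ha hu hl hH h⟩
  obtain ⟨l, H, hlen, hl, hH, h⟩ := Nat.sSup_mem hne hbdd
  refine ⟨l, H, hl, hH, h, fun w hw hi h0 => ?_⟩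
  have hwr : ‖w‖ = r := by
    obtain ⟨k, hk⟩ := exists_toC_eq_of_normSq_eq_zero hr hRR hR0 ha hu hw
      (by rw [h w hw, h0, smul_zero, map_zero])
    rcases hk with rfl | rfl
    · exact norm_toC_eq (ha k)
    · rw [Complex.norm_conj]; exact norm_toC_eq (ha k)
  obtain ⟨G, hG, hGH⟩ := hH.div_quad hw hi h0
  have hmem : (w :: l).length ∈ S := by
    -- `quad w` is completed to a Blaschke factor by dividing it by `den R w / R ^ 2`; this
    -- nonvanishing function is put back into the remaining factor.
    refine ⟨w :: l, fun z => (den R w z / R ^ 2) • G z, rfl, ?_, ?_, ?_⟩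
    · intro v hv
      rcases List.mem_cons.1 hv with rfl | hv
      · exact hwr
      · exact hl v hv
    · refine hG.smul (c := fun z => den R w z / R ^ 2)
        ((differentiable_den R w).div_const _).differentiableOn fun z => ?_
      rw [den_conj, map_div₀, map_pow, Complex.conj_ofReal]
    · intro z hz
      have hd := den_ne_zero hr hRR hwr hz
      have hRc : (R : ℂ) ≠ 0 := by exact_mod_cast hR0.ne'
      rw [h z hz, hGH z hz, smul_smul, smul_smul, sphProd, sphProd, List.map_cons, List.prod_cons,
        sphBlaschke]
      congr 1
      field_simp
  have := le_csSup hbdd hmem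
  rw [← hlen, List.length_cons] at this
  omega

end extremal

lemma toC_eq_of_eq_conj {p q : ℍ} (h : toC p = conj (toC q)) : toC p = toC q := by
  have h1 := toC_im_nonneg p
  have h2 := toC_im_nonneg q
  have h3 := congrArg Complex.im h
  rw [Complex.conj_im] at h3
  rw [h, Complex.conj_eq_iff_im]
  linarith

/-- Two zeros on one nonreal sphere would make the stem vanish at its point, by `eq_of_ev_eq`. -/
lemma IsStem.eq_of_zeros {R : ℝ} {h : ℍ → ℍ} {H : ℂ → ℍ[ℂ]} (hh : IsStem R h H)
    (h0 : ∀ z ∈ Metric.ball (0 : ℂ) R, z.im ≠ 0 → H z ≠ 0) {p q : ℍ}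
    (hp : p ∈ Metric.ball (0 : ℍ) R) (hp0 : h p = 0) (hq : q ∈ Metric.ball (0 : ℍ) R)
    (hq0 : h q = 0) (hpq : toC p = toC q) : p = q := by
  obtain ⟨I, hI, hs⟩ := exists_slice_eq p
  obtain ⟨J, hJ, ht⟩ := exists_slice_eq q
  rw [hh.apply_eq hp hI hs] at hp0
  rw [hh.apply_eq hq hJ ht, ← hpq] at hq0
  by_cases hi : (toC p).im = 0
  · rw [← hs, ← ht, ← hpq, slice, slice, hi]; simp
  · by_cases hIJ : I = J
    · rw [← hs, ← ht, hpq, hIJ]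
    · exact absurd (eq_of_ev_eq hIJ (hp0.trans (ev_zero I).symm) (hq0.trans (ev_zero J).symm))
        (h0 _ (toC_mem_ball.2 hp) hi)

lemma eventually_ne_zero_of_finite {h : ℍ → ℍ} {U : Set ℍ} (hU : IsOpen U)
    (hfin : {q ∈ U | h q = 0}.Finite) {q : ℍ} (hq : q ∈ U) :
    ∀ᶠ p in nhdsWithin q {q}ᶜ, h p ≠ 0 := by
  have h1 : ∀ᶠ p in nhds q, p ∈ ({q ∈ U | h q = 0} \ {q})ᶜ :=
    (hfin.subset Set.sdiff_subset).isClosed.isOpen_compl.mem_nhds (by simp)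
  filter_upwards [nhdsWithin_le_nhds h1, nhdsWithin_le_nhds (hU.mem_nhds hq),
    self_mem_nhdsWithin] with p hp hpU hpq hp0
  exact hp ⟨⟨hpU, hp0⟩, hpq⟩

/-! ### Sharpness of the Jensen bound -/

section extremal
variable {r R R' : ℝ} {n : ℕ} {u : ℍ} {a : Fin n → ℍ}

lemma exists_isJensenFactorization_blaschkeProduct (hr : 0 < r) (hR : R = Real.exp 1 * r)
    (ha : ∀ k, ‖a k‖ = r) (hu : ‖u‖ = 1) :
    ∃ g h : ℍ → ℍ, IsJensenFactorization R (blaschkeProduct R u a) g h ∧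
      maxModulus g R * maxModulus h R = Real.exp n := by
  -- Regularity on this larger ball gives continuity up to `|q| = R` at once.
  set R' := R ^ 2 / r with hR'
  have hRR : R' * r = R ^ 2 := div_mul_cancel₀ _ hr.ne'
  obtain ⟨h1, h2⟩ := lt_of_mul_eq_sq hr hR hRR
  have hR0 := hr.trans h1
  have h00 : (0 : ℍ) ∈ Metric.ball (0 : ℍ) R' := Metric.mem_ball_self (hR0.trans h2)
  have h00c : (0 : ℂ) ∈ Metric.ball (0 : ℂ) R' := Metric.mem_ball_self (hR0.trans h2)
  obtain ⟨l, H, hl, hH, hfac, hne⟩ := exists_spherical_factorization hr hR hRR ha hu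
  -- Each scalar factor equals `r² / R² = e^(-2)` at `0`, so this constant normalizes `g(0)` to `1`.
  -- It cancels in the product of the maximum moduli.
  set c : ℝ := Real.exp 2 ^ l.length with hc
  have hc0 : 0 < c := by positivity
  have hcc : (c : ℂ) ≠ 0 := by exact_mod_cast hc0.ne'
  set C : ℂ → ℂ := fun z => c * sphProd R l z with hC
  have hCd : DifferentiableOn ℂ C (Metric.ball 0 R') :=
    (differentiableOn_sphProd hr hRR hl).const_mul _
  have hCc : ∀ z, C (conj z) = conj (C z) := fun z => by
    simp only [hC, sphProd_conj, map_mul, Complex.conj_ofReal]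
  have hCS : Stem R' (fun z => (C z : ℍ[ℂ])) :=
    ⟨Holo.coe hCd, fun z _ => by rw [hCc, conjC_coe]⟩
  have hGS : Stem R' (fun z => (c : ℂ)⁻¹ • H z) :=
    hH.smul (c := fun _ => (c : ℂ)⁻¹) (differentiableOn_const _)
      (fun z => by rw [map_inv₀, Complex.conj_ofReal])
  have hΦ : Stem R' (blaschkeProductStem R u a) := stem_blaschkeProductStem hr hRR ha
  have hφ : IsStem R' (blaschkeProduct R u a) (blaschkeProductStem R u a) :=
    isStem_blaschkeProduct R' R u a
  set g := ofStem fun z => (C z : ℍ[ℂ]) with hg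
  set h := ofStem fun z => (c : ℂ)⁻¹ • H z with hh
  have hgS := hCS.isStem_ofStem
  have hhS := hGS.isStem_ofStem
  rw [← hg] at hgS
  rw [← hh] at hhS
  have hgh : ∀ q ∈ Metric.ball (0 : ℍ) R', blaschkeProduct R u a q = g q * h q := fun q hq =>
    hφ.ext (hgS.coe_mul hhS) (fun z hz => by
      rw [hfac z hz, smul_smul]
      congr 1
      simp only [hC]
      field_simp) hq
  have hgn : ∀ q ∈ Metric.ball (0 : ℍ) R', ‖g q‖ = ‖C (toC q)‖ := fun q hq => by
    obtain ⟨I, hI, hs⟩ := exists_slice_eq q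
    rw [hgS.apply_eq hq hI hs, ← slice_eq_ev, norm_slice hI]
  have hg0 : ‖g 0‖ = 1 := by
    have ht : toC (0 : ℍ) = 0 := by rw [← norm_eq_zero, norm_toC, norm_zero]
    have : c * (r ^ 2 / R ^ 2) ^ l.length = 1 := by
      rw [hc, ← mul_pow, sq_div_sq_eq hr hR, ← Real.exp_add]; norm_num
    rw [hgn 0 h00, ht]
    simp only [hC]
    rw [sphProd_zero hR0 hl, ← Complex.ofReal_mul, this, Complex.ofReal_one, norm_one]
  have hφ0 : ‖blaschkeProduct R u a 0‖ = 1 := by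
    have h3 := Stem.normSq_zero (hR0.trans h2) hφ
    rw [normSq_blaschkeProductStem_zero hr hR hRR ha hu] at h3
    have h4 : ‖blaschkeProduct R u a 0‖ ^ 2 = 1 := by exact_mod_cast h3.symm
    exact (pow_eq_one_iff_of_nonneg (norm_nonneg _) two_ne_zero).1 h4
  have hsph : ∀ q ∈ Metric.sphere (0 : ℍ) R, q ∈ Metric.ball (0 : ℍ) R' := fun q hq => by
    rw [mem_sphere_zero_iff_norm] at hq
    rwa [mem_ball_zero_iff, hq]
  have hgs : ∀ q ∈ Metric.sphere (0 : ℍ) R, ‖g q‖ = c := fun q hq => by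
    rw [hgn q (hsph q hq)]
    simp only [hC]
    rw [norm_mul, norm_sphProd hr hRR hl (toC_mem_ball.2 (hsph q hq)) (by simpa using hq), mul_one,
      Complex.norm_real, Real.norm_eq_abs, abs_of_pos hc0]
  have hhs : ∀ q ∈ Metric.sphere (0 : ℍ) R, ‖h q‖ = Real.exp n / c := fun q hq => by
    obtain ⟨I, hI, hs⟩ := exists_slice_eq q
    have h3 := norm_ev_blaschkeProductStem (u := u) hr hR0 hRR ha hu
      (toC_mem_ball.2 (hsph q hq)) (by simpa using hq) hI
    rw [← hφ.apply_eq (hsph q hq) hI hs, hgh q (hsph q hq), norm_mul, hgs q hq] at h3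
    rw [← h3, mul_div_cancel_left₀ _ hc0.ne']
  have hfin : {q ∈ Metric.ball (0 : ℍ) R' | h q = 0}.Finite := by
    -- A zero of `h` is a zero of the extremal function, hence lies on the sphere of some `a k`, and
    -- each sphere holds at most one zero of `h`.
    refine Set.Finite.of_injOn (f := toC) (t := Set.range fun k => toC (a k)) ?_ ?_
      (Set.finite_range _)
    · rintro q ⟨hq, hq0⟩
      obtain ⟨I, hI, hs⟩ := exists_slice_eq q
      have h3 := hgh q hq
      rw [hq0, mul_zero, hφ.apply_eq hq hI hs] at h3
      obtain ⟨k, hk⟩ := exists_toC_eq_of_normSq_eq_zero hr hRR hR0 ha hu (toC_mem_ball.2 hq)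
        (normSq_eq_zero_of_ev hI h3)
      exact ⟨k, (hk.elim id toC_eq_of_eq_conj).symm⟩
    · rintro p ⟨hp, hp0⟩ q ⟨hq, hq0⟩ hpq
      exact hhS.eq_of_zeros (fun z hz hi => smul_ne_zero (inv_ne_zero hcc) (hne z hz hi))
        hp hp0 hq hq0 hpq
  refine ⟨g, h, ⟨?_, (hCS.mono h2.le).regular, (hGS.mono h2.le).regular, ?_, ?_, ?_, ?_, ?_, hg0,
    ?_⟩, ?_⟩
  · exact sliceRegularOn_of_isStem (hφ.mono h2.le) (hΦ.mono h2.le).holo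
  · exact hCS.regular.continuousOn.mono (Metric.closedBall_subset_ball h2)
  · exact hGS.regular.continuousOn.mono (Metric.closedBall_subset_ball h2)
  · exact fun q hq => hgh q (Metric.ball_subset_ball h2.le hq)
  · intro q hq hq0 p hp
    rw [mem_sphereOf] at hp
    have hq' := Metric.ball_subset_ball h2.le hq
    have hp' : p ∈ Metric.ball (0 : ℍ) R' := by rw [← toC_mem_ball, hp, toC_mem_ball]; exact hq'
    rw [← norm_eq_zero, hgn p hp', hp, ← hgn q hq', hq0, norm_zero]
  · intro q hq _
    exact eventually_ne_zero_of_finite Metric.isOpen_ball hfin (Metric.ball_subset_ball h2.le hq)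
  · have h3 := hgh 0 h00
    have h4 := congrArg norm h3
    rw [hφ0, norm_mul, hg0, one_mul] at h4
    exact h4.symm
  · rw [maxModulus_eq hR0.le hgs, maxModulus_eq hR0.le hhs, mul_div_cancel₀ _ hc0.ne']

lemma le_zeroCount_blaschkeProduct (hr : 0 < r) (hR : R = Real.exp 1 * r)
    (ha : ∀ k, ‖a k‖ = r) (hu : ‖u‖ = 1) :
    n ≤ zeroCount (blaschkeProduct R u a) (Metric.ball 0 R) (Metric.closedBall 0 r) := by
  classical
  set R' := R ^ 2 / r with hR'
  have hRR : R' * r = R ^ 2 := div_mul_cancel₀ _ hr.ne'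
  obtain ⟨h1, h2⟩ := lt_of_mul_eq_sq hr hR hRR
  have hR0 := hr.trans h1
  have hΦ : Stem R (blaschkeProductStem R u a) := (stem_blaschkeProductStem hr hRR ha).mono h2.le
  have hφ : IsStem R (blaschkeProduct R u a) (blaschkeProductStem R u a) :=
    isStem_blaschkeProduct R R u a
  set D : ℂ → ℂ := fun z => Quaternion.normSq (blaschkeProductStem R u a z) with hD
  set Z : Finset ℂ := Finset.univ.image fun k => toC (a k) with hZ
  have hZr : ∀ z ∈ Z, ‖z‖ = r ∧ 0 ≤ z.im := fun z hz => by
    obtain ⟨k, -, rfl⟩ := Finset.mem_image.1 hz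
    exact ⟨norm_toC_eq (ha k), toC_im_nonneg _⟩
  have key : ∀ z ∈ Z, ((Finset.univ.filter fun k => toC (a k) = z).card : ℕ∞) ≤
      (isolatedFiber (blaschkeProduct R u a) (Metric.ball 0 R) z).encard +
      2 * (sphericalFiber (blaschkeProduct R u a) (Metric.ball 0 R) z).encard := by
    intro z hz
    obtain ⟨hzr, hi⟩ := hZr z hz
    have hzR : z ∈ Metric.ball (0 : ℂ) R := by rwa [mem_ball_zero_iff, hzr]
    have hzR' : z ∈ Metric.ball (0 : ℂ) R' := Metric.ball_subset_ball h2.le hzR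
    have hnt : analyticOrderAt D z ≠ ⊤ := hΦ.analyticOrderAt_ne_top (by
      rw [normSq_blaschkeProductStem_zero hr hR hRR ha hu]; exact one_ne_zero) hzR
    obtain ⟨N, hN⟩ := ENat.ne_top_iff_exists.1 hnt
    obtain ⟨c, hc, hNc⟩ := encard_fibers hΦ hφ hzR hi hN.symm
    rw [hc]
    set K := Finset.univ.filter fun k => toC (a k) = z with hK
    -- What remains of `D` after extracting one factor `quad z` for every `a k` on the sphere of
    -- `z`. Only the lower bound for the order of `D` at `z` is needed, so `E` may vanish there.
    set E : ℂ → ℂ := fun v => ((Real.exp n ^ 2 : ℝ) : ℂ) * ((R : ℂ) ^ 2 / den R z v) ^ K.card *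
      ∏ k ∈ Finset.univ.filter fun k => ¬ toC (a k) = z, sphBlaschke R (toC (a k)) v with hE
    have hEd : DifferentiableOn ℂ E (Metric.ball 0 R') := by
      refine ((((differentiableOn_const _).div (differentiable_den R z).differentiableOn
        fun v hv => den_ne_zero hr hRR hzr hv).pow _).const_mul _).mul ?_
      exact DifferentiableOn.fun_finsetProd fun k _ =>
        differentiableOn_sphBlaschke hr hRR (norm_toC_eq (ha k))
    have hDE : ∀ᶠ v in nhds z, D v = quad z v ^ K.card * E v := by
      filter_upwards [Metric.isOpen_ball.mem_nhds hzR'] with v hv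
      simp only [hD, hE]
      rw [normSq_blaschkeProductStem hr hRR ha hu hv,
        ← Finset.prod_filter_mul_prod_filter_not Finset.univ fun k => toC (a k) = z,
        Finset.prod_congr rfl fun k hk => by rw [(Finset.mem_filter.1 hk).2],
        Finset.prod_const, ← hK, sphBlaschke, mul_div_right_comm, mul_pow]
      ring
    have hord := analyticOrderAt_of_eq_pow_mul (analyticAt_quad z z)
      (hEd.analyticAt (Metric.isOpen_ball.mem_nhds hzR')) hDE
    rw [← hN, analyticOrderAt_quad, hNc] at hord
    have hle : ((K.card * (if z.im = 0 then 2 else 1) : ℕ) : ℕ∞) ≤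
        (((if z.im = 0 then 2 else 1) * c : ℕ) : ℕ∞) := by
      rw [hord, nsmul_eq_mul, Nat.cast_mul]
      exact le_self_add
    have hle' : K.card * (if z.im = 0 then 2 else 1) ≤ (if z.im = 0 then 2 else 1) * c := by
      exact_mod_cast hle
    rw [mul_comm] at hle'
    exact_mod_cast Nat.le_of_mul_le_mul_left hle' (by split_ifs <;> norm_num)
  have hn : n = ∑ z ∈ Z, (Finset.univ.filter fun k => toC (a k) = z).card := by
    rw [← Finset.card_eq_sum_card_fiberwise fun k _ => Finset.mem_image_of_mem _ (Finset.mem_univ k),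
      Finset.card_univ, Fintype.card_fin]
  calc (n : ℕ∞) = ∑ z ∈ Z, ((Finset.univ.filter fun k => toC (a k) = z).card : ℕ∞) := by
        rw [← Nat.cast_sum, ← hn]
    _ ≤ _ := Finset.sum_le_sum key
    _ ≤ _ := sum_le_zeroCount Z fun q hq => by
        have := (hZr _ hq).1
        rw [norm_toC] at this
        rw [mem_closedBall_zero_iff, this]

/-- The Blaschke products attain the bound in the Jensen inequality. -/
theorem exists_jensen_equality (hr : 0 < r) (a : Fin n → ℍ) (u : ℍ) (ha : ∀ k, ‖a k‖ = r)
    (hu : ‖u‖ = 1) :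
    ∃ g h : ℍ → ℍ,
      IsJensenFactorization (Real.exp 1 * r) (blaschkeProduct (Real.exp 1 * r) u a) g h ∧
      zeroCount (blaschkeProduct (Real.exp 1 * r) u a) (Metric.ball 0 (Real.exp 1 * r))
        (Metric.closedBall 0 r) = n ∧
      (n : ℝ) = Real.log (maxModulus g (Real.exp 1 * r) * maxModulus h (Real.exp 1 * r)) := by
  obtain ⟨g, h, hgh, hM⟩ := exists_isJensenFactorization_blaschkeProduct hr rfl ha hu
  have hlog : (n : ℝ) =
      Real.log (maxModulus g (Real.exp 1 * r) * maxModulus h (Real.exp 1 * r)) := by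
    rw [hM, Real.log_exp]
  -- The upper bound on the number of zeros comes from the inequality whose sharpness is being
  -- shown.
  obtain ⟨m, hm, hle⟩ := jensen_inequality hr hgh
  refine ⟨g, h, hgh, ?_, hlog⟩
  rw [← hlog] at hle
  have h1 : m ≤ n := by exact_mod_cast hle
  have h2 := le_zeroCount_blaschkeProduct (r := r) hr rfl ha hu
  rw [hm] at h2 ⊢
  have h3 : n ≤ m := by exact_mod_cast h2
  rw [le_antisymm h1 h3]

end extremal

end SliceRegular

end

/-- Jensen inequality for slice regular functions, and its sharpness. The zeros are counted both in
the open ball `|q| < r` (with value `m`) and in the closed ball `|q| ≤ r` (with value `n`). -/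
theorem mainTheorem3 (r : ℝ) (hr : 0 < r) :
    (∀ f g h : ℍ → ℍ, SliceRegular.IsJensenFactorization (Real.exp 1 * r) f g h →
      ∃ m n : ℕ,
        SliceRegular.zeroCount f (Metric.ball 0 (Real.exp 1 * r)) (Metric.ball 0 r) = m ∧
        SliceRegular.zeroCount f (Metric.ball 0 (Real.exp 1 * r)) (Metric.closedBall 0 r) = n ∧
        m ≤ n ∧
        (n : ℝ) ≤ Real.log (SliceRegular.maxModulus g (Real.exp 1 * r) *
          SliceRegular.maxModulus h (Real.exp 1 * r))) ∧
    (∀ (n : ℕ) (a : Fin n → ℍ) (u : ℍ), (∀ k, ‖a k‖ = r) → ‖u‖ = 1 →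
      ∃ g h : ℍ → ℍ,
        SliceRegular.IsJensenFactorization (Real.exp 1 * r)
          (SliceRegular.blaschkeProduct (Real.exp 1 * r) u a) g h ∧
        SliceRegular.zeroCount (SliceRegular.blaschkeProduct (Real.exp 1 * r) u a)
          (Metric.ball 0 (Real.exp 1 * r)) (Metric.closedBall 0 r) = n ∧
        (n : ℝ) = Real.log (SliceRegular.maxModulus g (Real.exp 1 * r) *
          SliceRegular.maxModulus h (Real.exp 1 * r))) := by
  refine ⟨fun f g h hfgh => ?_, fun n a u ha hu => SliceRegular.exists_jensen_equality hr a u ha hu⟩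
  obtain ⟨n, hn, hle⟩ := SliceRegular.jensen_inequality hr hfgh
  obtain ⟨m, hm, hmn⟩ := ENat.le_natCast_iff.1 (hn ▸ SliceRegular.zeroCount_mono
    (f := f) (U := Metric.ball 0 (Real.exp 1 * r)) (Metric.ball_subset_closedBall (x := 0) (ε := r)))
  exact ⟨m, n, hm, hn, hmn, hle⟩
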